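/- Let $n\ge 1$. For a function $u$ on an open subset of $\mathbb C^n$ write $u_{i\bar j}=\partial^2u/\partial z_i\partial\bar z_j$, $u_{i\bar jk}=\partial^3u/\partial z_i\partial\bar z_j\partial z_k$, $\Delta u=\sum_i u_{i\bar i}$, and let $B_\rho\subset\mathbb C^n$ be the open Euclidean ball of radius $\rho$ centred at $0$; inequalities between Hermitian matrices are in the sense of quadratic forms. (a) There is a constant $C(n)>0$ depending only on $n$ such that the following holds. Let $r>0$, let $u\in C^5(B_r)$ be real-valued and plurisubharmonic, let $\varphi\in C^3(B_r)$ be real-valued, and suppose that $\det(u_{i\bar j})=e^{\varphi}$ on $B_r$. Let $\lambda>0$ and $\Lambda,M,N\in\mathbb R$ be constants such that on $B_r$ $$\lambda I_n\le(u_{i\bar j})\le\Lambda I_n,\qquad -Mr^{-2}I_n\le(\varphi_{i\bar j})\le Mr^{-2}I_n,\qquad \Big(\sum_{i,j,k}|\varphi_{i\bar jk}|^2\Big)^{1/2}\le Nr^{-3}.$$ Then on $B_{r/2}$ $$\sum_{i,j,k}|u_{i\bar jk}|^2\le C(n)\,\lambda^{-1}\Lambda^3\Big((1+M)^{-2}N^2+\lambda^{-1}\Lambda(1+M)\Big)r^{-2}.$$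 (b) There is a constant $C(n)>0$ depending only on $n$ such that the following holds. For a bounded domain $\Omega\subset\mathbb C^n$ put $d_x=\operatorname{dist}(x,\partial\Omega)$ and $[g]^*_{k;\Omega}=\sup_{x\in\Omega}d_x^k|\nabla^kg(x)|\in[0,\infty]$, where $\nabla^k g$ is the $k$-th real derivative and $|\cdot|$ its norm as a multilinear map. Let $u\in C^5(\Omega)$ be real-valued and plurisubharmonic, and suppose that $\det(u_{i\bar j})=f$ on $\Omega$, where $f\in C^3(\Omega)$ is real-valued and $f\ge m$ for a constant $m>0$. If $\Delta u\le K$ on $\Omega$ and $[\log f]^*_{2;\Omega}+[\log f]^*_{3;\Omega}\le L$, with real constants $K$ and $L\ge 0$, then for all $i,j$ $$[u_{i\bar j}]^*_{1;\Omega}\le C(n)\,K^{n+1}m^{-1}\big(1+L^{1/2}\big).$$ -/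

import Mathlib

open scoped ComplexOrder ENNReal

noncomputable section

namespace ComplexMA

/-- Complex Euclidean space `ℂⁿ`, with the Euclidean norm. -/
abbrev Cn (n : ℕ) : Type := EuclideanSpace ℂ (Fin n)

/-- The Wirtinger derivative `∂g/∂zₖ = (1/2) (∂g/∂xₖ - i ∂g/∂yₖ)`; here `fderiv ℝ` is the real
Fréchet derivative, `eₖ` is the direction of `xₖ` and `i eₖ` that of `yₖ`. -/
def dz {n : ℕ} (k : Fin n) (g : Cn n → ℂ) (z : Cn n) : ℂ :=
  (1 / 2 : ℂ) * (fderiv ℝ g z (EuclideanSpace.single k 1)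
    - Complex.I * fderiv ℝ g z (EuclideanSpace.single k Complex.I))

/-- The Wirtinger derivative `∂g/∂z̄ₖ = (1/2) (∂g/∂xₖ + i ∂g/∂yₖ)`. -/
def dzbar {n : ℕ} (k : Fin n) (g : Cn n → ℂ) (z : Cn n) : ℂ :=
  (1 / 2 : ℂ) * (fderiv ℝ g z (EuclideanSpace.single k 1)
    + Complex.I * fderiv ℝ g z (EuclideanSpace.single k Complex.I))

/-- `u_{i j̄} = ∂²u / ∂zᵢ ∂z̄ⱼ` of a real-valued function. -/
def mixed {n : ℕ} (u : Cn n → ℝ) (i j : Fin n) : Cn n → ℂ :=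
  dzbar j (dz i (fun w => (u w : ℂ)))

/-- `u_{i j̄ k} = ∂³u / ∂zᵢ ∂z̄ⱼ ∂zₖ` of a real-valued function. -/
def mixed3 {n : ℕ} (u : Cn n → ℝ) (i j k : Fin n) : Cn n → ℂ :=
  dz k (mixed u i j)

/-- The complex Hessian matrix `(u_{i j̄})` at a point. -/
def complexHessian {n : ℕ} (u : Cn n → ℝ) (z : Cn n) : Matrix (Fin n) (Fin n) ℂ :=
  Matrix.of fun i j => mixed u i j z

/-- The complex Laplacian `Δu = ∑ᵢ u_{i ī}` (a real number whenever `u` is `C²`). -/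
def complexLaplacian {n : ℕ} (u : Cn n → ℝ) (z : Cn n) : ℝ :=
  (complexHessian u z).trace.re

/-- `a I ≤ A ≤ b I` in the order of Hermitian matrices. -/
def MatrixBetween {n : ℕ} (a b : ℝ) (A : Matrix (Fin n) (Fin n) ℂ) : Prop :=
  (A - (a : ℂ) • (1 : Matrix (Fin n) (Fin n) ℂ)).PosSemidef ∧
    ((b : ℂ) • (1 : Matrix (Fin n) (Fin n) ℂ) - A).PosSemidef

/-- A real-valued function is plurisubharmonic on `Ω` if it is upper semicontinuous and satisfies
the sub-mean value inequality on every closed complex disc contained in `Ω`. The integrability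
clause makes the circle average a genuine one (for finite-valued functions it is automatic). -/
def PlurisubharmonicOn {n : ℕ} (u : Cn n → ℝ) (Ω : Set (Cn n)) : Prop :=
  UpperSemicontinuousOn u Ω ∧
    ∀ z w : Cn n, (∀ ζ : ℂ, ‖ζ‖ ≤ 1 → z + ζ • w ∈ Ω) →
      CircleIntegrable (fun ζ : ℂ => u (z + ζ • w)) 0 1 ∧
        u z ≤ Real.circleAverage (fun ζ : ℂ => u (z + ζ • w)) 0 1

/-- The weighted seminorm `[g]*_{k;Ω} = sup_{x ∈ Ω} d_x^k |∇ᵏ g(x)|`, `d_x = dist(x, ∂Ω)`,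
with values in `[0, ∞]`. -/
def starSeminorm {n : ℕ} {F : Type} [NormedAddCommGroup F] [NormedSpace ℝ F]
    (k : ℕ) (Ω : Set (Cn n)) (g : Cn n → F) : ℝ≥0∞ :=
  ⨆ x ∈ Ω, ENNReal.ofReal (Metric.infDist x (frontier Ω) ^ k * ‖iteratedFDeriv ℝ k g x‖)

end ComplexMA

end

/-! Both estimates come from Calabi's third order computation and the maximum principle. Write g for
the Kähler metric (u_{i j̄}), s for the tensor u_{i j̄ k}, and S for the squared norm of s in the
metric g (`calabi`). Differentiating log det g = φ twice and three times turns the traced curvature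
of g into φ_{i j̄} (`hessian_log_det`) and the traced mixed derivative of s into φ_{i j̄ k}
(`third_log_det`). The result is `bochner_formula`: Δ_g S = |∇s|² + |∇̄s|² + 2 Re⟨s, ∂∂̄∂φ⟩ - ⟨Φs,
s⟩, where Φ lets (φ_{i j̄}) act on each of the three slots.

The right side has no positive multiple of S. That is supplied by Δ_g(Δu) ≥ λS - nM/r²
(`trace_laplacian`). So the test function is η²S + AΔu with a quadratic cutoff η. At an interior
maximum the cross terms between ∂η and ∇s are absorbed by the squares in the Bochner formula
(`cutoff_cross_term`), and the Laplacian term with A of order (1+M)/(λ²r²) dominates all other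
multiples of S (`calabi_le_at_max`). Comparing the maximum with the value on the half ball bounds S
there, and returning to the Euclidean norm costs Λ³ (`nsq_thirdE_le_calabi`). This is
`interior_estimate`.

Normal coordinates are avoided. At the point considered a constant frame makes g the identity
(`exists_normalizing_frame`); the first derivatives of g remain, and completing squares
(`bochner_algebra`) assembles them into covariant derivatives. S does not depend on the frame
(`calabi_frame`), so the test function is globally defined while each pointwise computation uses its
own frame.

On a domain, plurisubharmonicity makes the complex Hessian nonnegative
(`PlurisubharmonicOn.levi_nonneg`). Its trace and determinant then confine the eigenvalues to
[m/K^{n-1}, K] (`matrixBetween_of_trace_det`). The ball estimate with φ = log f on the ball of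
radius d_x/2 gives the weighted bound (`starSeminorm_mixed_le`). -/

noncomputable section

namespace ComplexMA

open Filter Topology ComplexConjugate

/-! ### Wirtinger calculus in arbitrary directions, and second order jets -/

section wirtinger

variable {n : ℕ}

/-- The Wirtinger derivative `∂_v` in the complex direction `v`. -/
def wirt (v : Cn n) (f : Cn n → ℂ) (z : Cn n) : ℂ :=
  (1 / 2 : ℂ) * (fderiv ℝ f z v - Complex.I * fderiv ℝ f z (Complex.I • v))

/-- The Wirtinger derivative `∂̄_v` in the complex direction `v`. -/
def wirtBar (v : Cn n) (f : Cn n → ℂ) (z : Cn n) : ℂ :=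
  (1 / 2 : ℂ) * (fderiv ℝ f z v + Complex.I * fderiv ℝ f z (Complex.I • v))

lemma I_smul_single (k : Fin n) :
    (Complex.I • EuclideanSpace.single k (1 : ℂ) : Cn n) = EuclideanSpace.single k Complex.I := by
  ext i; by_cases h : i = k <;> simp [h]

lemma dz_eq_wirt (k : Fin n) (f : Cn n → ℂ) : dz k f = wirt (EuclideanSpace.single k 1) f := by
  funext z; simp only [dz, wirt, I_smul_single]

lemma dzbar_eq_wirtBar (k : Fin n) (f : Cn n → ℂ) :
    dzbar k f = wirtBar (EuclideanSpace.single k 1) f := by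
  funext z; simp only [dzbar, wirtBar, I_smul_single]

section calculus

variable {f g : Cn n → ℂ} {x : Cn n} {v w : Cn n}

lemma fderiv_apply_eq_wirt_add (f : Cn n → ℂ) (x v : Cn n) :
    fderiv ℝ f x v = wirt v f x + wirtBar v f x := by
  simp only [wirt, wirtBar]; ring

lemma fderiv_smul_eq (f : Cn n → ℂ) (x v : Cn n) (c : ℂ) :
    fderiv ℝ f x (c • v) = c.re * fderiv ℝ f x v + c.im * fderiv ℝ f x (Complex.I • v) := by
  have h : c • v = (c.re : ℝ) • v + (c.im : ℝ) • (Complex.I • v) := by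
    ext i
    simp only [PiLp.smul_apply, PiLp.add_apply, smul_eq_mul, Complex.real_smul]
    conv_lhs => rw [← Complex.re_add_im c]
    ring
  rw [h, map_add, map_smul, map_smul]; simp

/-- The operator picks the complex linear part of the real derivative. Together with the conjugate
linearity of `wirtBar`, this makes a change of frame act by T on unbarred indices and by its
conjugate on barred ones. -/
lemma wirt_smul (c : ℂ) : wirt (c • v) f x = c * wirt v f x := by
  unfold wirt
  rw [smul_smul, fderiv_smul_eq f x v c, fderiv_smul_eq f x v (Complex.I * c)]
  have hI := Complex.I_mul_I
  simp only [Complex.mul_re, Complex.mul_im, Complex.I_re, Complex.I_im]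
  conv_rhs => rw [← Complex.re_add_im c]
  push_cast
  linear_combination ((1/2 : ℂ) * c.im * fderiv ℝ f x (Complex.I • v)) * hI

lemma wirtBar_smul (c : ℂ) : wirtBar (c • v) f x = conj c * wirtBar v f x := by
  unfold wirtBar
  rw [smul_smul, fderiv_smul_eq f x v c, fderiv_smul_eq f x v (Complex.I * c)]
  have hI := Complex.I_mul_I
  have : conj c = c.re - c.im * Complex.I := by
    apply Complex.ext <;> simp
  simp only [Complex.mul_re, Complex.mul_im, Complex.I_re, Complex.I_im, this]
  push_cast
  linear_combination ((1/2 : ℂ) * c.im * fderiv ℝ f x (Complex.I • v)) * hI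

lemma wirt_add_dir : wirt (v + w) f x = wirt v f x + wirt w f x := by
  simp only [wirt, smul_add, map_add]; ring

lemma wirtBar_add_dir : wirtBar (v + w) f x = wirtBar v f x + wirtBar w f x := by
  simp only [wirtBar, smul_add, map_add]; ring

lemma wirt_sum_dir {ι : Type*} (s : Finset ι) (c : ι → ℂ) (e : ι → Cn n) :
    wirt (∑ i ∈ s, c i • e i) f x = ∑ i ∈ s, c i * wirt (e i) f x := by
  classical
  induction s using Finset.induction_on with
  | empty => simp [wirt]
  | insert a s ha ih => rw [Finset.sum_insert ha, Finset.sum_insert ha, wirt_add_dir, wirt_smul, ih]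

lemma wirtBar_sum_dir {ι : Type*} (s : Finset ι) (c : ι → ℂ) (e : ι → Cn n) :
    wirtBar (∑ i ∈ s, c i • e i) f x = ∑ i ∈ s, conj (c i) * wirtBar (e i) f x := by
  classical
  induction s using Finset.induction_on with
  | empty => simp [wirtBar]
  | insert a s ha ih =>
    rw [Finset.sum_insert ha, Finset.sum_insert ha, wirtBar_add_dir, wirtBar_smul, ih]

lemma wirt_congr (h : f =ᶠ[𝓝 x] g) : wirt v f x = wirt v g x := by
  simp only [wirt, h.fderiv_eq]

lemma wirtBar_congr (h : f =ᶠ[𝓝 x] g) : wirtBar v f x = wirtBar v g x := by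
  simp only [wirtBar, h.fderiv_eq]

lemma wirtBar_eventuallyEq (h : f =ᶠ[𝓝 x] g) : wirtBar v f =ᶠ[𝓝 x] wirtBar v g := by
  filter_upwards [h.eventuallyEq_nhds] with y hy using wirtBar_congr hy

lemma wirt_const (c : ℂ) : wirt v (fun _ => c) x = 0 := by simp [wirt]

lemma wirtBar_const (c : ℂ) : wirtBar v (fun _ => c) x = 0 := by simp [wirtBar]

lemma wirt_add (hf : DifferentiableAt ℝ f x) (hg : DifferentiableAt ℝ g x) :
    wirt v (fun y => f y + g y) x = wirt v f x + wirt v g x := by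
  simp only [wirt, fderiv_fun_add hf hg, add_apply]; ring

lemma wirtBar_add (hf : DifferentiableAt ℝ f x) (hg : DifferentiableAt ℝ g x) :
    wirtBar v (fun y => f y + g y) x = wirtBar v f x + wirtBar v g x := by
  simp only [wirtBar, fderiv_fun_add hf hg, add_apply]; ring

lemma wirt_mul (hf : DifferentiableAt ℝ f x) (hg : DifferentiableAt ℝ g x) :
    wirt v (fun y => f y * g y) x = wirt v f x * g x + f x * wirt v g x := by
  simp only [wirt, fderiv_fun_mul hf hg, add_apply,
    smul_apply, smul_eq_mul]; ring

lemma wirtBar_mul (hf : DifferentiableAt ℝ f x) (hg : DifferentiableAt ℝ g x) :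
    wirtBar v (fun y => f y * g y) x = wirtBar v f x * g x + f x * wirtBar v g x := by
  simp only [wirtBar, fderiv_fun_mul hf hg, add_apply,
    smul_apply, smul_eq_mul]; ring

lemma wirt_sum {ι : Type*} (s : Finset ι) (F : ι → Cn n → ℂ)
    (hF : ∀ i ∈ s, DifferentiableAt ℝ (F i) x) :
    wirt v (fun y => ∑ i ∈ s, F i y) x = ∑ i ∈ s, wirt v (F i) x := by
  simp only [wirt, fderiv_fun_sum hF, sum_apply, Finset.mul_sum,
    ← Finset.sum_sub_distrib]

lemma wirtBar_sum {ι : Type*} (s : Finset ι) (F : ι → Cn n → ℂ)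
    (hF : ∀ i ∈ s, DifferentiableAt ℝ (F i) x) :
    wirtBar v (fun y => ∑ i ∈ s, F i y) x = ∑ i ∈ s, wirtBar v (F i) x := by
  simp only [wirtBar, fderiv_fun_sum hF, sum_apply, Finset.mul_sum,
    ← Finset.sum_add_distrib]

lemma fderiv_conj (f : Cn n → ℂ) (x v : Cn n) :
    fderiv ℝ (fun y => conj (f y)) x v = conj (fderiv ℝ f x v) := by
  have := (Complex.conjLIE.toContinuousLinearEquiv).comp_fderiv (f := f) (x := x)
  have h2 : (fun y => conj (f y)) = (⇑Complex.conjLIE.toContinuousLinearEquiv) ∘ f := by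
    funext y; simp
  rw [h2, this]; simp

lemma wirt_conj : wirt v (fun y => conj (f y)) x = conj (wirtBar v f x) := by
  simp only [wirt, wirtBar, fderiv_conj, map_mul, map_add, Complex.conj_I,
    map_div₀, map_one, map_ofNat]
  ring

lemma wirtBar_conj : wirtBar v (fun y => conj (f y)) x = conj (wirt v f x) := by
  simp only [wirt, wirtBar, fderiv_conj, map_mul, map_sub, Complex.conj_I,
    map_div₀, map_one, map_ofNat]
  ring

lemma contDiffAt_fderiv_apply {k : ℕ} (hf : ContDiffAt ℝ (k + 1 : ℕ) f x) (v : Cn n) :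
    ContDiffAt ℝ k (fun y => fderiv ℝ f y v) x :=
  (hf.fderiv_right (m := k) (by norm_cast)).clm_apply contDiffAt_const

lemma contDiffAt_wirt {k : ℕ} (hf : ContDiffAt ℝ (k + 1 : ℕ) f x) (v : Cn n) :
    ContDiffAt ℝ k (wirt v f) x :=
  contDiffAt_const.mul ((contDiffAt_fderiv_apply hf v).sub
    (contDiffAt_const.mul (contDiffAt_fderiv_apply hf (Complex.I • v))))

lemma contDiffAt_wirtBar {k : ℕ} (hf : ContDiffAt ℝ (k + 1 : ℕ) f x) (v : Cn n) :
    ContDiffAt ℝ k (wirtBar v f) x :=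
  contDiffAt_const.mul ((contDiffAt_fderiv_apply hf v).add
    (contDiffAt_const.mul (contDiffAt_fderiv_apply hf (Complex.I • v))))

lemma differentiableAt_fderiv (hf : ContDiffAt ℝ 2 f x) : DifferentiableAt ℝ (fderiv ℝ f) x :=
  (hf.fderiv_right (m := 1) (by norm_num)).differentiableAt (by norm_num)

lemma fderiv_fderiv_apply (hf : ContDiffAt ℝ 2 f x) (v w : Cn n) :
    fderiv ℝ (fun y => fderiv ℝ f y v) x w = fderiv ℝ (fderiv ℝ f) x w v := by
  rw [fderiv_clm_apply (differentiableAt_fderiv hf) (by fun_prop)]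
  simp

lemma fderiv_fderiv_comm (hf : ContDiffAt ℝ 2 f x) (v w : Cn n) :
    fderiv ℝ (fderiv ℝ f) x v w = fderiv ℝ (fderiv ℝ f) x w v :=
  (hf.isSymmSndFDerivAt (by simp)) v w

lemma fderiv_wirt (hf : ContDiffAt ℝ 2 f x) (v w : Cn n) :
    fderiv ℝ (wirt v f) x w = (1 / 2 : ℂ) * (fderiv ℝ (fderiv ℝ f) x w v
      - Complex.I * fderiv ℝ (fderiv ℝ f) x w (Complex.I • v)) := by
  have hd : ∀ v, DifferentiableAt ℝ (fun y => fderiv ℝ f y v) x := fun v =>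
    (differentiableAt_fderiv hf).clm_apply (by fun_prop)
  unfold wirt
  rw [fderiv_const_mul ((hd v).fun_sub ((hd _).const_mul _)),
    fderiv_fun_sub (hd v) ((hd _).const_mul _), fderiv_const_mul (hd _)]
  simp [fderiv_fderiv_apply hf]

lemma fderiv_wirtBar (hf : ContDiffAt ℝ 2 f x) (v w : Cn n) :
    fderiv ℝ (wirtBar v f) x w = (1 / 2 : ℂ) * (fderiv ℝ (fderiv ℝ f) x w v
      + Complex.I * fderiv ℝ (fderiv ℝ f) x w (Complex.I • v)) := by
  have hd : ∀ v, DifferentiableAt ℝ (fun y => fderiv ℝ f y v) x := fun v =>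
    (differentiableAt_fderiv hf).clm_apply (by fun_prop)
  unfold wirtBar
  rw [fderiv_const_mul ((hd v).fun_add ((hd _).const_mul _)),
    fderiv_fun_add (hd v) ((hd _).const_mul _), fderiv_const_mul (hd _)]
  simp [fderiv_fderiv_apply hf, mul_add]

lemma wirt_wirtBar_comm (hf : ContDiffAt ℝ 2 f x) :
    wirt v (wirtBar w f) x = wirtBar w (wirt v f) x := by
  conv_lhs => rw [wirt]
  conv_rhs => rw [wirtBar]
  simp only [fderiv_wirt hf, fderiv_wirtBar hf, fderiv_fderiv_comm hf v,
    fderiv_fderiv_comm hf (Complex.I • v)]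
  ring

lemma wirt_wirt_comm (hf : ContDiffAt ℝ 2 f x) :
    wirt v (wirt w f) x = wirt w (wirt v f) x := by
  conv_lhs => rw [wirt]
  conv_rhs => rw [wirt]
  simp only [fderiv_wirt hf, fderiv_fderiv_comm hf v,
    fderiv_fderiv_comm hf (Complex.I • v)]
  ring

/-- The cross terms cancel by symmetry of the second derivative. This is the bridge from the Levi
form to real second derivatives, used both for the maximum principle and for plurisubharmonicity. -/
lemma wirt_wirtBar_self (hf : ContDiffAt ℝ 2 f x) :
    wirt v (wirtBar v f) x = (1 / 4 : ℂ) * (fderiv ℝ (fderiv ℝ f) x v v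
      + fderiv ℝ (fderiv ℝ f) x (Complex.I • v) (Complex.I • v)) := by
  rw [wirt]
  simp only [fderiv_wirtBar hf, fderiv_fderiv_comm hf (Complex.I • v) v]
  have hI := Complex.I_mul_I
  linear_combination (-(1/4 : ℂ) * fderiv ℝ (fderiv ℝ f) x (Complex.I • v) (Complex.I • v)) * hI

lemma ContDiffAt.eventually_nat {k : ℕ} (hf : ContDiffAt ℝ k f x) :
    ∀ᶠ y in 𝓝 x, ContDiffAt ℝ k f y := hf.eventually (by simp)

lemma contDiffAt_conj {k : WithTop ℕ∞} (hf : ContDiffAt ℝ k f x) :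
    ContDiffAt ℝ k (fun y => conj (f y)) x :=
  (Complex.conjLIE.toContinuousLinearEquiv.contDiff.contDiffAt).comp x hf

end calculus

/-- The value, the two first derivatives and the mixed second derivative of a `C²` function. -/
structure WJet (x v w : Cn n) (f : Cn n → ℂ) (a b c d : ℂ) : Prop where
  contDiffAt : ContDiffAt ℝ 2 f x
  val : f x = a
  fst : wirt v f x = b
  snd : wirtBar w f x = c
  mix : wirt v (wirtBar w f) x = d

namespace WJet

variable {x v w : Cn n} {f g : Cn n → ℂ} {a b c d a' b' c' d' : ℂ}

lemma of_contDiffAt (hf : ContDiffAt ℝ 2 f x) :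
    WJet x v w f (f x) (wirt v f x) (wirtBar w f x) (wirt v (wirtBar w f) x) :=
  ⟨hf, rfl, rfl, rfl, rfl⟩

lemma const (a : ℂ) : WJet x v w (fun _ => a) a 0 0 0 := by
  refine ⟨contDiffAt_const, rfl, wirt_const a, wirtBar_const a, ?_⟩
  have : wirtBar w (fun _ : Cn n => a) = fun _ => 0 := by funext y; exact wirtBar_const a
  rw [this, wirt_const]

lemma congr (h : WJet x v w f a b c d) (hfg : f =ᶠ[𝓝 x] g) : WJet x v w g a b c d :=
  ⟨h.contDiffAt.congr_of_eventuallyEq hfg.symm, hfg.eq_of_nhds ▸ h.val,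
    by rw [← wirt_congr hfg, h.fst], by rw [← wirtBar_congr hfg, h.snd],
    by rw [← wirt_congr (wirtBar_eventuallyEq hfg), h.mix]⟩

lemma add (hf : WJet x v w f a b c d) (hg : WJet x v w g a' b' c' d') :
    WJet x v w (fun y => f y + g y) (a + a') (b + b') (c + c') (d + d') := by
  have df := hf.contDiffAt.differentiableAt (by norm_num)
  have dg := hg.contDiffAt.differentiableAt (by norm_num)
  have df' := (contDiffAt_wirtBar (k := 1) hf.contDiffAt w).differentiableAt (by norm_num)
  have dg' := (contDiffAt_wirtBar (k := 1) hg.contDiffAt w).differentiableAt (by norm_num)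
  refine ⟨hf.contDiffAt.add hg.contDiffAt, by rw [hf.val, hg.val],
    by rw [wirt_add df dg, hf.fst, hg.fst], by rw [wirtBar_add df dg, hf.snd, hg.snd], ?_⟩
  have : wirtBar w (fun y => f y + g y) =ᶠ[𝓝 x] fun y => wirtBar w f y + wirtBar w g y := by
    filter_upwards [ContDiffAt.eventually_nat (k := 2) hf.contDiffAt,
      ContDiffAt.eventually_nat (k := 2) hg.contDiffAt] with y h1 h2
    exact wirtBar_add (h1.differentiableAt (by norm_num)) (h2.differentiableAt (by norm_num))
  rw [wirt_congr this, wirt_add df' dg', hf.mix, hg.mix]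

lemma mul (hf : WJet x v w f a b c d) (hg : WJet x v w g a' b' c' d') :
    WJet x v w (fun y => f y * g y) (a * a') (b * a' + a * b') (c * a' + a * c')
      (d * a' + c * b' + b * c' + a * d') := by
  have df := hf.contDiffAt.differentiableAt (by norm_num)
  have dg := hg.contDiffAt.differentiableAt (by norm_num)
  have df' := (contDiffAt_wirtBar (k := 1) hf.contDiffAt w).differentiableAt (by norm_num)
  have dg' := (contDiffAt_wirtBar (k := 1) hg.contDiffAt w).differentiableAt (by norm_num)
  refine ⟨hf.contDiffAt.mul hg.contDiffAt, by rw [hf.val, hg.val],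
    by rw [wirt_mul df dg, hf.fst, hg.fst, hf.val, hg.val],
    by rw [wirtBar_mul df dg, hf.snd, hg.snd, hf.val, hg.val], ?_⟩
  have : wirtBar w (fun y => f y * g y) =ᶠ[𝓝 x]
      fun y => wirtBar w f y * g y + f y * wirtBar w g y := by
    filter_upwards [ContDiffAt.eventually_nat (k := 2) hf.contDiffAt,
      ContDiffAt.eventually_nat (k := 2) hg.contDiffAt] with y h1 h2
    exact wirtBar_mul (h1.differentiableAt (by norm_num)) (h2.differentiableAt (by norm_num))
  rw [wirt_congr this, wirt_add (df'.fun_mul dg) (df.fun_mul dg'), wirt_mul df' dg,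
    wirt_mul df dg', hf.mix, hg.mix, hf.fst, hg.fst, hf.snd, hg.snd, hf.val, hg.val]
  ring

lemma sum {ι : Type*} (s : Finset ι) {F : ι → Cn n → ℂ} {a b c d : ι → ℂ}
    (h : ∀ i ∈ s, WJet x v w (F i) (a i) (b i) (c i) (d i)) :
    WJet x v w (fun y => ∑ i ∈ s, F i y) (∑ i ∈ s, a i) (∑ i ∈ s, b i) (∑ i ∈ s, c i)
      (∑ i ∈ s, d i) := by
  classical
  induction s using Finset.induction_on with
  | empty => simpa using const 0
  | insert i s hi ih =>
    simp only [Finset.sum_insert hi]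
    exact (h i (Finset.mem_insert_self i s)).add
      (ih fun j hj => h j (Finset.mem_insert_of_mem hj))

/-- Conjugation exchanges ∂ and ∂̄, so the two directions and the two first derivatives trade
places. -/
lemma conjugate (hf : WJet x v w f a b c d) :
    WJet x w v (fun y => conj (f y)) (conj a) (conj c) (conj b) (conj d) := by
  refine ⟨contDiffAt_conj hf.contDiffAt, by rw [hf.val], by rw [wirt_conj, hf.snd],
    by rw [wirtBar_conj, hf.fst], ?_⟩
  have : wirtBar v (fun y => (starRingEnd ℂ) (f y)) = fun y => (starRingEnd ℂ) (wirt v f y) := by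
    funext y; exact wirtBar_conj
  rw [this, wirt_conj, ← wirt_wirtBar_comm hf.contDiffAt, hf.mix]

/-- Computing one jet in two ways is how an identity between functions gets differentiated. -/
lemma eq (h : WJet x v w f a b c d) (h' : WJet x v w f a' b' c' d') :
    a = a' ∧ b = b' ∧ c = c' ∧ d = d' :=
  ⟨h.val.symm.trans h'.val, h.fst.symm.trans h'.fst, h.snd.symm.trans h'.snd,
    h.mix.symm.trans h'.mix⟩

end WJet

end wirtinger

/-! ### Jets of inverse matrices, determinants and tensor metrics -/

section matrixJets

open Matrix
open scoped Kronecker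

variable {n : ℕ}

section matrixCalculus

variable {ι : Type*} [Fintype ι] [DecidableEq ι] {x v w : Cn n}

lemma contDiffAt_det {k : WithTop ℕ∞} {A : Cn n → Matrix ι ι ℂ}
    (hA : ∀ i j, ContDiffAt ℝ k (fun y => A y i j) x) : ContDiffAt ℝ k (fun y => (A y).det) x := by
  simp only [Matrix.det_apply]
  refine ContDiffAt.sum fun σ _ => ContDiffAt.const_smul _ ?_
  exact contDiffAt_prod fun i _ => hA _ _

lemma contDiffAt_inv_apply {k : WithTop ℕ∞} {A : Cn n → Matrix ι ι ℂ}
    (hA : ∀ i j, ContDiffAt ℝ k (fun y => A y i j) x) (hdet : (A x).det ≠ 0) (i j : ι) :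
    ContDiffAt ℝ k (fun y => (A y)⁻¹ i j) x := by
  simp only [Matrix.inv_def, Matrix.smul_apply, Ring.inverse_eq_inv', smul_eq_mul,
    Matrix.adjugate_apply]
  refine ((contDiffAt_det hA).inv hdet).mul (contDiffAt_det fun p q => ?_)
  by_cases h : p = j
  · simpa [Matrix.updateRow_apply, h] using contDiffAt_const
  · simpa [Matrix.updateRow_apply, h] using hA p q

lemma eventually_det_ne_zero {A : Cn n → Matrix ι ι ℂ}
    (hA : ∀ i j, ContinuousAt (fun y => A y i j) x) (hdet : (A x).det ≠ 0) :
    ∀ᶠ y in 𝓝 x, (A y).det ≠ 0 := by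
  have : ContinuousAt (fun y => (A y).det) x := by
    simp only [Matrix.det_apply]
    refine tendsto_finsetSum _ fun σ _ => Tendsto.const_smul ?_ _
    exact tendsto_finsetProd _ fun i _ => hA _ _
  exact this.eventually_ne hdet

/-- Differentiate A A⁻¹ = 1 and solve successively for the derivatives of the inverse; since A is
the identity at the point, the answers are polynomial in P, R and Q. -/
lemma WJet.matrix_inv {A : Cn n → Matrix ι ι ℂ} {P R Q : Matrix ι ι ℂ}
    (hA : ∀ i j, WJet x v w (fun y => A y i j) ((1 : Matrix ι ι ℂ) i j) (P i j) (R i j) (Q i j))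
    (i j : ι) :
    WJet x v w (fun y => (A y)⁻¹ i j) ((1 : Matrix ι ι ℂ) i j) ((-P) i j) ((-R) i j)
      ((-Q + P * R + R * P) i j) := by
  have hA1 : A x = 1 := by ext i j; exact (hA i j).val
  have hdet : (A x).det ≠ 0 := by simp [hA1]
  have hG := fun i j => WJet.of_contDiffAt (v := v) (w := w)
    (contDiffAt_inv_apply (fun i j => (hA i j).contDiffAt) hdet i j)
  set G1 : Matrix ι ι ℂ := Matrix.of fun i j => wirt v (fun y => (A y)⁻¹ i j) x with hG1
  set G2 : Matrix ι ι ℂ := Matrix.of fun i j => wirtBar w (fun y => (A y)⁻¹ i j) x with hG2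
  set G3 : Matrix ι ι ℂ :=
    Matrix.of fun i j => wirt v (wirtBar w (fun y => (A y)⁻¹ i j)) x with hG3
  have hG0 : (A x)⁻¹ = 1 := by simp [hA1]
  have hev := eventually_det_ne_zero (fun i j => (hA i j).contDiffAt.continuousAt) hdet
  have key : ∀ i k, _ := fun i k => WJet.eq
    ((WJet.sum Finset.univ fun j _ => (hA i j).mul (hG j k)).congr
      (g := fun _ => (1 : Matrix ι ι ℂ) i k) (by
        filter_upwards [hev] with y hy
        rw [← Matrix.mul_nonsing_inv (A y) (Ne.isUnit hy)]
        rfl)) (WJet.const _)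
  have e1 : P + G1 = 0 := by
    ext i k
    have := (key i k).2.1
    rw [Finset.sum_add_distrib] at this
    have h2 : (P * (A x)⁻¹ + 1 * G1 : Matrix ι ι ℂ) i k = 0 := this
    simpa [hG0] using h2
  have e2 : R + G2 = 0 := by
    ext i k
    have := (key i k).2.2.1
    rw [Finset.sum_add_distrib] at this
    have h2 : (R * (A x)⁻¹ + 1 * G2 : Matrix ι ι ℂ) i k = 0 := this
    simpa [hG0] using h2
  have e3 : Q + R * G1 + P * G2 + G3 = 0 := by
    ext i k
    have := (key i k).2.2.2
    rw [Finset.sum_add_distrib, Finset.sum_add_distrib, Finset.sum_add_distrib] at this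
    have h2 : (Q * (A x)⁻¹ + R * G1 + P * G2 + 1 * G3 : Matrix ι ι ℂ) i k = 0 := this
    simpa [hG0] using h2
  have e1' : G1 = -P := (neg_eq_of_add_eq_zero_right e1).symm
  have e2' : G2 = -R := (neg_eq_of_add_eq_zero_right e2).symm
  have e3' : G3 = -Q + P * R + R * P := by
    rw [e1', e2'] at e3
    have := (neg_eq_of_add_eq_zero_right e3).symm
    rw [this]; noncomm_ring
  rw [← e1', ← e2', ← e3']
  have := hG i j
  rwa [hG0] at this

lemma wirt_prod {κ : Type*} [DecidableEq κ] (s : Finset κ) {F : κ → Cn n → ℂ}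
    (hF : ∀ i ∈ s, DifferentiableAt ℝ (F i) x) :
    wirt v (fun y => ∏ i ∈ s, F i y) x = ∑ i ∈ s, (∏ j ∈ s.erase i, F j x) * wirt v (F i) x := by
  have := (HasFDerivAt.finsetProd (u := s) (g := F) (g' := fun i => fderiv ℝ (F i) x) (x := x)
    fun i hi => (hF i hi).hasFDerivAt).fderiv
  simp only [wirt, this, _root_.sum_apply, _root_.smul_apply, smul_eq_mul, Finset.mul_sum,
    ← Finset.sum_sub_distrib]
  refine Finset.sum_congr rfl fun i _ => by ring

/-- Jacobi's formula. In the Leibniz expansion, differentiating the factor from column i replaces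
that column by its derivative, and Cramer's rule recognises the adjugate. -/
lemma wirt_det {A : Cn n → Matrix ι ι ℂ}
    (hA : ∀ i j, DifferentiableAt ℝ (fun y => A y i j) x) :
    wirt v (fun y => (A y).det) x
      = ∑ i, ∑ j, (A x).adjugate i j * wirt v (fun y => A y j i) x := by
  have hrhs : ∀ i, ∑ j, (A x).adjugate i j * wirt v (fun y => A y j i) x
      = ((A x).updateCol i fun j => wirt v (fun y => A y j i) x).det := by
    intro i
    rw [← Matrix.cramer_apply, Matrix.cramer_eq_adjugate_mulVec]; rfl
  simp only [hrhs, Matrix.det_apply']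
  have hp : ∀ σ : Equiv.Perm ι, DifferentiableAt ℝ (fun y => ∏ i, A y (σ i) i) x := fun σ =>
    (HasFDerivAt.finsetProd fun i _ => (hA (σ i) i).hasFDerivAt).differentiableAt
  rw [wirt_sum _ _ fun σ _ => (hp σ).const_mul _, Finset.sum_comm]
  refine Finset.sum_congr rfl fun σ _ => ?_
  rw [wirt_mul (by fun_prop) (hp σ), wirt_const, zero_mul, zero_add, wirt_prod _ fun i _ => hA _ _,
    Finset.mul_sum]
  refine Finset.sum_congr rfl fun i _ => ?_
  rw [← Finset.mul_prod_erase _ _ (Finset.mem_univ i)]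
  simp only [Matrix.updateCol_self]
  rw [mul_comm (∏ j ∈ _, _)]
  congr 2
  refine Finset.prod_congr rfl fun j hj => ?_
  rw [Matrix.updateCol_ne (Finset.ne_of_mem_erase hj)]

lemma wirt_cexp {f : Cn n → ℂ} (hf : DifferentiableAt ℝ f x) :
    wirt v (fun y => Complex.exp (f y)) x = Complex.exp (f x) * wirt v f x := by
  simp only [wirt, hf.hasFDerivAt.cexp.fderiv, _root_.smul_apply, smul_eq_mul]; ring

/-- The first derivative of `log det A`. -/
lemma wirt_log_det {A : Cn n → Matrix ι ι ℂ} {f : Cn n → ℂ} {κ : ℂ} (hκ : κ ≠ 0)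
    (hA : ∀ i j, DifferentiableAt ℝ (fun y => A y i j) x) (hf : DifferentiableAt ℝ f x)
    (h : ∀ᶠ y in 𝓝 x, (A y).det = κ * Complex.exp (f y)) :
    wirt v f x = ∑ i, ∑ j, (A x)⁻¹ i j * wirt v (fun y => A y j i) x := by
  have h1 := wirt_congr (v := v) (f := fun y => (A y).det) h
  have hx := h.self_of_nhds
  rw [wirt_det hA, wirt_mul (by fun_prop) hf.cexp, wirt_const, zero_mul, zero_add,
    wirt_cexp hf, ← mul_assoc, ← hx] at h1
  have hdet : (A x).det ≠ 0 := by rw [hx]; exact mul_ne_zero hκ (Complex.exp_ne_zero _)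
  simp only [Matrix.inv_def, Matrix.smul_apply, Ring.inverse_eq_inv', smul_eq_mul, mul_assoc,
    ← Finset.mul_sum, h1]
  field_simp

end matrixCalculus

section hermitianForm

variable {ι : Type*} [Fintype ι] [DecidableEq ι] {x v : Cn n}

/-- The squared norm of a section in a Hermitian metric which is the identity at the point. -/
lemma WJet.hermitian {s : ι → Cn n → ℂ} {h : ι → ι → Cn n → ℂ} {s₀ a b d : ι → ℂ}
    {H₁ H₂ : Matrix ι ι ℂ}
    (hs : ∀ α, WJet x v v (s α) (s₀ α) (a α) (b α) (d α))
    (hh : ∀ α β, WJet x v v (h α β) ((1 : Matrix ι ι ℂ) α β) (H₁ α β) (H₁ᴴ α β) (H₂ α β)) :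
    WJet x v v (fun y => ∑ α, conj (s α y) * ∑ β, h α β y * s β y)
      (star s₀ ⬝ᵥ s₀) (star b ⬝ᵥ s₀ + star s₀ ⬝ᵥ (H₁ *ᵥ s₀ + a))
      (star a ⬝ᵥ s₀ + star s₀ ⬝ᵥ (H₁ᴴ *ᵥ s₀ + b))
      (star d ⬝ᵥ s₀ + star a ⬝ᵥ (H₁ *ᵥ s₀ + a) + star b ⬝ᵥ (H₁ᴴ *ᵥ s₀ + b)
        + star s₀ ⬝ᵥ (H₂ *ᵥ s₀ + H₁ᴴ *ᵥ a + H₁ *ᵥ b + d)) := by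
  have hone : ∀ z : ι → ℂ, ∀ α, ∑ β, (1 : Matrix ι ι ℂ) α β * z β = z α := fun z α =>
    congrFun (Matrix.one_mulVec z) α
  have := WJet.sum Finset.univ fun α _ =>
    (hs α).conjugate.mul (WJet.sum Finset.univ fun β _ => (hh α β).mul (hs β))
  simp only [Finset.sum_add_distrib, hone] at this
  exact this

/-- Completing the squares in the Bochner formula: `X` acts on the holomorphic slots and `Y` on
the antiholomorphic ones. -/
lemma bochner_algebra {s a b d : ι → ℂ} {X Y Z H₁ H₂ : Matrix ι ι ℂ} (h₁ : H₁ = -(X + Y))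
    (h₂ : H₂ = Xᴴ * X + Y * Yᴴ + X * Yᴴ + Y * Xᴴ - Z) :
    star d ⬝ᵥ s + star a ⬝ᵥ (H₁ *ᵥ s + a) + star b ⬝ᵥ (H₁ᴴ *ᵥ s + b)
        + star s ⬝ᵥ (H₂ *ᵥ s + H₁ᴴ *ᵥ a + H₁ *ᵥ b + d)
      = star (a - X *ᵥ s) ⬝ᵥ (a - X *ᵥ s) + star (b - Yᴴ *ᵥ s) ⬝ᵥ (b - Yᴴ *ᵥ s)
        + (star s ⬝ᵥ (d - X *ᵥ b - Yᴴ *ᵥ a + (X * Yᴴ) *ᵥ s)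
          + star (d - X *ᵥ b - Yᴴ *ᵥ a + (X * Yᴴ) *ᵥ s) ⬝ᵥ s) - star s ⬝ᵥ (Z *ᵥ s) := by
  subst h₁ h₂
  simp only [star_sub, star_add, Matrix.star_mulVec, ← Matrix.dotProduct_mulVec, dotProduct_add,
    dotProduct_sub, add_dotProduct, sub_dotProduct, Matrix.mulVec_add, Matrix.mulVec_sub,
    Matrix.add_mulVec, Matrix.sub_mulVec, Matrix.neg_mulVec, dotProduct_neg,
    Matrix.mulVec_mulVec, Matrix.conjTranspose_mul, Matrix.conjTranspose_conjTranspose,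
    Matrix.conjTranspose_neg, Matrix.conjTranspose_add]
  ring

/-- The gradient of the squared norm involves the same covariant derivatives a - Xs and b - Yᴴs
whose squares appear in `bochner_algebra`; this is why those squares can absorb the cutoff terms. -/
lemma gradient_algebra {s a b : ι → ℂ} {X Y H₁ : Matrix ι ι ℂ} (h₁ : H₁ = -(X + Y)) :
    star b ⬝ᵥ s + star s ⬝ᵥ (H₁ *ᵥ s + a)
      = star (b - Yᴴ *ᵥ s) ⬝ᵥ s + star s ⬝ᵥ (a - X *ᵥ s) := by
  subst h₁
  simp only [star_sub, star_add, Matrix.star_mulVec, ← Matrix.dotProduct_mulVec, dotProduct_add,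
    dotProduct_sub, add_dotProduct, sub_dotProduct, Matrix.mulVec_add, Matrix.mulVec_sub,
    Matrix.add_mulVec, Matrix.sub_mulVec, Matrix.neg_mulVec, dotProduct_neg,
    Matrix.conjTranspose_conjTranspose]
  ring

lemma gradient_algebra_conj {s a b : ι → ℂ} {X Y H₁ : Matrix ι ι ℂ} (h₁ : H₁ = -(X + Y)) :
    star a ⬝ᵥ s + star s ⬝ᵥ (H₁ᴴ *ᵥ s + b)
      = star (a - X *ᵥ s) ⬝ᵥ s + star s ⬝ᵥ (b - Yᴴ *ᵥ s) := by
  subst h₁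
  simp only [star_sub, Matrix.star_mulVec, ← Matrix.dotProduct_mulVec, dotProduct_add,
    dotProduct_sub, sub_dotProduct, Matrix.add_mulVec, Matrix.neg_mulVec, dotProduct_neg,
    Matrix.conjTranspose_neg, Matrix.conjTranspose_add]
  ring

end hermitianForm

section tensor

variable {ι : Type*} [Fintype ι] [DecidableEq ι] {x v : Cn n}

/-- The action of `P` on the first and the third slot. -/
def slotsHol (P : Matrix ι ι ℂ) : Matrix (ι × ι × ι) (ι × ι × ι) ℂ :=
  P ⊗ₖ ((1 : Matrix ι ι ℂ) ⊗ₖ (1 : Matrix ι ι ℂ))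
    + (1 : Matrix ι ι ℂ) ⊗ₖ ((1 : Matrix ι ι ℂ) ⊗ₖ P)

/-- The action of `Pᵀ` on the second slot. -/
def slotBar (P : Matrix ι ι ℂ) : Matrix (ι × ι × ι) (ι × ι × ι) ℂ :=
  (1 : Matrix ι ι ℂ) ⊗ₖ (Pᵀ ⊗ₖ (1 : Matrix ι ι ℂ))

/-- `slotsHol` as an additive map. -/
def slotsHolHom : Matrix ι ι ℂ →+ Matrix (ι × ι × ι) (ι × ι × ι) ℂ :=
  AddMonoidHom.mk' slotsHol fun A B => by
    simp only [slotsHol, Matrix.kronecker_add, Matrix.add_kronecker]; abel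

/-- `slotBar` as an additive map. -/
def slotBarHom : Matrix ι ι ℂ →+ Matrix (ι × ι × ι) (ι × ι × ι) ℂ :=
  AddMonoidHom.mk' slotBar fun A B => by
    simp only [slotBar, Matrix.transpose_add, Matrix.kronecker_add, Matrix.add_kronecker]

/-- The metric induced by `G` on the tensors `s_{i j̄ k}`. -/
def tensorMetric (G : Matrix ι ι ℂ) : Matrix (ι × ι × ι) (ι × ι × ι) ℂ :=
  G ⊗ₖ (Gᵀ ⊗ₖ G)

/-- The left side is the product rule for the threefold tensor product; the right side is the shape
needed by `bochner_algebra`. The discrepancy in every slot is the same curvature matrix Q - PPᴴ,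
since in the transposed slot the factors of P and Pᴴ also trade places. -/
lemma kron_tensor_jet_identity (P Q : Matrix ι ι ℂ) :
    (-Q + P * Pᴴ + Pᴴ * P) ⊗ₖ ((1 : Matrix ι ι ℂ) ⊗ₖ (1 : Matrix ι ι ℂ))
      + (1 : Matrix ι ι ℂ) ⊗ₖ ((-Q + P * Pᴴ + Pᴴ * P)ᵀ ⊗ₖ (1 : Matrix ι ι ℂ))
      + (1 : Matrix ι ι ℂ) ⊗ₖ ((1 : Matrix ι ι ℂ) ⊗ₖ (-Q + P * Pᴴ + Pᴴ * P))
      + (P ⊗ₖ (Pᴴᵀ ⊗ₖ (1 : Matrix ι ι ℂ)) + Pᴴ ⊗ₖ (Pᵀ ⊗ₖ (1 : Matrix ι ι ℂ)))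
      + (P ⊗ₖ ((1 : Matrix ι ι ℂ) ⊗ₖ Pᴴ) + Pᴴ ⊗ₖ ((1 : Matrix ι ι ℂ) ⊗ₖ P))
      + ((1 : Matrix ι ι ℂ) ⊗ₖ (Pᵀ ⊗ₖ Pᴴ) + (1 : Matrix ι ι ℂ) ⊗ₖ (Pᴴᵀ ⊗ₖ P))
    = (slotsHol P)ᴴ * slotsHol P + slotBar P * (slotBar P)ᴴ + slotsHol P * (slotBar P)ᴴ
      + slotBar P * (slotsHol P)ᴴ - (slotsHol (Q - P * Pᴴ) + slotBar (Q - P * Pᴴ)) := by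
  have hT : Pᵀᴴ = Pᴴᵀ := by ext; simp
  have hm : ∀ (A : Matrix ι ι ℂ), (-A) = (-1 : ℂ) • A := fun A => by simp
  simp only [slotsHol, slotBar, Matrix.conjTranspose_add, Matrix.conjTranspose_kronecker,
    Matrix.conjTranspose_one, add_mul, mul_add, ← Matrix.mul_kronecker_mul, one_mul, mul_one,
    Matrix.transpose_add, Matrix.transpose_sub, Matrix.transpose_neg, Matrix.transpose_mul,
    Matrix.kronecker_add, Matrix.add_kronecker, sub_eq_add_neg, hT, hm, Matrix.smul_kronecker,
    Matrix.kronecker_smul, Matrix.transpose_smul, smul_add, smul_smul]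
  norm_num
  abel

lemma tensorMetric_jet {G : Cn n → Matrix ι ι ℂ} {P Q : Matrix ι ι ℂ}
    (hG : ∀ i j, WJet x v v (fun y => G y i j) ((1 : Matrix ι ι ℂ) i j) ((-P) i j) ((-Pᴴ) i j)
      ((-Q + P * Pᴴ + Pᴴ * P) i j)) (α β : ι × ι × ι) :
    WJet x v v (fun y => tensorMetric (G y) α β) ((1 : Matrix (ι × ι × ι) (ι × ι × ι) ℂ) α β)
      ((-(slotsHol P + slotBar P)) α β) ((-(slotsHol P + slotBar P))ᴴ α β)
      (((slotsHol P)ᴴ * slotsHol P + slotBar P * (slotBar P)ᴴ + slotsHol P * (slotBar P)ᴴ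
      + slotBar P * (slotsHol P)ᴴ - (slotsHol (Q - P * Pᴴ) + slotBar (Q - P * Pᴴ))) α β) := by
  obtain ⟨p, q, r⟩ := α
  obtain ⟨i, j, k⟩ := β
  rw [← kron_tensor_jet_identity]
  generalize -Q + P * Pᴴ + Pᴴ * P = Z at *
  have key := (hG p i).mul ((hG j q).mul (hG r k))
  have h1 : (1 : Matrix (ι × ι × ι) (ι × ι × ι) ℂ)
      = (1 : Matrix ι ι ℂ) ⊗ₖ ((1 : Matrix ι ι ℂ)ᵀ ⊗ₖ (1 : Matrix ι ι ℂ)) := by simp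
  have hs : ∀ a b : ι, (1 : Matrix ι ι ℂ) a b = (1 : Matrix ι ι ℂ) b a := fun a b => by
    simp [Matrix.one_apply, eq_comm]
  have e1 : (1 : Matrix (ι × ι × ι) (ι × ι × ι) ℂ) (p, q, r) (i, j, k)
      = (1 : Matrix ι ι ℂ) p i * ((1 : Matrix ι ι ℂ) j q * (1 : Matrix ι ι ℂ) r k) := by
    rw [h1]; rfl
  have e2 : (-(slotsHol P + slotBar P)) (p, q, r) (i, j, k)
      = (-P) p i * ((1 : Matrix ι ι ℂ) j q * (1 : Matrix ι ι ℂ) r k) + (1 : Matrix ι ι ℂ) p i *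
        ((-P) j q * (1 : Matrix ι ι ℂ) r k + (1 : Matrix ι ι ℂ) j q * (-P) r k) := by
    rw [hs j q]
    change -(P p i * ((1 : Matrix ι ι ℂ) q j * (1 : Matrix ι ι ℂ) r k) + (1 : Matrix ι ι ℂ) p i *
      ((1 : Matrix ι ι ℂ) q j * P r k) + (1 : Matrix ι ι ℂ) p i *
      (P j q * (1 : Matrix ι ι ℂ) r k)) = (-P p i) * _ + _ * ((-P j q) * _ + _ * (-P r k))
    ring
  have e3 : (-(slotsHol P + slotBar P))ᴴ (p, q, r) (i, j, k)
      = (-Pᴴ) p i * ((1 : Matrix ι ι ℂ) j q * (1 : Matrix ι ι ℂ) r k) + (1 : Matrix ι ι ℂ) p i *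
        ((-Pᴴ) j q * (1 : Matrix ι ι ℂ) r k + (1 : Matrix ι ι ℂ) j q * (-Pᴴ) r k) := by
    have hT : Pᵀᴴ = Pᴴᵀ := by ext; simp
    simp only [slotsHol, slotBar, Matrix.conjTranspose_neg, Matrix.conjTranspose_add,
      Matrix.conjTranspose_kronecker, Matrix.conjTranspose_one, hT]
    rw [hs j q]
    change -(Pᴴ p i * ((1 : Matrix ι ι ℂ) q j * (1 : Matrix ι ι ℂ) r k) + (1 : Matrix ι ι ℂ) p i *
      ((1 : Matrix ι ι ℂ) q j * Pᴴ r k) + (1 : Matrix ι ι ℂ) p i *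
      (Pᴴ j q * (1 : Matrix ι ι ℂ) r k)) = (-Pᴴ p i) * _ + _ * ((-Pᴴ j q) * _ + _ * (-Pᴴ r k))
    ring
  rw [e1, e2, e3]
  refine (congrArg (WJet x v v _ _ _ _) ?_).mpr key
  rw [hs j q]
  change Z p i * ((1 : Matrix ι ι ℂ) q j * (1 : Matrix ι ι ℂ) r k)
    + (1 : Matrix ι ι ℂ) p i * (Z j q * (1 : Matrix ι ι ℂ) r k)
    + (1 : Matrix ι ι ℂ) p i * ((1 : Matrix ι ι ℂ) q j * Z r k)
    + (P p i * (Pᴴ j q * (1 : Matrix ι ι ℂ) r k) + Pᴴ p i * (P j q * (1 : Matrix ι ι ℂ) r k))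
    + (P p i * ((1 : Matrix ι ι ℂ) q j * Pᴴ r k) + Pᴴ p i * ((1 : Matrix ι ι ℂ) q j * P r k))
    + ((1 : Matrix ι ι ℂ) p i * (P j q * Pᴴ r k) + (1 : Matrix ι ι ℂ) p i * (Pᴴ j q * P r k))
    = Z p i * _ + (-Pᴴ p i) * ((-P j q) * _ + _ * (-P r k)) +
        (-P p i) * ((-Pᴴ j q) * _ + _ * (-Pᴴ r k)) +
      _ * (Z j q * _ + (-Pᴴ j q) * (-P r k) + (-P j q) * (-Pᴴ r k) + _ * Z r k)
  ring

end tensor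

end matrixJets

/-! ### The Bochner formula for Calabi's quantity -/

section bochner

open Matrix
open scoped Kronecker

variable {n : ℕ}

section commutation

variable {f : Cn n → ℂ} {x c i j k l : Cn n}

lemma wirtBar_wirtBar_comm (hf : ContDiffAt ℝ 2 f x) :
    wirtBar i (wirtBar j f) x = wirtBar j (wirtBar i f) x := by
  conv_lhs => rw [wirtBar]
  conv_rhs => rw [wirtBar]
  simp only [fderiv_wirtBar hf, fderiv_fderiv_comm hf i,
    fderiv_fderiv_comm hf (Complex.I • i)]
  ring

lemma wirt_wirtBar_comm_eventually (hf : ContDiffAt ℝ 2 f x) :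
    wirt i (wirtBar j f) =ᶠ[𝓝 x] wirtBar j (wirt i f) := by
  filter_upwards [hf.eventually (by simp)] with y hy using wirt_wirtBar_comm hy

lemma wirt_wirt_comm_eventually (hf : ContDiffAt ℝ 2 f x) :
    wirt i (wirt j f) =ᶠ[𝓝 x] wirt j (wirt i f) := by
  filter_upwards [hf.eventually (by simp)] with y hy using wirt_wirt_comm hy

lemma wirtBar_wirtBar_comm_eventually (hf : ContDiffAt ℝ 2 f x) :
    wirtBar i (wirtBar j f) =ᶠ[𝓝 x] wirtBar j (wirtBar i f) := by
  filter_upwards [hf.eventually (by simp)] with y hy using wirtBar_wirtBar_comm hy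

/-- The Kähler condition: unbarred derivatives commute, so i and k may be exchanged in u_{i j̄ k}.
-/
lemma third_symm (hf : ContDiffAt ℝ 3 f x) :
    wirt k (wirtBar j (wirt i f)) x = wirt i (wirtBar j (wirt k f)) x := by
  have hf2 : ContDiffAt ℝ 2 f x := hf.of_le (by norm_num)
  rw [wirt_wirtBar_comm (contDiffAt_wirt (k := 2) hf i),
    wirt_wirtBar_comm (contDiffAt_wirt (k := 2) hf k)]
  exact wirtBar_congr (wirt_wirt_comm_eventually hf2)

lemma third_symm_eventually (hf : ContDiffAt ℝ 3 f x) :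
    wirt k (wirtBar j (wirt i f)) =ᶠ[𝓝 x] wirt i (wirtBar j (wirt k f)) := by
  filter_upwards [hf.eventually (by simp)] with y hy using third_symm hy

lemma fourth_symm (hf : ContDiffAt ℝ 4 f x) :
    wirtBar c (wirt k (wirtBar j (wirt i f))) x = wirt k (wirtBar j (wirtBar c (wirt i f))) x := by
  have h3 := contDiffAt_wirt (k := 3) hf i
  rw [← wirt_wirtBar_comm (contDiffAt_wirtBar (k := 2) h3 j)]
  exact wirt_congr (wirtBar_wirtBar_comm_eventually (h3.of_le (by norm_num)))

lemma fourth_symm_eventually (hf : ContDiffAt ℝ 4 f x) :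
    wirtBar c (wirt k (wirtBar j (wirt i f)))
      =ᶠ[𝓝 x] wirt k (wirtBar j (wirtBar c (wirt i f))) := by
  filter_upwards [hf.eventually (by simp)] with y hy using fourth_symm hy

lemma fourth_symm_hol (hf : ContDiffAt ℝ 4 f x) :
    wirt c (wirt k (wirtBar j (wirt i f))) x = wirt k (wirt i (wirtBar j (wirt c f))) x := by
  have h3 := contDiffAt_wirt (k := 3) hf i
  rw [wirt_wirt_comm (contDiffAt_wirtBar (k := 2) h3 j)]
  exact wirt_congr (third_symm_eventually (hf.of_le (by norm_num)))

lemma fourth_symm_trace (hf : ContDiffAt ℝ 4 f x) :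
    wirt c (wirtBar c (wirtBar j (wirt i f))) x = wirtBar j (wirt i (wirtBar c (wirt c f))) x := by
  have h3 := contDiffAt_wirt (k := 3) hf i
  rw [wirtBar_congr (third_symm_eventually (hf.of_le (by norm_num))),
    ← wirt_wirtBar_comm (contDiffAt_wirtBar (k := 2) h3 c)]
  exact wirt_congr (wirtBar_wirtBar_comm_eventually (h3.of_le (by norm_num)))

/-- Moves the pair c, c̄ innermost, where summation over c produces the trace occurring in the
differentiated equation. -/
lemma fifth_symm (hf : ContDiffAt ℝ 5 f x) :
    wirt c (wirtBar c (wirt k (wirtBar j (wirt i f)))) x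
      = wirt k (wirtBar j (wirt i (wirtBar c (wirt c f)))) x := by
  have h4 := contDiffAt_wirt (k := 4) hf i
  have h3 := contDiffAt_wirtBar (k := 3) h4 c
  rw [wirt_congr (fourth_symm_eventually (hf.of_le (by norm_num))),
    wirt_wirt_comm (contDiffAt_wirtBar (k := 2) h3 j),
    wirt_congr (wirt_wirtBar_comm_eventually (h3.of_le (by norm_num)))]
  exact wirt_congr (wirtBar_eventuallyEq (third_symm_eventually (hf.of_le (by norm_num))))

end commutation

/-- The complex Hessian of `u` in the frame `e`. -/
def hessE (e : Fin n → Cn n) (u : Cn n → ℝ) (x : Cn n) : Matrix (Fin n) (Fin n) ℂ :=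
  Matrix.of fun a b => wirtBar (e b) (wirt (e a) fun y => (u y : ℂ)) x

/-- The tensor of third derivatives `u_{i j̄ k}` in the frame `e`. -/
def thirdE (e : Fin n → Cn n) (u : Cn n → ℝ) (x : Cn n) (α : Fin n × Fin n × Fin n) : ℂ :=
  wirt (e α.2.2) (wirtBar (e α.2.1) (wirt (e α.1) fun y => (u y : ℂ))) x

/-- Calabi's third order quantity. -/
def calabi (e : Fin n → Cn n) (u : Cn n → ℝ) (x : Cn n) : ℂ :=
  ∑ α, conj (thirdE e u x α) * ∑ β, tensorMetric (hessE e u x)⁻¹ α β * thirdE e u x β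

variable {u φ : Cn n → ℝ} {x : Cn n} {e : Fin n → Cn n}

lemma contDiffAt_ofReal {k : WithTop ℕ∞} (hu : ContDiffAt ℝ k u x) :
    ContDiffAt ℝ k (fun y => (u y : ℂ)) x :=
  Complex.ofRealCLM.contDiff.contDiffAt.comp x hu

lemma hessE_conj (hu : ContDiffAt ℝ 2 u x) (i j : Fin n) :
    conj (hessE e u x j i) = hessE e u x i j := by
  have h : (fun y => conj (wirt (e j) (fun y => (u y : ℂ)) y))
      = wirtBar (e j) fun y => (u y : ℂ) := by
    funext y
    have := wirtBar_conj (v := e j) (f := fun y => (u y : ℂ)) (x := y)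
    simp only [Complex.conj_ofReal] at this
    exact this.symm
  have h2 := wirt_conj (v := e i) (f := wirt (e j) fun y => (u y : ℂ)) (x := x)
  rw [h, wirt_wirtBar_comm (contDiffAt_ofReal hu)] at h2
  exact h2.symm

lemma hessE_isHermitian (hu : ContDiffAt ℝ 2 u x) : (hessE e u x).IsHermitian :=
  Matrix.IsHermitian.ext fun i j => hessE_conj hu i j

section atNormalizedPoint

/-- The matrix `∂_c g`. -/
def dHess (e : Fin n → Cn n) (u : Cn n → ℝ) (x : Cn n) (c : Fin n) : Matrix (Fin n) (Fin n) ℂ :=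
  Matrix.of fun i j => wirt (e c) (fun y => hessE e u y i j) x

/-- The matrix `∂_k ∂̄_j g`. -/
def ddHess (e : Fin n → Cn n) (u : Cn n → ℝ) (x : Cn n) (k l : Fin n) :
    Matrix (Fin n) (Fin n) ℂ :=
  Matrix.of fun i j => wirt (e k) (wirtBar (e l) (fun y => hessE e u y i j)) x

lemma contDiffAt_hessE (hu : ContDiffAt ℝ 5 u x) (i j : Fin n) :
    ContDiffAt ℝ 3 (fun y => hessE e u y i j) x :=
  contDiffAt_wirtBar (k := 3) (contDiffAt_wirt (k := 4) (contDiffAt_ofReal hu) _) _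

/-- The metric is Hermitian near the point, so its ∂̄ derivative is the adjoint of its ∂ derivative.
-/
lemma wirtBar_hessE (hu : ContDiffAt ℝ 5 u x) (c i j : Fin n) :
    wirtBar (e c) (fun y => hessE e u y i j) x = (dHess e u x c)ᴴ i j := by
  simp only [dHess, Matrix.conjTranspose_apply, Matrix.of_apply, Complex.star_def]
  rw [← wirtBar_conj]
  refine wirtBar_congr ?_
  filter_upwards [hu.eventually (by simp)] with y hy
  exact (hessE_conj (hy.of_le (by norm_num)) i j).symm

lemma hessE_jet (hu : ContDiffAt ℝ 5 u x) (hg : hessE e u x = 1) (k l i j : Fin n) :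
    WJet x (e k) (e l) (fun y => hessE e u y i j) ((1 : Matrix (Fin n) (Fin n) ℂ) i j)
      (dHess e u x k i j) ((dHess e u x l)ᴴ i j) (ddHess e u x k l i j) :=
  ⟨(contDiffAt_hessE hu i j).of_le (by norm_num), by rw [hg], rfl, wirtBar_hessE hu l i j, rfl⟩

/-- Only the value of the metric is normalised. Its first derivatives enter through `slotsHol` and
`slotBar` as the connection, and its curvature as the last term. -/
lemma calabi_jet (hu : ContDiffAt ℝ 5 u x) (hg : hessE e u x = 1) (c : Fin n) :
    WJet x (e c) (e c) (calabi e u) (star (thirdE e u x) ⬝ᵥ thirdE e u x)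
      (star ((fun α => wirtBar (e c) (fun y => thirdE e u y α) x)
          - (slotBar (dHess e u x c))ᴴ *ᵥ thirdE e u x) ⬝ᵥ thirdE e u x
        + star (thirdE e u x) ⬝ᵥ ((fun α => wirt (e c) (fun y => thirdE e u y α) x)
          - slotsHol (dHess e u x c) *ᵥ thirdE e u x))
      (star ((fun α => wirt (e c) (fun y => thirdE e u y α) x)
          - slotsHol (dHess e u x c) *ᵥ thirdE e u x) ⬝ᵥ thirdE e u x
        + star (thirdE e u x) ⬝ᵥ ((fun α => wirtBar (e c) (fun y => thirdE e u y α) x)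
          - (slotBar (dHess e u x c))ᴴ *ᵥ thirdE e u x))
      (star ((fun α => wirt (e c) (fun y => thirdE e u y α) x)
          - slotsHol (dHess e u x c) *ᵥ thirdE e u x) ⬝ᵥ
          ((fun α => wirt (e c) (fun y => thirdE e u y α) x)
          - slotsHol (dHess e u x c) *ᵥ thirdE e u x)
        + star ((fun α => wirtBar (e c) (fun y => thirdE e u y α) x)
          - (slotBar (dHess e u x c))ᴴ *ᵥ thirdE e u x) ⬝ᵥ
          ((fun α => wirtBar (e c) (fun y => thirdE e u y α) x)
          - (slotBar (dHess e u x c))ᴴ *ᵥ thirdE e u x)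
        + (star (thirdE e u x) ⬝ᵥ
            ((fun α => wirt (e c) (wirtBar (e c) (fun y => thirdE e u y α)) x)
            - slotsHol (dHess e u x c) *ᵥ (fun α => wirtBar (e c) (fun y => thirdE e u y α) x)
            - (slotBar (dHess e u x c))ᴴ *ᵥ (fun α => wirt (e c) (fun y => thirdE e u y α) x)
            + (slotsHol (dHess e u x c) * (slotBar (dHess e u x c))ᴴ) *ᵥ thirdE e u x)
          + star ((fun α => wirt (e c) (wirtBar (e c) (fun y => thirdE e u y α)) x)
            - slotsHol (dHess e u x c) *ᵥ (fun α => wirtBar (e c) (fun y => thirdE e u y α) x)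
            - (slotBar (dHess e u x c))ᴴ *ᵥ (fun α => wirt (e c) (fun y => thirdE e u y α) x)
            + (slotsHol (dHess e u x c) * (slotBar (dHess e u x c))ᴴ) *ᵥ thirdE e u x)
              ⬝ᵥ thirdE e u x)
        - star (thirdE e u x) ⬝ᵥ
          ((slotsHol (ddHess e u x c c - dHess e u x c * (dHess e u x c)ᴴ)
            + slotBar (ddHess e u x c c - dHess e u x c * (dHess e u x c)ᴴ))
              *ᵥ thirdE e u x)) := by
  have hG := WJet.matrix_inv (hessE_jet hu hg c c)
  have hh := tensorMetric_jet hG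
  have hs : ∀ α, WJet x (e c) (e c) (fun y => thirdE e u y α) (thirdE e u x α) _ _ _ := fun α =>
    WJet.of_contDiffAt (contDiffAt_wirt (k := 2) (contDiffAt_hessE hu _ _) _)
  have key := WJet.hermitian hs hh
  rw [bochner_algebra rfl rfl, gradient_algebra rfl, gradient_algebra_conj rfl] at key
  exact key

lemma kronecker_mulVec_apply {ι : Type*} [Fintype ι] (A B C : Matrix ι ι ℂ) (s : ι × ι × ι → ℂ)
    (i j k : ι) : ((A ⊗ₖ (B ⊗ₖ C)) *ᵥ s) (i, j, k)
      = ∑ p, ∑ q, ∑ r, A i p * (B j q * C k r) * s (p, q, r) := by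
  simp only [Matrix.mulVec, dotProduct, Fintype.sum_prod_type, Matrix.kroneckerMap_apply]

lemma slotsHol_mulVec_apply {ι : Type*} [Fintype ι] [DecidableEq ι] (P : Matrix ι ι ℂ)
    (s : ι × ι × ι → ℂ) (i j k : ι) :
    (slotsHol P *ᵥ s) (i, j, k) = ∑ m, P i m * s (m, j, k) + ∑ m, P k m * s (i, j, m) := by
  rw [slotsHol, Matrix.add_mulVec, Pi.add_apply, kronecker_mulVec_apply, kronecker_mulVec_apply]
  simp [Matrix.one_apply]

lemma slotBar_conjTranspose_mulVec_apply {ι : Type*} [Fintype ι] [DecidableEq ι]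
    (P : Matrix ι ι ℂ) (s : ι × ι × ι → ℂ) (i j k : ι) :
    ((slotBar P)ᴴ *ᵥ s) (i, j, k) = ∑ m, conj (P j m) * s (i, m, k) := by
  rw [slotBar, Matrix.conjTranspose_kronecker, Matrix.conjTranspose_kronecker,
    Matrix.conjTranspose_one, kronecker_mulVec_apply]
  simp [Matrix.one_apply]

variable {κ : ℂ}

/-- The constant κ stands for |det T|², the factor which a change of frame introduces into the
Monge–Ampère equation. Holding near x, the identity can be differentiated again. -/
lemma wirt_log_det_eventually (hu : ContDiffAt ℝ 5 u x) (hφ : ContDiffAt ℝ 3 φ x) (hκ : κ ≠ 0)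
    (hdet : ∀ᶠ y in 𝓝 x, (hessE e u y).det = κ * Complex.exp (φ y)) (v : Cn n) :
    wirt v (fun y => (φ y : ℂ)) =ᶠ[𝓝 x]
      fun y => ∑ a, ∑ b, (hessE e u y)⁻¹ a b * wirt v (fun z => hessE e u z b a) y := by
  filter_upwards [hdet.eventually_nhds, hu.eventually (by simp),
    hφ.eventually (by simp)] with y h1 h2 h3
  exact wirt_log_det hκ (fun i j => (contDiffAt_hessE h2 i j).differentiableAt (by norm_num))
    ((contDiffAt_ofReal h3).differentiableAt (by norm_num)) h1

/-- Apply the product rule to ∂_v φ = tr(g⁻¹ ∂_v g), with the jet of g⁻¹ from `WJet.matrix_inv`. -/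
lemma log_det_jet (hu : ContDiffAt ℝ 5 u x) (hφ : ContDiffAt ℝ 3 φ x) (hg : hessE e u x = 1)
    (hκ : κ ≠ 0) (hdet : ∀ᶠ y in 𝓝 x, (hessE e u y).det = κ * Complex.exp (φ y))
    (v : Cn n) (k j : Fin n) :
    wirtBar (e j) (wirt v fun y => (φ y : ℂ)) x
      = (∑ a, wirtBar (e j) (wirt v fun y => hessE e u y a a) x)
        - ∑ a, ∑ b, (dHess e u x j)ᴴ a b * wirt v (fun y => hessE e u y b a) x ∧
    wirt (e k) (wirtBar (e j) (wirt v fun y => (φ y : ℂ))) x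
      = ∑ a, ∑ b, ((-ddHess e u x k j + dHess e u x k * (dHess e u x j)ᴴ
            + (dHess e u x j)ᴴ * dHess e u x k) a b * wirt v (fun y => hessE e u y b a) x
          - (dHess e u x j)ᴴ a b * wirt (e k) (wirt v fun y => hessE e u y b a) x
          - dHess e u x k a b * wirtBar (e j) (wirt v fun y => hessE e u y b a) x)
        + ∑ a, wirt (e k) (wirtBar (e j) (wirt v fun y => hessE e u y a a)) x := by
  have hG := WJet.matrix_inv (hessE_jet hu hg k j)
  have hs : ∀ a b, WJet x (e k) (e j) (wirt v fun y => hessE e u y b a) _ _ _ _ := fun a b =>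
    WJet.of_contDiffAt (contDiffAt_wirt (k := 2) (contDiffAt_hessE hu b a) v)
  have key := (WJet.sum Finset.univ fun a _ => WJet.sum Finset.univ fun b _ =>
    (hG a b).mul (hs a b)).congr (wirt_log_det_eventually hu hφ hκ hdet v).symm
  constructor
  · rw [key.snd, ← Finset.sum_sub_distrib]
    refine Finset.sum_congr rfl fun a _ => ?_
    rw [Finset.sum_add_distrib, add_comm, sub_eq_add_neg, ← Finset.sum_neg_distrib]
    congr 1
    · simp [Matrix.one_apply]
    · simp
  · rw [key.mix, ← Finset.sum_add_distrib]
    refine Finset.sum_congr rfl fun a _ => ?_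
    have h1 : wirt (e k) (wirtBar (e j) (wirt v fun y => hessE e u y a a)) x
        = ∑ b, (1 : Matrix (Fin n) (Fin n) ℂ) a b *
          wirt (e k) (wirtBar (e j) (wirt v fun y => hessE e u y b a)) x := by
      simp [Matrix.one_apply]
    rw [h1, ← Finset.sum_add_distrib]
    refine Finset.sum_congr rfl fun b _ => ?_
    rw [Matrix.neg_apply (dHess e u x k), Matrix.neg_apply (dHess e u x j)ᴴ]
    ring

lemma dHess_symm (hu : ContDiffAt ℝ 5 u x) (i j k : Fin n) :
    dHess e u x k i j = dHess e u x i k j :=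
  third_symm ((contDiffAt_ofReal hu).of_le (by norm_num))

/-- The Kähler symmetry of the curvature: tracing over the two derivative directions gives the same
as tracing over the matrix indices, which is the Hessian of log det g. -/
lemma hessian_log_det (hu : ContDiffAt ℝ 5 u x) (hφ : ContDiffAt ℝ 3 φ x) (hg : hessE e u x = 1)
    (hκ : κ ≠ 0) (hdet : ∀ᶠ y in 𝓝 x, (hessE e u y).det = κ * Complex.exp (φ y)) :
    ∑ c, (ddHess e u x c c - dHess e u x c * (dHess e u x c)ᴴ) = hessE e φ x := by
  ext i j
  have h := (log_det_jet hu hφ hg hκ hdet (e i) j j).1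
  simp only [hessE, Matrix.of_apply]
  rw [h, Matrix.sum_apply]
  simp only [Matrix.sub_apply, Finset.sum_sub_distrib]
  congr 1
  · exact Finset.sum_congr rfl fun c _ =>
      fourth_symm_trace ((contDiffAt_ofReal hu).of_le (by norm_num))
  · rw [Finset.sum_comm]
    refine Finset.sum_congr rfl fun c _ => ?_
    rw [Matrix.mul_apply]
    refine Finset.sum_congr rfl fun m _ => ?_
    simp only [Matrix.conjTranspose_apply]
    rw [dHess_symm hu i m c, dHess_symm hu j m c, mul_comm]
    rfl

/-- After permuting derivatives, the connection terms on the left match one by one the terms of the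
twice differentiated trace identity. There is no curvature remainder because `bochner_algebra` has
already split it off. -/
lemma third_log_det (hu : ContDiffAt ℝ 5 u x) (hφ : ContDiffAt ℝ 3 φ x) (hg : hessE e u x = 1)
    (hκ : κ ≠ 0) (hdet : ∀ᶠ y in 𝓝 x, (hessE e u y).det = κ * Complex.exp (φ y)) :
    ∑ c, ((fun α => wirt (e c) (wirtBar (e c) (fun y => thirdE e u y α)) x)
            - slotsHol (dHess e u x c) *ᵥ (fun α => wirtBar (e c) (fun y => thirdE e u y α) x)
            - (slotBar (dHess e u x c))ᴴ *ᵥ (fun α => wirt (e c) (fun y => thirdE e u y α) x)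
            + (slotsHol (dHess e u x c) * (slotBar (dHess e u x c))ᴴ) *ᵥ thirdE e u x)
      = thirdE e φ x := by
  ext ⟨i, j, k⟩
  have hU := contDiffAt_ofReal hu
  have hU4 : ContDiffAt ℝ 4 (fun y => (u y : ℂ)) x := hU.of_le (by norm_num)
  have h := (log_det_jet hu hφ hg hκ hdet (e i) k j).2
  have h5 : ∀ c, wirt (e c) (wirtBar (e c) (fun y => thirdE e u y (i, j, k))) x
      = wirt (e k) (wirtBar (e j) (wirt (e i) fun y => hessE e u y c c)) x := fun c =>
    fifth_symm hU
  have h4a : ∀ c m, wirtBar (e c) (fun y => thirdE e u y (m, j, k)) x = ddHess e u x k j m c :=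
    fun c m => fourth_symm hU4
  have h4b : ∀ c m, wirtBar (e c) (fun y => thirdE e u y (i, j, m)) x
      = wirtBar (e j) (wirt (e i) fun y => hessE e u y m c) x := by
    intro c m
    have : (fun y => thirdE e u y (i, j, m)) =ᶠ[𝓝 x] fun y => thirdE e u y (m, j, i) :=
      third_symm_eventually (hU.of_le (by norm_num))
    rw [wirtBar_congr this, ← wirt_wirtBar_comm ((contDiffAt_hessE hu m c).of_le (by norm_num))]
    exact fourth_symm hU4
  have h4c : ∀ c m, wirt (e c) (fun y => thirdE e u y (i, m, k)) x
      = wirt (e k) (wirt (e i) fun y => hessE e u y c m) x := fun c m => fourth_symm_hol hU4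
  have h3 : ∀ p q r, thirdE e u x (p, q, r) = dHess e u x r p q := fun p q r => rfl
  have hw : ∀ b a, wirt (e i) (fun y => hessE e u y b a) x = dHess e u x i b a := fun _ _ => rfl
  change _ = wirt (e k) (wirtBar (e j) (wirt (e i) fun y => (φ y : ℂ))) x
  rw [h, Finset.sum_apply]
  simp only [Pi.add_apply, Pi.sub_apply, ← Matrix.mulVec_mulVec, slotsHol_mulVec_apply,
    slotBar_conjTranspose_mulVec_apply, h5, h4a, h4b, h4c, h3, hw, Finset.sum_add_distrib,
    Finset.sum_sub_distrib, Matrix.add_apply, Matrix.neg_apply, add_mul, neg_mul,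
    Finset.sum_neg_distrib]
  -- The five identities t1 to t5 only relabel summation indices and exchange unbarred indices by
  -- `dHess_symm`.
  have t1 : ∑ c, ∑ m, dHess e u x c i m * ddHess e u x k j m c
      = ∑ a, ∑ b, ddHess e u x k j a b * dHess e u x i b a := by
    rw [Finset.sum_comm]
    refine Finset.sum_congr rfl fun m _ => Finset.sum_congr rfl fun c _ => ?_
    rw [dHess_symm hu i m c, mul_comm]
  have t2 : ∑ c, ∑ m, dHess e u x c k m * wirtBar (e j) (wirt (e i) fun y => hessE e u y m c) x
      = ∑ a, ∑ b, dHess e u x k a b * wirtBar (e j) (wirt (e i) fun y => hessE e u y b a) x := by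
    refine Finset.sum_congr rfl fun c _ => Finset.sum_congr rfl fun m _ => ?_
    rw [dHess_symm hu k m c]
  have t3 : ∑ c, ∑ m, conj (dHess e u x c j m) *
        wirt (e k) (wirt (e i) fun y => hessE e u y c m) x
      = ∑ a, ∑ b, (dHess e u x j)ᴴ a b * wirt (e k) (wirt (e i) fun y => hessE e u y b a) x := by
    rw [Finset.sum_comm]
    refine Finset.sum_congr rfl fun m _ => Finset.sum_congr rfl fun c _ => ?_
    rw [dHess_symm hu j m c]
    rfl
  have t4 : ∑ c, ∑ m, dHess e u x c i m * ∑ l, conj (dHess e u x c j l) * dHess e u x k m l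
      = ∑ a, ∑ b, (dHess e u x k * (dHess e u x j)ᴴ) a b * dHess e u x i b a := by
    rw [Finset.sum_comm]
    refine Finset.sum_congr rfl fun m _ => Finset.sum_congr rfl fun c _ => ?_
    rw [dHess_symm hu i m c, Matrix.mul_apply, mul_comm]
    refine congrArg (· * _) (Finset.sum_congr rfl fun l _ => ?_)
    rw [dHess_symm hu j l c, mul_comm]
    rfl
  have t5 : ∑ c, ∑ m, dHess e u x c k m * ∑ l, conj (dHess e u x c j l) * dHess e u x m i l
      = ∑ a, ∑ b, ((dHess e u x j)ᴴ * dHess e u x k) a b * dHess e u x i b a := by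
    simp only [Matrix.mul_apply, Finset.mul_sum, Finset.sum_mul]
    calc _ = ∑ c, ∑ l, ∑ m, dHess e u x c k m *
          (conj (dHess e u x c j l) * dHess e u x m i l) :=
          Finset.sum_congr rfl fun c _ => Finset.sum_comm
      _ = ∑ l, ∑ c, ∑ m, dHess e u x c k m *
          (conj (dHess e u x c j l) * dHess e u x m i l) := Finset.sum_comm
      _ = _ := by
        refine Finset.sum_congr rfl fun l _ => ?_
        rw [Finset.sum_comm]
        refine Finset.sum_congr rfl fun m _ => Finset.sum_congr rfl fun c _ => ?_
        rw [dHess_symm hu k m c, dHess_symm hu j l c, dHess_symm hu i l m,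
          Matrix.conjTranspose_apply, Complex.star_def]
        ring
  linear_combination -t1 - t2 - t3 + t4 + t5

/-- The Bochner formula for Calabi's quantity, at a point where the metric is the identity. -/
theorem bochner_formula (hu : ContDiffAt ℝ 5 u x) (hφ : ContDiffAt ℝ 3 φ x)
    (hg : hessE e u x = 1) (hκ : κ ≠ 0)
    (hdet : ∀ᶠ y in 𝓝 x, (hessE e u y).det = κ * Complex.exp (φ y)) :
    ∃ (α β : Fin n → Fin n × Fin n × Fin n → ℂ) (D : Fin n → ℂ),
      (∀ c, WJet x (e c) (e c) (calabi e u) (star (thirdE e u x) ⬝ᵥ thirdE e u x)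
        (star (β c) ⬝ᵥ thirdE e u x + star (thirdE e u x) ⬝ᵥ α c)
        (star (α c) ⬝ᵥ thirdE e u x + star (thirdE e u x) ⬝ᵥ β c) (D c)) ∧
      ∑ c, D c = ∑ c, (star (α c) ⬝ᵥ α c + star (β c) ⬝ᵥ β c)
        + (star (thirdE e u x) ⬝ᵥ thirdE e φ x + star (thirdE e φ x) ⬝ᵥ thirdE e u x)
        - star (thirdE e u x) ⬝ᵥ
          ((slotsHol (hessE e φ x) + slotBar (hessE e φ x)) *ᵥ thirdE e u x) := by
  -- Unification fills in the witnesses: α c and β c are the covariant derivatives of the third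
  -- order tensor in the directions ∂_c and ∂̄_c.
  refine ⟨_, _, _, fun c => calabi_jet hu hg c, ?_⟩
  have hΦ : slotsHol (hessE e φ x) + slotBar (hessE e φ x)
      = ∑ c, (slotsHol (ddHess e u x c c - dHess e u x c * (dHess e u x c)ᴴ)
            + slotBar (ddHess e u x c c - dHess e u x c * (dHess e u x c)ᴴ)) := by
    rw [← hessian_log_det hu hφ hg hκ hdet, Finset.sum_add_distrib]
    exact congrArg₂ _ (map_sum slotsHolHom _ _) (map_sum slotBarHom _ _)
  rw [hΦ, ← third_log_det hu hφ hg hκ hdet, Matrix.sum_mulVec, dotProduct_sum, dotProduct_sum,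
    star_sum, sum_dotProduct, ← Finset.sum_add_distrib, ← Finset.sum_add_distrib,
    ← Finset.sum_sub_distrib]

end atNormalizedPoint

end bochner

/-! ### Changes of frame and normalisation of the metric -/

section frames

open Matrix
open scoped Kronecker

variable {n : ℕ}

section squareNorm

variable {ι : Type*} [Fintype ι]

/-- The squared Euclidean norm of a family of complex numbers. -/
def nsq (s : ι → ℂ) : ℝ := ∑ α, ‖s α‖ ^ 2

lemma nsq_nonneg (s : ι → ℂ) : 0 ≤ nsq s := Finset.sum_nonneg fun _ _ => by positivity

lemma star_dotProduct_self (s : ι → ℂ) : star s ⬝ᵥ s = (nsq s : ℂ) := by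
  simp only [nsq, dotProduct, Complex.ofReal_sum]
  refine Finset.sum_congr rfl fun α _ => ?_
  rw [Pi.star_apply, Complex.star_def, mul_comm, Complex.mul_conj, Complex.normSq_eq_norm_sq]

lemma norm_star_dotProduct_le (s t : ι → ℂ) : ‖star s ⬝ᵥ t‖ ≤ √(nsq s) * √(nsq t) := by
  refine (norm_sum_le _ _).trans ?_
  have := Real.sum_mul_le_sqrt_mul_sqrt Finset.univ (fun α => ‖s α‖) (fun α => ‖t α‖)
  simpa [nsq] using this

lemma nsq_conj (s : ι → ℂ) : nsq (fun α => conj (s α)) = nsq s := by simp [nsq]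

/-- The matrix `A` enlarges squared norms by at most the factor `μ`. -/
def BoundedBy {κ : Type*} [Fintype κ] (A : Matrix κ ι ℂ) (μ : ℝ) : Prop :=
  ∀ y, nsq (A *ᵥ y) ≤ μ * nsq y

lemma BoundedBy.mul {A B : Matrix ι ι ℂ} {μ ν : ℝ} (hμ : 0 ≤ μ) (hA : BoundedBy A μ)
    (hB : BoundedBy B ν) : BoundedBy (A * B) (μ * ν) := fun y => by
  rw [← Matrix.mulVec_mulVec, mul_assoc]
  exact (hA _).trans (mul_le_mul_of_nonneg_left (hB y) hμ)

lemma BoundedBy.conj {A : Matrix ι ι ℂ} {μ : ℝ} (hA : BoundedBy A μ) :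
    BoundedBy Aᴴᵀ μ := fun y => by
  have h : Aᴴᵀ *ᵥ y = fun α => (starRingEnd ℂ) ((A *ᵥ fun β => (starRingEnd ℂ) (y β)) α) := by
    funext α
    simp [Matrix.mulVec, dotProduct]
  rw [h, nsq_conj, ← nsq_conj y]
  exact hA _

lemma BoundedBy.kronecker_one {κ : Type*} [Fintype κ] [DecidableEq κ] {A : Matrix ι ι ℂ} {μ : ℝ}
    (hA : BoundedBy A μ) : BoundedBy (A ⊗ₖ (1 : Matrix κ κ ℂ)) μ := fun y => by
  have h : ∀ α k, ((A ⊗ₖ (1 : Matrix κ κ ℂ)) *ᵥ y) (α, k) = (A *ᵥ fun β => y (β, k)) α := by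
    intro α k
    simp [Matrix.mulVec, dotProduct, Fintype.sum_prod_type, Matrix.kroneckerMap_apply,
      Matrix.one_apply]
  simp only [nsq, Fintype.sum_prod_type_right, h]
  rw [Finset.mul_sum]
  exact Finset.sum_le_sum fun k _ => hA _

lemma BoundedBy.one_kronecker {κ : Type*} [Fintype κ] [DecidableEq κ] {A : Matrix ι ι ℂ} {μ : ℝ}
    (hA : BoundedBy A μ) : BoundedBy ((1 : Matrix κ κ ℂ) ⊗ₖ A) μ := fun y => by
  have h : ∀ k α, (((1 : Matrix κ κ ℂ) ⊗ₖ A) *ᵥ y) (k, α) = (A *ᵥ fun β => y (k, β)) α := by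
    intro k α
    simp [Matrix.mulVec, dotProduct, Fintype.sum_prod_type, Matrix.kroneckerMap_apply,
      Matrix.one_apply]
  simp only [nsq, Fintype.sum_prod_type, h]
  rw [Finset.mul_sum]
  exact Finset.sum_le_sum fun k _ => hA _

/-- The action of a change of frame on the tensors `s_{i j̄ k}`. -/
def tensorFrame (T : Matrix ι ι ℂ) : Matrix (ι × ι × ι) (ι × ι × ι) ℂ := T ⊗ₖ (Tᴴᵀ ⊗ₖ T)

/-- The action factors into three commuting actions on single slots, each costing one factor μ;
conjugating the matrix does not change its bound. -/
lemma BoundedBy.tensorFrame [DecidableEq ι] {A : Matrix ι ι ℂ} {μ : ℝ} (hμ : 0 ≤ μ)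
    (hA : BoundedBy A μ) : BoundedBy (tensorFrame A) (μ ^ 3) := by
  have h : ComplexMA.tensorFrame A = (A ⊗ₖ (1 : Matrix (ι × ι) (ι × ι) ℂ)) *
      (((1 : Matrix ι ι ℂ) ⊗ₖ (Aᴴᵀ ⊗ₖ (1 : Matrix ι ι ℂ))) *
        ((1 : Matrix ι ι ℂ) ⊗ₖ ((1 : Matrix ι ι ℂ) ⊗ₖ A))) := by
    simp only [ComplexMA.tensorFrame, ← Matrix.mul_kronecker_mul, one_mul, mul_one]
  rw [h, pow_three]
  exact hA.kronecker_one.mul hμ (hA.conj.kronecker_one.one_kronecker.mul hμ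
    hA.one_kronecker.one_kronecker)

lemma tensorFrame_mul (A B : Matrix ι ι ℂ) :
    tensorFrame A * tensorFrame B = tensorFrame (A * B) := by
  simp only [tensorFrame, ← Matrix.mul_kronecker_mul, Matrix.conjTranspose_mul,
    Matrix.transpose_mul]

lemma tensorFrame_one [DecidableEq ι] : tensorFrame (1 : Matrix ι ι ℂ) = 1 := by
  simp [tensorFrame]

lemma tensorMetric_frame (T G : Matrix ι ι ℂ) :
    (tensorFrame T)ᴴ * tensorMetric G * tensorFrame T = tensorMetric (Tᴴ * G * T) := by
  have hT : Tᴴᵀᴴ = Tᵀ := by ext; simp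
  simp only [tensorFrame, tensorMetric, Matrix.conjTranspose_kronecker,
    ← Matrix.mul_kronecker_mul, hT, Matrix.transpose_mul, Matrix.mul_assoc]

end squareNorm

section frames

/-- The frame whose coordinates are the rows of `T`. -/
def frame (T : Matrix (Fin n) (Fin n) ℂ) (a : Fin n) : Cn n := WithLp.toLp 2 (T a)

lemma frame_eq_sum (T : Matrix (Fin n) (Fin n) ℂ) (a : Fin n) :
    frame T a = ∑ i, T a i • (EuclideanSpace.single i (1 : ℂ) : Cn n) := by
  ext j
  simp [frame, Finset.sum_apply, Pi.single_apply]

lemma frame_one (a : Fin n) : frame 1 a = EuclideanSpace.single a (1 : ℂ) := by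
  rw [frame_eq_sum]; simp [Matrix.one_apply, ite_smul]

lemma wirt_frame (T : Matrix (Fin n) (Fin n) ℂ) (a : Fin n) (f : Cn n → ℂ) :
    wirt (frame T a) f = fun x => ∑ i, T a i * wirt (frame 1 i) f x := by
  funext x
  rw [frame_eq_sum, wirt_sum_dir]
  simp only [frame_one]

lemma wirtBar_frame (T : Matrix (Fin n) (Fin n) ℂ) (a : Fin n) (f : Cn n → ℂ) :
    wirtBar (frame T a) f = fun x => ∑ i, conj (T a i) * wirtBar (frame 1 i) f x := by
  funext x
  rw [frame_eq_sum, wirtBar_sum_dir]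
  simp only [frame_one]

variable {u : Cn n → ℝ} {x : Cn n}

lemma wirt_const_mul {f : Cn n → ℂ} {v : Cn n} (c : ℂ) (hf : DifferentiableAt ℝ f x) :
    wirt v (fun y => c * f y) x = c * wirt v f x := by
  rw [wirt_mul (by fun_prop) hf, wirt_const]; simp

lemma wirtBar_const_mul {f : Cn n → ℂ} {v : Cn n} (c : ℂ) (hf : DifferentiableAt ℝ f x) :
    wirtBar v (fun y => c * f y) x = c * wirtBar v f x := by
  rw [wirtBar_mul (by fun_prop) hf, wirtBar_const]; simp

lemma wirtBar_wirt_frame {f : Cn n → ℂ} (T : Matrix (Fin n) (Fin n) ℂ) (hf : ContDiffAt ℝ 2 f x)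
    (a b : Fin n) : wirtBar (frame T b) (wirt (frame T a) f) x
      = ∑ i, ∑ j, T a i * conj (T b j) * wirtBar (frame 1 j) (wirt (frame 1 i) f) x := by
  have hd : ∀ i, DifferentiableAt ℝ (wirt (frame 1 i) f) x := fun i =>
    (contDiffAt_wirt (k := 1) hf _).differentiableAt (by norm_num)
  rw [wirtBar_frame, wirt_frame, Finset.sum_comm]
  refine Finset.sum_congr rfl fun j _ => ?_
  rw [wirtBar_sum _ _ fun i _ => (hd i).const_mul _, Finset.mul_sum]
  refine Finset.sum_congr rfl fun i _ => ?_
  rw [wirtBar_const_mul _ (hd i)]; ring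

lemma hessE_frame (T : Matrix (Fin n) (Fin n) ℂ) (hu : ContDiffAt ℝ 2 u x) :
    hessE (frame T) u x = T * hessE (frame 1) u x * Tᴴ := by
  ext a b
  simp only [hessE, Matrix.of_apply, Matrix.mul_apply, Matrix.conjTranspose_apply,
    wirtBar_wirt_frame T (contDiffAt_ofReal hu), Finset.sum_mul]
  rw [Finset.sum_comm]
  refine Finset.sum_congr rfl fun j _ => Finset.sum_congr rfl fun i _ => ?_
  rw [Complex.star_def]; ring

lemma thirdE_frame (T : Matrix (Fin n) (Fin n) ℂ) (hu : ContDiffAt ℝ 3 u x) :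
    thirdE (frame T) u x = tensorFrame T *ᵥ thirdE (frame 1) u x := by
  funext ⟨a, b, c⟩
  have hU := contDiffAt_ofReal hu
  have hd : ∀ i j, DifferentiableAt ℝ
      (wirtBar (frame 1 j) (wirt (frame 1 i) fun y => (u y : ℂ))) x := fun i j =>
    (contDiffAt_wirtBar (k := 1) (contDiffAt_wirt (k := 2) hU _) _).differentiableAt (by norm_num)
  have h1 : wirtBar (frame T b) (wirt (frame T a) fun y => (u y : ℂ)) =ᶠ[𝓝 x] fun y =>
      ∑ i, ∑ j, T a i * conj (T b j) *
        wirtBar (frame 1 j) (wirt (frame 1 i) fun y => (u y : ℂ)) y := by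
    filter_upwards [hU.eventually (by simp)] with y hy
    exact wirtBar_wirt_frame T (hy.of_le (by norm_num)) a b
  rw [tensorFrame, kronecker_mulVec_apply]
  change wirt (frame T c) (wirtBar (frame T b) (wirt (frame T a) fun y => (u y : ℂ))) x = _
  rw [wirt_congr h1, wirt_frame]
  have h2 : ∀ k, wirt (frame 1 k) (fun y => ∑ i, ∑ j, T a i * conj (T b j) *
        wirtBar (frame 1 j) (wirt (frame 1 i) fun y => (u y : ℂ)) y) x
      = ∑ i, ∑ j, T a i * conj (T b j) * thirdE (frame 1) u x (i, j, k) := by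
    intro k
    rw [wirt_sum _ _ fun i _ => DifferentiableAt.fun_sum fun j _ => (hd i j).const_mul _]
    refine Finset.sum_congr rfl fun i _ => ?_
    rw [wirt_sum _ _ fun j _ => (hd i j).const_mul _]
    exact Finset.sum_congr rfl fun j _ => wirt_const_mul _ (hd i j)
  simp only [h2, Finset.mul_sum]
  rw [Finset.sum_comm]
  refine Finset.sum_congr rfl fun i _ => ?_
  rw [Finset.sum_comm]
  refine Finset.sum_congr rfl fun j _ => Finset.sum_congr rfl fun k _ => ?_
  rw [Matrix.transpose_apply, Matrix.conjTranspose_apply, Complex.star_def]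
  ring

lemma calabi_eq (e : Fin n → Cn n) (u : Cn n → ℝ) (x : Cn n) :
    calabi e u x = star (thirdE e u x) ⬝ᵥ (tensorMetric (hessE e u x)⁻¹ *ᵥ thirdE e u x) := rfl

/-- Calabi's quantity does not depend on the frame. -/
lemma calabi_frame {T B : Matrix (Fin n) (Fin n) ℂ} (hBT : B * T = 1) (hu : ContDiffAt ℝ 3 u x) :
    calabi (frame T) u x = calabi (frame 1) u x := by
  have hTB : T * B = 1 := mul_eq_one_comm.mp hBT
  have hTi : T⁻¹ = B := Matrix.inv_eq_left_inv hBT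
  have hTi' : Tᴴ⁻¹ = Bᴴ := by rw [← Matrix.conjTranspose_nonsing_inv, hTi]
  have hB : Tᴴ * Bᴴ = 1 := by rw [← Matrix.conjTranspose_mul, hBT, Matrix.conjTranspose_one]
  have hG : Tᴴ * (T * hessE (frame 1) u x * Tᴴ)⁻¹ * T = (hessE (frame 1) u x)⁻¹ := by
    rw [Matrix.mul_inv_rev, Matrix.mul_inv_rev, hTi, hTi', ← mul_assoc, hB, one_mul, mul_assoc,
      hBT, mul_one]
  rw [calabi_eq, calabi_eq, thirdE_frame T hu, hessE_frame T (hu.of_le (by norm_num)), ← hG,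
    ← tensorMetric_frame, Matrix.star_mulVec, ← Matrix.dotProduct_mulVec, Matrix.mulVec_mulVec,
    Matrix.mulVec_mulVec, Matrix.mul_assoc]

end frames

section normalization

open scoped MatrixOrder Matrix.Norms.L2Operator in
lemma exists_hermitian_sqrt {A : Matrix (Fin n) (Fin n) ℂ} (hA : A.PosSemidef) :
    ∃ B : Matrix (Fin n) (Fin n) ℂ, B.IsHermitian ∧ B * B = A := by
  refine ⟨CFC.sqrt A, ?_, CFC.sqrt_mul_sqrt_self A (Matrix.nonneg_iff_posSemidef.mpr hA)⟩
  exact (Matrix.nonneg_iff_posSemidef.mp (CFC.sqrt_nonneg A)).1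

lemma nsq_mulVec {ι : Type*} [Fintype ι] (B : Matrix ι ι ℂ) (y : ι → ℂ) :
    ((nsq (B *ᵥ y) : ℝ) : ℂ) = star y ⬝ᵥ ((Bᴴ * B) *ᵥ y) := by
  rw [← star_dotProduct_self, Matrix.star_mulVec, ← Matrix.dotProduct_mulVec,
    Matrix.mulVec_mulVec]

lemma MatrixBetween.bounds {A : Matrix (Fin n) (Fin n) ℂ} {a b : ℝ} (h : MatrixBetween a b A)
    (y : Fin n → ℂ) : a * nsq y ≤ (star y ⬝ᵥ (A *ᵥ y)).re ∧
      (star y ⬝ᵥ (A *ᵥ y)).re ≤ b * nsq y := by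
  have h1 := (Complex.le_def.mp (h.1.dotProduct_mulVec_nonneg y)).1
  have h2 := (Complex.le_def.mp (h.2.dotProduct_mulVec_nonneg y)).1
  simp only [Matrix.sub_mulVec, dotProduct_sub, Matrix.smul_mulVec, Matrix.one_mulVec,
    dotProduct_smul, star_dotProduct_self, Complex.zero_re, Complex.sub_re, smul_eq_mul,
    ← Complex.ofReal_mul, Complex.ofReal_re] at h1 h2
  exact ⟨by linarith, by linarith⟩

/-- The frame in which a positive matrix becomes the identity. -/
lemma exists_normalizing_frame {A : Matrix (Fin n) (Fin n) ℂ} {lam Lam : ℝ} (hlam : 0 < lam)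
    (hA : MatrixBetween lam Lam A) :
    ∃ T B : Matrix (Fin n) (Fin n) ℂ, B * T = 1 ∧ T * A * Tᴴ = 1 ∧ BoundedBy T lam⁻¹ ∧
      BoundedBy B Lam ∧ ∀ y, lam * nsq y ≤ nsq (B *ᵥ y) := by
  have hpsd : A.PosSemidef := by
    have h := hA.1.add (Matrix.PosSemidef.one.smul (Complex.zero_le_real.mpr hlam.le))
    simpa using h
  -- With B the Hermitian square root, |By|² = ⟨Ay, y⟩, so both bounds on A are bounds on B. The
  -- lower one makes B invertible, and its inverse is the frame.
  obtain ⟨B, hB, hBB⟩ := exists_hermitian_sqrt hpsd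
  have hre : ∀ y, nsq (B *ᵥ y) = (star y ⬝ᵥ (A *ᵥ y)).re := by
    intro y
    rw [← hBB]
    conv_rhs => rw [← hB.eq, hB.eq]
    have := nsq_mulVec B y
    rw [hB.eq] at this
    rw [← this, Complex.ofReal_re]
  have hlow : ∀ y, lam * nsq y ≤ nsq (B *ᵥ y) := fun y => by rw [hre]; exact (hA.bounds y).1
  have hup : BoundedBy B Lam := fun y => by rw [hre]; exact (hA.bounds y).2
  have hinj : Function.Injective B.mulVec := by
    intro y z hyz
    have h0 : B *ᵥ (y - z) = 0 := by rw [Matrix.mulVec_sub, sub_eq_zero]; exact hyz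
    have h1 := hlow (y - z)
    rw [h0] at h1
    have h2 : nsq (y - z) = 0 := by
      refine le_antisymm ?_ (nsq_nonneg _)
      have : nsq (0 : Fin n → ℂ) = 0 := by simp [nsq]
      rw [this] at h1
      nlinarith
    funext i
    have h3 := (Finset.sum_eq_zero_iff_of_nonneg fun _ _ => by positivity).mp h2 i
      (Finset.mem_univ i)
    simpa [sub_eq_zero] using h3
  have hu : IsUnit B := Matrix.mulVec_injective_iff_isUnit.mp hinj
  have hdet : IsUnit B.det := (Matrix.isUnit_iff_isUnit_det B).mp hu
  have hBT : B * B⁻¹ = 1 := Matrix.mul_nonsing_inv B hdet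
  have hTB : B⁻¹ * B = 1 := Matrix.nonsing_inv_mul B hdet
  refine ⟨B⁻¹, B, hBT, ?_, fun y => ?_, hup, hlow⟩
  · rw [← hBB, Matrix.conjTranspose_nonsing_inv, hB.eq, ← mul_assoc, hTB, one_mul, hBT]
  · have h := hlow (B⁻¹ *ᵥ y)
    rw [Matrix.mulVec_mulVec, hBT, Matrix.one_mulVec] at h
    rw [inv_mul_eq_div, le_div_iff₀ hlam, mul_comm]
    exact h

end normalization

end frames

/-! ### The maximum principle, the cutoff, and the Laplacian of Δu -/

section maximumPrinciple

open Matrix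
open scoped Kronecker

variable {n : ℕ}

section maximum

variable {x v w : Cn n} {f g : Cn n → ℂ} {a b c d : ℂ}

lemma WJet.const_mul (h : WJet x v w f a b c d) (k : ℂ) :
    WJet x v w (fun y => k * f y) (k * a) (k * b) (k * c) (k * d) := by
  simpa using (WJet.const k).mul h

lemma WJet.mul_const (h : WJet x v w f a b c d) (k : ℂ) :
    WJet x v w (fun y => f y * k) (a * k) (b * k) (c * k) (d * k) := by
  simpa using h.mul (WJet.const k)

/-- With equal directions, conjugation gives a jet in the same directions, and the real part is the
mean of f and its conjugate. Thus complex valued test functions need not first be shown to be real.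
-/
lemma WJet.re (h : WJet x v v f a b c d) :
    wirt v (wirtBar v fun y => ((f y).re : ℂ)) x = d.re := by
  have h2 := (h.add h.conjugate).const_mul (1 / 2)
  have h3 : (fun y => 1 / 2 * (f y + conj (f y))) = fun y => ((f y).re : ℂ) := by
    funext y; rw [Complex.add_conj]; push_cast; ring
  rw [h3] at h2
  rw [h2.mix, Complex.add_conj]; push_cast; ring

lemma fderiv_ofReal {F : Cn n → ℝ} (hF : DifferentiableAt ℝ F x) (v : Cn n) :
    fderiv ℝ (fun y => (F y : ℂ)) x v = (fderiv ℝ F x v : ℂ) := by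
  have := (Complex.ofRealCLM.hasFDerivAt.comp x hF.hasFDerivAt).fderiv
  have h2 : (fun y => (F y : ℂ)) = Complex.ofRealCLM ∘ F := rfl
  rw [h2, this]; rfl

lemma fderiv_fderiv_ofReal {F : Cn n → ℝ} (hF : ContDiffAt ℝ 2 F x) (v w : Cn n) :
    fderiv ℝ (fderiv ℝ fun y => (F y : ℂ)) x w v = (fderiv ℝ (fderiv ℝ F) x w v : ℂ) := by
  rw [← fderiv_fderiv_apply (contDiffAt_ofReal hF)]
  have h : (fun y => fderiv ℝ (fun y => (F y : ℂ)) y v) =ᶠ[𝓝 x]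
      fun y => ((fderiv ℝ F y v : ℝ) : ℂ) := by
    filter_upwards [hF.eventually (by simp)] with y hy
    exact fderiv_ofReal (hy.differentiableAt (by norm_num)) v
  have hd : DifferentiableAt ℝ (fderiv ℝ F) x :=
    (hF.fderiv_right (m := 1) (by norm_num)).differentiableAt (by norm_num)
  rw [h.fderiv_eq, fderiv_ofReal (hd.clm_apply (by fun_prop)),
    fderiv_clm_apply hd (by fun_prop)]
  simp

lemma hasDerivAt_line (x v : Cn n) (t : ℝ) : HasDerivAt (fun s : ℝ => x + s • v) v t := by
  simpa using ((hasDerivAt_id t).smul_const v).const_add x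

lemma deriv_line {F : Cn n → ℝ} {t : ℝ} (hF : DifferentiableAt ℝ F (x + t • v)) :
    HasDerivAt (fun s : ℝ => F (x + s • v)) (fderiv ℝ F (x + t • v) v) t :=
  hF.hasFDerivAt.comp_hasDerivAt t (hasDerivAt_line x v t)

lemma deriv_deriv_line {F : Cn n → ℝ} {t : ℝ} (hF : ContDiffAt ℝ 2 F (x + t • v)) :
    HasDerivAt (fun s : ℝ => fderiv ℝ F (x + s • v) v)
      (fderiv ℝ (fderiv ℝ F) (x + t • v) v v) t := by
  have hd : DifferentiableAt ℝ (fderiv ℝ F) (x + t • v) :=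
    (hF.fderiv_right (m := 1) (by norm_num)).differentiableAt (by norm_num)
  have h1 := hd.hasFDerivAt.comp_hasDerivAt t (hasDerivAt_line x v t)
  exact (ContinuousLinearMap.apply ℝ ℝ v).hasFDerivAt.comp_hasDerivAt t h1

/-- Restrict to a line. A positive second derivative would make the local maximum a local minimum
too, so the restriction would be locally constant and its second derivative zero. -/
lemma fderiv_fderiv_nonpos_of_isLocalMax {F : Cn n → ℝ} (hF : ContDiffAt ℝ 2 F x)
    (hmax : IsLocalMax F x) (v : Cn n) : fderiv ℝ (fderiv ℝ F) x v v ≤ 0 := by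
  by_contra! hpos
  have hcont : ContinuousAt (fun s : ℝ => x + s • v) 0 := by fun_prop
  have h0 : x + (0 : ℝ) • v = x := by simp
  have htend : Tendsto (fun s : ℝ => x + s • v) (𝓝 0) (𝓝 x) := by
    simpa [ContinuousAt] using hcont
  have hd : deriv (fun s : ℝ => F (x + s • v)) =ᶠ[𝓝 0] fun s => fderiv ℝ F (x + s • v) v := by
    filter_upwards [htend.eventually (hF.eventually (by simp))] with s hs
    exact (deriv_line (hs.differentiableAt (by norm_num))).deriv
  have hdd : deriv (deriv fun s : ℝ => F (x + s • v)) 0 = fderiv ℝ (fderiv ℝ F) x v v := by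
    rw [hd.deriv_eq, (deriv_deriv_line (by rwa [h0])).deriv, h0]
  have hm : IsLocalMax (fun s : ℝ => F (x + s • v)) 0 := by
    have := htend.eventually hmax
    simpa [IsLocalMax, IsMaxFilter] using this
  have hmin : IsLocalMin (fun s : ℝ => F (x + s • v)) 0 := by
    refine isLocalMin_of_deriv_deriv_pos (by rw [hdd]; exact hpos) hm.deriv_eq_zero ?_
    have : ContinuousAt F x := hF.continuousAt
    exact ContinuousAt.comp (f := fun s : ℝ => x + s • v) (by rwa [h0]) hcont
  have hconst : (fun s : ℝ => F (x + s • v)) =ᶠ[𝓝 0] fun _ => F (x + (0 : ℝ) • v) := by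
    filter_upwards [hm, hmin] with s h1 h2 using le_antisymm h1 h2
  have h2 : deriv (deriv fun s : ℝ => F (x + s • v)) 0 = 0 := by
    have h3 : deriv (fun s : ℝ => F (x + s • v)) =ᶠ[𝓝 0] fun _ => 0 := by
      filter_upwards [hconst.eventuallyEq_nhds] with s hs
      rw [hs.deriv_eq, deriv_const]
    rw [h3.deriv_eq, deriv_const]
  rw [hdd] at h2
  exact hpos.ne' h2

/-- At a local maximum of the real part of a function, the complex Hessian is nonpositive. -/
lemma WJet.re_mix_nonpos (h : WJet x v v f a b c d) (hmax : IsLocalMax (fun y => (f y).re) x) :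
    d.re ≤ 0 := by
  have hF : ContDiffAt ℝ 2 (fun y => (f y).re) x :=
    Complex.reCLM.contDiff.contDiffAt.comp x h.contDiffAt
  have h1 := h.re
  rw [wirt_wirtBar_self (contDiffAt_ofReal hF), fderiv_fderiv_ofReal hF,
    fderiv_fderiv_ofReal hF] at h1
  have h2 : d.re = 1 / 4 * (fderiv ℝ (fderiv ℝ fun y => (f y).re) x v v
      + fderiv ℝ (fderiv ℝ fun y => (f y).re) x (Complex.I • v) (Complex.I • v)) := by
    exact Complex.ofReal_injective (by rw [← h1]; push_cast; ring)
  rw [h2]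
  have := fderiv_fderiv_nonpos_of_isLocalMax hF hmax v
  have := fderiv_fderiv_nonpos_of_isLocalMax hF hmax (Complex.I • v)
  linarith

end maximum

section cutoff

variable {x v : Cn n}

lemma coord_jet (x v w : Cn n) (i : Fin n) : WJet x v w (fun y => y i) (x i) (v i) 0 0 := by
  have hd : ∀ y w, fderiv ℝ (fun y : Cn n => y i) y w = w i := by
    intro y w
    have : HasFDerivAt (fun y : Cn n => y i)
        ((EuclideanSpace.proj i : Cn n →L[ℂ] ℂ).restrictScalars ℝ) y :=
      ((EuclideanSpace.proj i : Cn n →L[ℂ] ℂ).restrictScalars ℝ).hasFDerivAt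
    rw [this.fderiv]; rfl
  have hI : ∀ z : ℂ, Complex.I * (Complex.I * z) = -z := fun z => by
    rw [← mul_assoc, Complex.I_mul_I]; ring
  have hb : wirtBar w (fun y : Cn n => y i) = fun _ => 0 := by
    funext y
    simp only [wirtBar, hd, PiLp.smul_apply, smul_eq_mul, hI]; ring
  refine ⟨?_, rfl, ?_, by rw [hb], by rw [hb, wirt_const]⟩
  · exact ((EuclideanSpace.proj i : Cn n →L[ℂ] ℂ).restrictScalars ℝ).contDiff.contDiffAt
  · simp only [wirt, hd, PiLp.smul_apply, smul_eq_mul, hI]; ring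

/-- The cutoff function `(ρ² - |y - p|²) / r²`. -/
def cutoff (p : Cn n) (ρ r : ℝ) (y : Cn n) : ℝ := (ρ ^ 2 - ‖y - p‖ ^ 2) * (r ^ 2)⁻¹

lemma norm_sq_eq_sum (y : Cn n) : ((‖y‖ ^ 2 : ℝ) : ℂ) = ∑ i, y i * conj (y i) := by
  rw [EuclideanSpace.norm_sq_eq, Complex.ofReal_sum]
  refine Finset.sum_congr rfl fun i _ => ?_
  rw [Complex.mul_conj, Complex.normSq_eq_norm_sq]

lemma nsq_ofLp (y : Cn n) : nsq (fun i => y i) = ‖y‖ ^ 2 := by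
  rw [EuclideanSpace.norm_sq_eq]; rfl

lemma cutoff_jet (p x v : Cn n) (ρ r : ℝ) :
    WJet x v v (fun y => (cutoff p ρ r y : ℂ)) (cutoff p ρ r x)
      (-(∑ i, v i * conj ((x - p) i)) * ((r ^ 2)⁻¹ : ℝ))
      (conj (-(∑ i, v i * conj ((x - p) i)) * ((r ^ 2)⁻¹ : ℝ)))
      ((-‖v‖ ^ 2 * (r ^ 2)⁻¹ : ℝ) : ℂ) := by
  have h1 : ∀ i, WJet x v v (fun y => (y - p) i) ((x - p) i) (v i) 0 0 := fun i => by
    simpa [sub_eq_add_neg] using (coord_jet x v v i).add (WJet.const (-(p i)))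
  have h2 := ((WJet.sum Finset.univ fun i _ => (h1 i).mul (h1 i).conjugate).const_mul
    (-1)).add (WJet.const ((ρ ^ 2 : ℝ) : ℂ)) |>.mul_const (((r ^ 2)⁻¹ : ℝ) : ℂ)
  have hf : ∀ y, (-1 * ∑ i, (y - p) i * conj ((y - p) i) + ((ρ ^ 2 : ℝ) : ℂ)) *
      (((r ^ 2)⁻¹ : ℝ) : ℂ) = (cutoff p ρ r y : ℂ) := by
    intro y
    rw [← norm_sq_eq_sum, cutoff]; push_cast; ring
  have hv := norm_sq_eq_sum v
  simp only [hf, map_zero, mul_zero, zero_mul, add_zero, zero_add] at h2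
  convert h2 using 1
  · ring
  · rw [map_mul, map_neg, map_sum, Complex.conj_ofReal]
    simp only [map_mul, Complex.conj_conj, neg_mul, one_mul, mul_comm]
  · rw [← hv]; push_cast; ring

end cutoff

section trace

variable {u φ : Cn n → ℝ} {x : Cn n}

lemma trace_jet {m : Type*} [Fintype m] {v w : Cn n} {A : Cn n → Matrix m m ℂ}
    {a b c d : Matrix m m ℂ}
    (h : ∀ i j, WJet x v w (fun y => A y i j) (a i j) (b i j) (c i j) (d i j))
    (B : Matrix m m ℂ) :
    WJet x v w (fun y => (B * A y * Bᴴ).trace) (B * a * Bᴴ).trace (B * b * Bᴴ).trace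
      (B * c * Bᴴ).trace (B * d * Bᴴ).trace := by
  simp only [Matrix.trace, Matrix.diag, Matrix.mul_apply]
  exact WJet.sum _ fun i _ => WJet.sum _ fun j _ =>
    (WJet.sum _ fun k _ => (h k j).const_mul (B i k)).mul_const _

lemma trace_mul_conjTranspose_re {m : Type*} [Fintype m] (A : Matrix m m ℂ) :
    (A * Aᴴ).trace.re = ∑ j, nsq (fun i => A i j) := by
  rw [Matrix.trace_mul_comm]
  simp only [Matrix.trace, Matrix.diag, Matrix.mul_apply, Matrix.conjTranspose_apply,
    Complex.re_sum, nsq]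
  refine Finset.sum_congr rfl fun j _ => Finset.sum_congr rfl fun i _ => ?_
  rw [Complex.star_def, mul_comm, Complex.mul_conj, Complex.normSq_eq_norm_sq, Complex.ofReal_re]

lemma sum_nsq_dHess (e : Fin n → Cn n) :
    ∑ c, ∑ j, nsq (fun i => dHess e u x c i j) = nsq (thirdE e u x) := by
  have h : nsq (thirdE e u x) = ∑ i, ∑ j, ∑ c, ‖dHess e u x c i j‖ ^ 2 := by
    simp only [nsq, Fintype.sum_prod_type]; rfl
  rw [h]
  simp only [nsq]
  calc _ = ∑ c, ∑ i, ∑ j, ‖dHess e u x c i j‖ ^ 2 :=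
        Finset.sum_congr rfl fun c _ => Finset.sum_comm
    _ = ∑ i, ∑ c, ∑ j, ‖dHess e u x c i j‖ ^ 2 := Finset.sum_comm
    _ = _ := Finset.sum_congr rfl fun i _ => Finset.sum_comm

/-- The Laplacian of `Δu` with respect to the metric. -/
lemma trace_laplacian {T B : Matrix (Fin n) (Fin n) ℂ} {κ : ℂ} {lam μ : ℝ} (hBT : B * T = 1)
    (hu : ContDiffAt ℝ 5 u x) (hφ : ContDiffAt ℝ 3 φ x) (hg : hessE (frame T) u x = 1)
    (hκ : κ ≠ 0) (hdet : ∀ᶠ y in 𝓝 x, (hessE (frame T) u y).det = κ * Complex.exp (φ y))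
    (hB : ∀ y, lam * nsq y ≤ nsq (B *ᵥ y)) (hΦ : MatrixBetween (-μ) μ (hessE (frame 1) φ x)) :
    ∃ (b b' D : Fin n → ℂ), (∀ c, WJet x (frame T c) (frame T c)
        (fun y => (hessE (frame 1) u y).trace) (hessE (frame 1) u x).trace (b c) (b' c) (D c)) ∧
      lam * nsq (thirdE (frame T) u x) - n * μ ≤ (∑ c, D c).re := by
  have hTB : T * B = 1 := mul_eq_one_comm.mp hBT
  have hinv : ∀ g : Matrix (Fin n) (Fin n) ℂ, B * (T * g * Tᴴ) * Bᴴ = g := by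
    intro g
    have h : Tᴴ * Bᴴ = 1 := by rw [← Matrix.conjTranspose_mul, hBT, Matrix.conjTranspose_one]
    calc B * (T * g * Tᴴ) * Bᴴ = (B * T) * g * (Tᴴ * Bᴴ) := by simp only [mul_assoc]
      _ = g := by rw [hBT, h, one_mul, mul_one]
  -- The Euclidean trace is recovered from the normalised Hessian by conjugation with B, so it can
  -- be differentiated through the jet of that Hessian.
  have htr : ∀ y, ContDiffAt ℝ 5 u y →
      (B * hessE (frame T) u y * Bᴴ).trace = (hessE (frame 1) u y).trace := by
    intro y hy
    rw [hessE_frame T (hy.of_le (by norm_num)), hinv]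
  have hj : ∀ c, WJet x (frame T c) (frame T c) (fun y => (hessE (frame 1) u y).trace)
      (hessE (frame 1) u x).trace _ _ _ := fun c => by
    have h := (trace_jet (hessE_jet hu hg c c) B).congr
      (g := fun y => (hessE (frame 1) u y).trace) (by
        filter_upwards [hu.eventually (by simp)] with y hy using htr y hy)
    have h0 : (B * (1 : Matrix (Fin n) (Fin n) ℂ) * Bᴴ).trace
        = (hessE (frame 1) u x).trace := by rw [← htr x hu, hg]
    rw [h0] at h
    exact h
  refine ⟨_, _, _, hj, ?_⟩
  · have h1 : ∑ c, ddHess (frame T) u x c c = hessE (frame T) φ x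
        + ∑ c, dHess (frame T) u x c * (dHess (frame T) u x c)ᴴ := by
      rw [← hessian_log_det hu hφ hg hκ hdet, Finset.sum_sub_distrib]; abel
    rw [← Matrix.trace_sum, ← Finset.sum_mul, ← Finset.mul_sum, h1, mul_add, add_mul,
      Matrix.trace_add, hessE_frame T (hφ.of_le (by norm_num)), hinv, Complex.add_re,
      Finset.mul_sum, Finset.sum_mul, Matrix.trace_sum, Complex.re_sum]
    have h2 : -(n * μ) ≤ (hessE (frame 1) φ x).trace.re := by
      have := (Complex.le_def.mp hΦ.1.trace_nonneg).1
      simp only [Matrix.trace_sub, Matrix.trace_smul, Matrix.trace_one, Fintype.card_fin,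
        Complex.sub_re, Complex.zero_re, smul_eq_mul] at this
      have h3 : (((-μ : ℝ) : ℂ) * (n : ℂ)).re = -(n * μ) := by
        rw [← Complex.ofReal_natCast, ← Complex.ofReal_mul, Complex.ofReal_re]; ring
      rw [h3] at this
      linarith
    -- This is the good term: the quadratic part of the curvature identity is a full square of third
    -- derivatives, and B costs at most the factor λ from below.
    have h4 : lam * nsq (thirdE (frame T) u x) ≤ ∑ c, (B * (dHess (frame T) u x c *
        (dHess (frame T) u x c)ᴴ) * Bᴴ).trace.re := by
      rw [← sum_nsq_dHess, Finset.mul_sum]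
      refine Finset.sum_le_sum fun c _ => ?_
      have h5 : B * (dHess (frame T) u x c * (dHess (frame T) u x c)ᴴ) * Bᴴ
          = (B * dHess (frame T) u x c) * (B * dHess (frame T) u x c)ᴴ := by
        rw [Matrix.conjTranspose_mul]; simp only [mul_assoc]
      rw [h5, trace_mul_conjTranspose_re, Finset.mul_sum]
      exact Finset.sum_le_sum fun j _ => hB _
    linarith

end trace

end maximumPrinciple

/-! ### The inequality at an interior maximum -/

section pointwiseInequality

open Matrix
open scoped Kronecker

variable {n : ℕ}

section pointwise

variable {u φ : Cn n → ℝ} {x : Cn n}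

/-- Absorbing the gradient terms of the cutoff. -/
lemma cutoff_cross_term {ι : Type*} [Fintype ι] (η : ℝ) (p : ℂ) (s α β : ι → ℂ) :
    -(η ^ 2 * (nsq α + nsq β) + 8 * ‖p‖ ^ 2 * nsq s)
      ≤ (2 * η * conj p * (star β ⬝ᵥ s + star s ⬝ᵥ α)
        + 2 * η * p * (star α ⬝ᵥ s + star s ⬝ᵥ β)).re := by
  set a := √(nsq α)
  set b := √(nsq β)
  set q := √(nsq s)
  have ha : a ^ 2 = nsq α := Real.sq_sqrt (nsq_nonneg _)
  have hb : b ^ 2 = nsq β := Real.sq_sqrt (nsq_nonneg _)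
  have hq : q ^ 2 = nsq s := Real.sq_sqrt (nsq_nonneg _)
  have e1 : ‖star β ⬝ᵥ s + star s ⬝ᵥ α‖ ≤ q * (a + b) := by
    refine (norm_add_le _ _).trans ?_
    have h1 : ‖star β ⬝ᵥ s‖ ≤ b * q := norm_star_dotProduct_le β s
    have h2 : ‖star s ⬝ᵥ α‖ ≤ q * a := norm_star_dotProduct_le s α
    linarith
  have e2 : ‖star α ⬝ᵥ s + star s ⬝ᵥ β‖ ≤ q * (a + b) := by
    refine (norm_add_le _ _).trans ?_
    have h1 : ‖star α ⬝ᵥ s‖ ≤ a * q := norm_star_dotProduct_le α s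
    have h2 : ‖star s ⬝ᵥ β‖ ≤ q * b := norm_star_dotProduct_le s β
    linarith
  have h1 : ‖2 * η * conj p * (star β ⬝ᵥ s + star s ⬝ᵥ α)
        + 2 * η * p * (star α ⬝ᵥ s + star s ⬝ᵥ β)‖ ≤ 4 * (|η| * ‖p‖) * (q * (a + b)) := by
    refine (norm_add_le _ _).trans ?_
    simp only [norm_mul, RCLike.norm_conj, Complex.norm_ofNat, Complex.norm_real,
      Real.norm_eq_abs]
    have hp : 0 ≤ 2 * |η| * ‖p‖ := by positivity
    have := mul_le_mul_of_nonneg_left e1 hp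
    have := mul_le_mul_of_nonneg_left e2 hp
    linarith
  have h2 := (abs_le.mp ((Complex.abs_re_le_norm _).trans h1)).1
  refine le_trans ?_ h2
  rw [← ha, ← hb, ← hq, ← sq_abs η]
  -- Each of the two squares contributes 4‖p‖²q², which is the origin of the constant 8.
  nlinarith [sq_nonneg (|η| * a - 2 * ‖p‖ * q), sq_nonneg (|η| * b - 2 * ‖p‖ * q)]

/-- Cauchy–Schwarz and Young with a free weight. The weight will be (1+M)/(λr²), the common size of
the other coefficients of S; this is what yields the factor (1+M)⁻² in front of N². -/
lemma third_term {ι : Type*} [Fintype ι] {κ : ℝ} (hκ : 0 < κ) (s t : ι → ℂ) :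
    -(κ * nsq s + κ⁻¹ * nsq t) ≤ (star s ⬝ᵥ t + star t ⬝ᵥ s).re := by
  have h1 : ‖star s ⬝ᵥ t + star t ⬝ᵥ s‖ ≤ 2 * (√(nsq s) * √(nsq t)) := by
    refine (norm_add_le _ _).trans ?_
    have := norm_star_dotProduct_le s t
    have := norm_star_dotProduct_le t s
    linarith
  have h2 := (abs_le.mp ((Complex.abs_re_le_norm _).trans h1)).1
  refine le_trans ?_ h2
  set p := √(nsq s)
  set q := √(nsq t)
  have hp : p ^ 2 = nsq s := Real.sq_sqrt (nsq_nonneg _)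
  have hq : q ^ 2 = nsq t := Real.sq_sqrt (nsq_nonneg _)
  rw [← hp, ← hq]
  have h3 : κ * p ^ 2 + κ⁻¹ * q ^ 2 - 2 * (p * q) = κ * (p - κ⁻¹ * q) ^ 2 := by
    field_simp; ring
  have h4 : 0 ≤ κ * (p - κ⁻¹ * q) ^ 2 := by positivity
  linarith

lemma slots_smul_one (μ : ℂ) :
    slotsHol (μ • (1 : Matrix (Fin n) (Fin n) ℂ)) + slotBar (μ • (1 : Matrix (Fin n) (Fin n) ℂ))
      = (3 * μ) • (1 : Matrix (Fin n × Fin n × Fin n) (Fin n × Fin n × Fin n) ℂ) := by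
  simp only [slotsHol, slotBar, Matrix.transpose_smul, Matrix.transpose_one,
    Matrix.smul_kronecker, Matrix.kronecker_smul, Matrix.one_kronecker_one, ← add_smul]
  congr 1; ring

lemma slots_posSemidef {A : Matrix (Fin n) (Fin n) ℂ} (hA : A.PosSemidef) :
    (slotsHol A + slotBar A).PosSemidef := by
  have h1 : (1 : Matrix (Fin n) (Fin n) ℂ).PosSemidef := Matrix.PosSemidef.one
  exact ((hA.kronecker (h1.kronecker h1)).add (h1.kronecker (h1.kronecker hA))).add
    (h1.kronecker (hA.transpose.kronecker h1))

/-- Acting on one slot preserves positivity, and the factor 3 counts the slots. -/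
lemma slots_term_le {A : Matrix (Fin n) (Fin n) ℂ} {μ : ℝ}
    (hA : ((μ : ℂ) • (1 : Matrix (Fin n) (Fin n) ℂ) - A).PosSemidef)
    (s : Fin n × Fin n × Fin n → ℂ) :
    (star s ⬝ᵥ ((slotsHol A + slotBar A) *ᵥ s)).re ≤ 3 * μ * nsq s := by
  have h := (Complex.le_def.mp ((slots_posSemidef hA).dotProduct_mulVec_nonneg s)).1
  have h2 : slotsHol ((μ : ℂ) • (1 : Matrix (Fin n) (Fin n) ℂ) - A)
        + slotBar ((μ : ℂ) • (1 : Matrix (Fin n) (Fin n) ℂ) - A)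
      = ((3 * μ : ℝ) : ℂ) • 1 - (slotsHol A + slotBar A) := by
    have h3 := slots_smul_one (n := n) μ
    have e1 : slotsHol ((μ : ℂ) • (1 : Matrix (Fin n) (Fin n) ℂ) - A)
      = slotsHol ((μ : ℂ) • (1 : Matrix (Fin n) (Fin n) ℂ)) - slotsHol A := map_sub slotsHolHom _ _
    have e2 : slotBar ((μ : ℂ) • (1 : Matrix (Fin n) (Fin n) ℂ) - A)
      = slotBar ((μ : ℂ) • (1 : Matrix (Fin n) (Fin n) ℂ)) - slotBar A := map_sub slotBarHom _ _
    rw [e1, e2]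
    push_cast
    rw [← h3]; abel
  rw [h2, Matrix.sub_mulVec, dotProduct_sub, Matrix.smul_mulVec, Matrix.one_mulVec,
    dotProduct_smul, star_dotProduct_self, smul_eq_mul, ← Complex.ofReal_mul, Complex.sub_re,
    Complex.ofReal_re, Complex.zero_re] at h
  linarith

/-- An upper bound in the original frame gives one in the normalized frame. -/
lemma frame_upper_bound {T g A : Matrix (Fin n) (Fin n) ℂ} {lam μ : ℝ} (hlam : 0 < lam)
    (hμ : 0 ≤ μ) (hg : T * g * Tᴴ = 1)
    (hlow : (g - (lam : ℂ) • (1 : Matrix (Fin n) (Fin n) ℂ)).PosSemidef)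
    (hA : ((μ : ℂ) • (1 : Matrix (Fin n) (Fin n) ℂ) - A).PosSemidef) :
    (((μ * lam⁻¹ : ℝ) : ℂ) • (1 : Matrix (Fin n) (Fin n) ℂ) - T * A * Tᴴ).PosSemidef := by
  have h1 := hA.mul_mul_conjTranspose_same T
  have h2 := (hlow.mul_mul_conjTranspose_same T).smul
    (Complex.zero_le_real.mpr (mul_nonneg hμ (inv_nonneg.mpr hlam.le)))
  have h3 := h1.add h2
  have hl : (lam : ℂ) ≠ 0 := by exact_mod_cast hlam.ne'
  have e : T * ((μ : ℂ) • (1 : Matrix (Fin n) (Fin n) ℂ) - A) * Tᴴ + ((μ * lam⁻¹ : ℝ) : ℂ) •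
      (T * (g - (lam : ℂ) • (1 : Matrix (Fin n) (Fin n) ℂ)) * Tᴴ)
      = ((μ * lam⁻¹ : ℝ) : ℂ) • (1 : Matrix (Fin n) (Fin n) ℂ) - T * A * Tᴴ := by
    rw [mul_sub, mul_sub, sub_mul, sub_mul, hg]
    simp only [Matrix.mul_smul, Matrix.smul_mul, mul_one, smul_sub, smul_smul]
    have : ((μ * lam⁻¹ : ℝ) : ℂ) * (lam : ℂ) = μ := by push_cast; field_simp
    rw [this]; abel
  rwa [e] at h3

lemma sum_norm_frame_sq_le {T : Matrix (Fin n) (Fin n) ℂ} {ν : ℝ} (hT : BoundedBy T ν) :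
    ∑ c, ‖frame T c‖ ^ 2 ≤ n * ν := by
  have h1 : ∀ i, ∑ c, ‖T c i‖ ^ 2 ≤ ν := by
    intro i
    have := hT (Pi.single i 1)
    have h2 : nsq (Pi.single i (1 : ℂ)) = 1 := by
      simp [nsq, Pi.single_apply, apply_ite (fun z : ℂ => ‖z‖ ^ 2)]
    rw [h2, mul_one] at this
    simpa [nsq] using this
  calc ∑ c, ‖frame T c‖ ^ 2 = ∑ c, ∑ i, ‖T c i‖ ^ 2 :=
        Finset.sum_congr rfl fun c _ => EuclideanSpace.norm_sq_eq _
    _ = ∑ i, ∑ c, ‖T c i‖ ^ 2 := Finset.sum_comm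
    _ ≤ ∑ _i : Fin n, ν := Finset.sum_le_sum fun i _ => h1 i
    _ = n * ν := by simp

lemma sum_norm_frame_inner_le {T : Matrix (Fin n) (Fin n) ℂ} {ν : ℝ} (hT : BoundedBy T ν)
    (w : Cn n) : ∑ c, ‖∑ i, frame T c i * conj (w i)‖ ^ 2 ≤ ν * ‖w‖ ^ 2 := by
  have h := hT fun i => conj (w i)
  rw [nsq_conj (fun i => w i), nsq_ofLp] at h
  exact h

/-- The scalar bookkeeping. In units of κq the errors cost 2n (Laplacian of the cutoff), 6 (its
gradient), 1 (third derivatives of φ) and 3 (Hessian of φ). The Laplacian term gains 13 + 2n, so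
more than one unit survives. -/
lemma max_estimate_real {n : ℕ} {r lam M N η q F G third slots N₃ D : ℝ} (hr : 0 < r)
    (hlam : 0 < lam) (hM : 0 ≤ M) (hη0 : 0 ≤ η) (hη1 : η ≤ 1) (hq0 : 0 ≤ q) (hF0 : 0 ≤ F)
    (hN0 : 0 ≤ N₃) (hF : F ≤ n * lam⁻¹) (hG : G ≤ lam⁻¹ * (r ^ 2)⁻¹)
    (hslots : slots ≤ 3 * (M * (r ^ 2)⁻¹ * lam⁻¹) * q)
    (hthird : -((1 + M) * (lam⁻¹ * (r ^ 2)⁻¹) * q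
      + ((1 + M) * (lam⁻¹ * (r ^ 2)⁻¹))⁻¹ * N₃) ≤ third)
    (hN : N₃ ≤ lam⁻¹ ^ 3 * (N ^ 2 * (r ^ 6)⁻¹))
    (hD : lam * q - n * (M * (r ^ 2)⁻¹) ≤ D)
    (hsum : -(2 * η * q * (r ^ 2)⁻¹) * F - 6 * q * G + η ^ 2 * (third - slots)
      + (13 + 2 * n) * ((1 + M) * (lam⁻¹ * (r ^ 2)⁻¹)) * lam⁻¹ * D ≤ 0) :
    q ≤ lam⁻¹ * (r ^ 2)⁻¹ * (((1 + M) ^ 2)⁻¹ * N ^ 2)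
      + (13 + 2 * n) * n * ((1 + M) * (lam⁻¹ * (r ^ 2)⁻¹)) := by
  have hk0 : 0 < lam⁻¹ * (r ^ 2)⁻¹ := by positivity
  have hN' : (((1 + M) * (lam⁻¹ * (r ^ 2)⁻¹))⁻¹ * ((1 + M) * (lam⁻¹ * (r ^ 2)⁻¹))⁻¹ *
      (lam⁻¹ ^ 3 * (N ^ 2 * (r ^ 6)⁻¹)))
      = lam⁻¹ * (r ^ 2)⁻¹ * (((1 + M) ^ 2)⁻¹ * N ^ 2) := by
    have : 1 + M ≠ 0 := by positivity
    field_simp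
  have hk0κ : lam⁻¹ * (r ^ 2)⁻¹ ≤ (1 + M) * (lam⁻¹ * (r ^ 2)⁻¹) := by nlinarith
  have hMκ : M * (r ^ 2)⁻¹ * lam⁻¹ ≤ (1 + M) * (lam⁻¹ * (r ^ 2)⁻¹) := by nlinarith
  have hκpos : 0 < (1 + M) * (lam⁻¹ * (r ^ 2)⁻¹) := by positivity
  rw [← hN']
  set κ := (1 + M) * (lam⁻¹ * (r ^ 2)⁻¹)
  clear_value κ
  have hη2 : η ^ 2 ≤ 1 := by nlinarith
  have b1 : 2 * η * q * (r ^ 2)⁻¹ * F ≤ 2 * n * κ * q := by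
    calc 2 * η * q * (r ^ 2)⁻¹ * F ≤ 2 * 1 * q * (r ^ 2)⁻¹ * (n * lam⁻¹) := by gcongr
      _ = 2 * n * (lam⁻¹ * (r ^ 2)⁻¹) * q := by ring
      _ ≤ 2 * n * κ * q := by gcongr
  have b2 : 6 * q * G ≤ 6 * κ * q := by
    calc 6 * q * G ≤ 6 * q * κ := by gcongr; exact hG.trans hk0κ
      _ = 6 * κ * q := by ring
  have b3 : -(κ * q + κ⁻¹ * N₃) ≤ η ^ 2 * third := by
    have h0 : 0 ≤ κ * q + κ⁻¹ * N₃ := by positivity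
    have := mul_le_mul_of_nonneg_left hthird (sq_nonneg η)
    nlinarith
  have b4 : η ^ 2 * slots ≤ 3 * κ * q := by
    calc η ^ 2 * slots ≤ η ^ 2 * (3 * κ * q) := by
          refine mul_le_mul_of_nonneg_left (hslots.trans ?_) (sq_nonneg η)
          gcongr
      _ ≤ 1 * (3 * κ * q) := by gcongr
      _ = 3 * κ * q := one_mul _
  have b5 : (13 + 2 * n) * κ * q - (13 + 2 * n) * n * κ * κ ≤ (13 + 2 * n) * κ * lam⁻¹ * D := by
    have hA0 : 0 ≤ (13 + 2 * n) * κ * lam⁻¹ := by positivity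
    refine le_trans ?_ (mul_le_mul_of_nonneg_left hD hA0)
    have h1 : (13 + 2 * n) * κ * lam⁻¹ * (lam * q - n * (M * (r ^ 2)⁻¹))
        = (13 + 2 * n) * κ * q - (13 + 2 * n) * n * κ * (M * (r ^ 2)⁻¹ * lam⁻¹) := by
      field_simp
    rw [h1]
    gcongr
  have hfin : κ * q ≤ κ⁻¹ * N₃ + (13 + 2 * n) * n * κ * κ := by
    have : 0 ≤ κ * q := by positivity
    linarith
  have hfin2 : κ * q ≤ κ * (κ⁻¹ * κ⁻¹ * (lam⁻¹ ^ 3 * (N ^ 2 * (r ^ 6)⁻¹))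
      + (13 + 2 * n) * n * κ) := by
    refine hfin.trans ?_
    have h1 : κ⁻¹ * N₃ ≤ κ⁻¹ * (lam⁻¹ ^ 3 * (N ^ 2 * (r ^ 6)⁻¹)) := by gcongr
    have h2 : κ * (κ⁻¹ * κ⁻¹ * (lam⁻¹ ^ 3 * (N ^ 2 * (r ^ 6)⁻¹)) + (13 + 2 * n) * n * κ)
        = κ⁻¹ * (lam⁻¹ ^ 3 * (N ^ 2 * (r ^ 6)⁻¹)) + (13 + 2 * n) * n * κ * κ := by
      field_simp
    rw [h2]
    linarith
  exact le_of_mul_le_mul_left hfin2 hκpos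

/-- The estimate for Calabi's quantity at an interior maximum of the test function. -/
theorem calabi_le_at_max {p : Cn n} {r ρ lam Lam M N : ℝ} (hr : 0 < r) (hlam : 0 < lam)
    (hM : 0 ≤ M) (hu : ContDiffAt ℝ 5 u x) (hφ : ContDiffAt ℝ 3 φ x)
    (hdet : ∀ᶠ y in 𝓝 x, (hessE (frame 1) u y).det = Complex.exp (φ y))
    (hg : MatrixBetween lam Lam (hessE (frame 1) u x))
    (hΦ : MatrixBetween (-(M * (r ^ 2)⁻¹)) (M * (r ^ 2)⁻¹) (hessE (frame 1) φ x))
    (hN : nsq (thirdE (frame 1) φ x) ≤ N ^ 2 * (r ^ 6)⁻¹) (hx : ‖x - p‖ ≤ r)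
    (hη0 : 0 ≤ cutoff p ρ r x) (hη1 : cutoff p ρ r x ≤ 1)
    (hmax : IsLocalMax (fun y => ((cutoff p ρ r y : ℂ) * cutoff p ρ r y * calabi (frame 1) u y
      + (((13 + 2 * n) * ((1 + M) * (lam⁻¹ * (r ^ 2)⁻¹)) * lam⁻¹ : ℝ) : ℂ)
        * (hessE (frame 1) u y).trace).re) x) :
    (calabi (frame 1) u x).re ≤ lam⁻¹ * (r ^ 2)⁻¹ * (((1 + M) ^ 2)⁻¹ * N ^ 2)
      + (13 + 2 * n) * n * ((1 + M) * (lam⁻¹ * (r ^ 2)⁻¹)) := by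
  obtain ⟨T, B, hBT, hTg, hT, -, hB⟩ := exists_normalizing_frame hlam hg
  have hTB : T * B = 1 := mul_eq_one_comm.mp hBT
  have hge : hessE (frame T) u x = 1 := by rw [hessE_frame T (hu.of_le (by norm_num)), hTg]
  have hdT : T.det ≠ 0 := by
    intro h0
    have := congrArg Matrix.det hTB
    rw [Matrix.det_mul, h0, zero_mul, Matrix.det_one] at this
    exact zero_ne_one this
  have hκ0 : T.det * Tᴴ.det ≠ 0 := by
    rw [Matrix.det_conjTranspose]; exact mul_ne_zero hdT (star_ne_zero.mpr hdT)
  have hdetT : ∀ᶠ y in 𝓝 x, (hessE (frame T) u y).det = (T.det * Tᴴ.det) * Complex.exp (φ y) := by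
    filter_upwards [hdet, hu.eventually (by simp)] with y h1 h2
    rw [hessE_frame T (h2.of_le (by norm_num)), Matrix.det_mul, Matrix.det_mul, h1]; ring
  obtain ⟨α, β, D, hD, hDsum⟩ := bochner_formula hu hφ hge hκ0 hdetT
  obtain ⟨b, b', Dt, hDt, hDtsum⟩ := trace_laplacian hBT hu hφ hge hκ0 hdetT hB hΦ
  set s := thirdE (frame T) u x with hs
  set κ := (1 + M) * (lam⁻¹ * (r ^ 2)⁻¹) with hκ
  set A := (13 + 2 * n) * κ * lam⁻¹ with hA
  set η := cutoff p ρ r x with hη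
  have hκpos : 0 < κ := by positivity
  have hcal : ∀ᶠ y in 𝓝 x, calabi (frame T) u y = calabi (frame 1) u y := by
    filter_upwards [hu.eventually (by simp)] with y h2
    exact calabi_frame hBT (h2.of_le (by norm_num))
  have hq : (calabi (frame 1) u x).re = nsq s := by
    rw [← hcal.self_of_nhds]
    -- The value is read off a jet in some frame direction, so an empty index set is treated apart.
    by_cases hn : Nonempty (Fin n)
    · obtain ⟨c⟩ := hn
      rw [(hD c).val, star_dotProduct_self, Complex.ofReal_re]
    · have : IsEmpty (Fin n) := not_nonempty_iff.mp hn
      simp [calabi, nsq]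
  rw [hq]
  set q := nsq s with hqdef
  have hq0 : 0 ≤ q := nsq_nonneg s
  -- P c is the derivative ∂_c η of the cutoff at x.
  let P : Fin n → ℂ := fun c => -(∑ i, frame T c i * conj ((x - p) i)) * ((r ^ 2)⁻¹ : ℝ)
  have hP : P = fun c => -(∑ i, frame T c i * conj ((x - p) i)) * ((r ^ 2)⁻¹ : ℝ) := rfl
  clear_value P
  have hmix : ∀ c, (((-‖frame T c‖ ^ 2 * (r ^ 2)⁻¹ : ℝ) : ℂ) * η * q
      + (2 * η * conj (P c)
          * (star (β c) ⬝ᵥ s + star s ⬝ᵥ α c)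
        + 2 * η * (P c)
          * (star (α c) ⬝ᵥ s + star s ⬝ᵥ β c))
      + (((-‖frame T c‖ ^ 2 * (r ^ 2)⁻¹ : ℝ) : ℂ) * η * q
      + 2 * ((‖P c‖ ^ 2 : ℝ) : ℂ) * q)
      + (η : ℂ) * η * D c + (A : ℂ) * Dt c).re ≤ 0 := by
    intro c
    have hj := ((((cutoff_jet p x (frame T c) ρ r).mul (cutoff_jet p x (frame T c) ρ r)).mul
      ((hD c).congr hcal)).add ((hDt c).const_mul (A : ℂ)))
    have hle := hj.re_mix_nonpos hmax
    refine le_of_eq_of_le (congrArg Complex.re ?_) hle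
    simp only [hP]
    rw [star_dotProduct_self, ← Complex.normSq_eq_norm_sq, ← Complex.mul_conj]
    ring
  -- The coefficient 6 is the loss 8 from `cutoff_cross_term` minus the gain 2 from the term |∂η|²
  -- in the mixed derivative of η². The squares of α and β will cancel against those in the Bochner
  -- formula after summation over c.
  have hmix' : ∀ c, -(2 * η * q * (r ^ 2)⁻¹) * ‖frame T c‖ ^ 2
      - η ^ 2 * (nsq (α c) + nsq (β c)) - 6 * q * ‖P c‖ ^ 2 + η ^ 2 * (D c).re
      + A * (Dt c).re ≤ 0 := by
    intro c
    have h1 := hmix c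
    have h2 := cutoff_cross_term η (P c) s (α c) (β c)
    have e1 : ((η : ℂ) * η * D c).re = η ^ 2 * (D c).re := by
      rw [← Complex.ofReal_mul, Complex.re_ofReal_mul]; ring
    have e2 : (((-‖frame T c‖ ^ 2 * (r ^ 2)⁻¹ : ℝ) : ℂ) * η * q).re
        = -‖frame T c‖ ^ 2 * (r ^ 2)⁻¹ * η * q := by
      rw [← Complex.ofReal_mul, ← Complex.ofReal_mul, Complex.ofReal_re]
    have e3 : (2 * ((‖P c‖ ^ 2 : ℝ) : ℂ) * q).re = 2 * ‖P c‖ ^ 2 * q := by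
      rw [← Complex.ofReal_ofNat, ← Complex.ofReal_mul, ← Complex.ofReal_mul, Complex.ofReal_re]
    simp only [Complex.add_re] at h1 h2
    rw [e1, e2, e3, Complex.re_ofReal_mul] at h1
    linarith
  have hsum := Finset.sum_nonpos fun c (_ : c ∈ Finset.univ) => hmix' c
  simp only [Finset.sum_add_distrib, Finset.sum_sub_distrib, ← Finset.mul_sum] at hsum
  rw [← Finset.sum_add_distrib] at hsum
  have hDre : ∑ c, (D c).re = ∑ c, (nsq (α c) + nsq (β c))
      + (star s ⬝ᵥ thirdE (frame T) φ x + star (thirdE (frame T) φ x) ⬝ᵥ s).re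
      - (star s ⬝ᵥ ((slotsHol (hessE (frame T) φ x) + slotBar (hessE (frame T) φ x)) *ᵥ s)).re := by
    rw [← Complex.re_sum, hDsum, Complex.sub_re, Complex.add_re, Complex.re_sum]
    simp only [star_dotProduct_self, ← Complex.ofReal_add, Complex.ofReal_re]
  rw [← Complex.re_sum Finset.univ Dt] at hsum
  have hfr := sum_norm_frame_sq_le hT
  have hP2 : ∑ c, ‖P c‖ ^ 2 ≤ lam⁻¹ * (r ^ 2)⁻¹ := by
    have h1 := sum_norm_frame_inner_le hT (x - p)
    have h2 : ∀ c, ‖P c‖ ^ 2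
        = ‖∑ i, frame T c i * conj ((x - p) i)‖ ^ 2 * ((r ^ 2)⁻¹ * (r ^ 2)⁻¹) := by
      intro c
      rw [hP]
      simp only [norm_mul, norm_neg, Complex.norm_real, Real.norm_eq_abs, mul_pow, sq_abs]
      ring
    simp only [h2, ← Finset.sum_mul]
    have h3 : ‖x - p‖ ^ 2 ≤ r ^ 2 := by gcongr
    calc _ ≤ (lam⁻¹ * ‖x - p‖ ^ 2) * ((r ^ 2)⁻¹ * (r ^ 2)⁻¹) := by gcongr
      _ ≤ (lam⁻¹ * r ^ 2) * ((r ^ 2)⁻¹ * (r ^ 2)⁻¹) := by gcongr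
      _ = _ := by field_simp
  have hslots : (star s ⬝ᵥ ((slotsHol (hessE (frame T) φ x) + slotBar (hessE (frame T) φ x))
      *ᵥ s)).re ≤ 3 * (M * (r ^ 2)⁻¹ * lam⁻¹) * q := by
    refine slots_term_le ?_ s
    rw [hessE_frame T (hφ.of_le (by norm_num))]
    exact frame_upper_bound hlam (by positivity) hTg hg.1 hΦ.2
  have hthird := third_term hκpos s (thirdE (frame T) φ x)
  have hN3 : nsq (thirdE (frame T) φ x) ≤ lam⁻¹ ^ 3 * (N ^ 2 * (r ^ 6)⁻¹) := by
    rw [thirdE_frame T hφ]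
    refine (hT.tensorFrame (inv_nonneg.mpr hlam.le) _).trans ?_
    gcongr
  rw [hDre] at hsum
  exact max_estimate_real hr hlam hM hη0 hη1 hq0 (Finset.sum_nonneg fun c _ => by positivity)
    (nsq_nonneg _) hfr hP2 hslots hthird hN3 hDtsum (by linarith)

end pointwise

end pointwiseInequality

/-! ### The interior estimate on a ball -/

section interiorEstimate

open Matrix
open scoped Kronecker

variable {n : ℕ}

section conversion

variable (u : Cn n → ℝ) (z : Cn n)

lemma mixed_eq_hessE (i j : Fin n) : mixed u i j = fun z => hessE (frame 1) u z i j := by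
  funext z
  simp only [mixed, hessE, dz_eq_wirt, dzbar_eq_wirtBar, frame_one, Matrix.of_apply]

lemma complexHessian_eq_hessE : complexHessian u z = hessE (frame 1) u z := by
  ext i j
  simp only [complexHessian, Matrix.of_apply, mixed_eq_hessE]

lemma mixed3_eq_thirdE (i j k : Fin n) : mixed3 u i j k z = thirdE (frame 1) u z (i, j, k) := by
  simp only [mixed3, mixed_eq_hessE, dz_eq_wirt, ← frame_one]
  rfl

lemma sum_mixed3_eq_nsq :
    ∑ i, ∑ j, ∑ k, ‖mixed3 u i j k z‖ ^ 2 = nsq (thirdE (frame 1) u z) := by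
  simp only [nsq, Fintype.sum_prod_type, mixed3_eq_thirdE]

end conversion

section interior

variable {u φ : Cn n → ℝ} {x : Cn n}

lemma contDiffAt_calabi {e : Fin n → Cn n} (hu : ContDiffAt ℝ 5 u x)
    (hdet : (hessE e u x).det ≠ 0) : ContDiffAt ℝ 2 (calabi e u) x := by
  have hs : ∀ α, ContDiffAt ℝ 2 (fun y => thirdE e u y α) x := fun α =>
    contDiffAt_wirt (k := 2) (contDiffAt_hessE hu _ _) _
  have hG : ∀ i j, ContDiffAt ℝ 2 (fun y => (hessE e u y)⁻¹ i j) x := fun i j =>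
    contDiffAt_inv_apply (fun i j => (contDiffAt_hessE hu i j).of_le (by norm_num)) hdet i j
  refine ContDiffAt.sum fun α _ => (contDiffAt_conj (hs α)).mul (ContDiffAt.sum fun β _ => ?_)
  exact ((hG _ _).mul ((hG _ _).mul (hG _ _))).mul (hs β)

lemma contDiffAt_trace {e : Fin n → Cn n} (hu : ContDiffAt ℝ 5 u x) :
    ContDiffAt ℝ 2 (fun y => (hessE e u y).trace) x :=
  ContDiffAt.sum fun i _ => (contDiffAt_hessE hu i i).of_le (by norm_num)

/-- In the normalising frame Calabi's quantity is a Euclidean squared norm; undoing the frame costs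
one factor Λ per slot. -/
lemma nsq_thirdE_le_calabi {lam Lam : ℝ} (hlam : 0 < lam) (hLam : 0 ≤ Lam)
    (hu : ContDiffAt ℝ 5 u x) (hg : MatrixBetween lam Lam (hessE (frame 1) u x)) :
    0 ≤ (calabi (frame 1) u x).re ∧
      nsq (thirdE (frame 1) u x) ≤ Lam ^ 3 * (calabi (frame 1) u x).re := by
  obtain ⟨T, B, hBT, hTg, -, hB, -⟩ := exists_normalizing_frame hlam hg
  have hu3 : ContDiffAt ℝ 3 u x := hu.of_le (by norm_num)
  have h1 : (calabi (frame 1) u x).re = nsq (thirdE (frame T) u x) := by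
    rw [← calabi_frame hBT hu3, calabi_eq, hessE_frame T (hu.of_le (by norm_num)), hTg]
    have : tensorMetric (1 : Matrix (Fin n) (Fin n) ℂ)⁻¹ = 1 := by simp [tensorMetric]
    rw [this, Matrix.one_mulVec, star_dotProduct_self, Complex.ofReal_re]
  have h2 : thirdE (frame 1) u x = tensorFrame B *ᵥ thirdE (frame T) u x := by
    rw [thirdE_frame T hu3, Matrix.mulVec_mulVec, tensorFrame_mul, hBT, tensorFrame_one,
      Matrix.one_mulVec]
  rw [h1]
  refine ⟨nsq_nonneg _, ?_⟩
  rw [h2]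
  exact hB.tensorFrame hLam _

lemma MatrixBetween.le (hn : 1 ≤ n) {a b : ℝ} {A : Matrix (Fin n) (Fin n) ℂ}
    (h : MatrixBetween a b A) : a ≤ b := by
  have h1 := h.bounds (Pi.single ⟨0, hn⟩ 1)
  have h2 : nsq (Pi.single (⟨0, hn⟩ : Fin n) (1 : ℂ)) = 1 := by
    simp [nsq, Pi.single_apply, apply_ite (fun z : ℂ => ‖z‖ ^ 2)]
  rw [h2] at h1
  linarith [h1.1, h1.2]

lemma MatrixBetween.trace_re {a b : ℝ} {A : Matrix (Fin n) (Fin n) ℂ} (h : MatrixBetween a b A) :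
    n * a ≤ A.trace.re ∧ A.trace.re ≤ n * b := by
  have h1 := (Complex.le_def.mp h.1.trace_nonneg).1
  have h2 := (Complex.le_def.mp h.2.trace_nonneg).1
  have h3 : ∀ μ : ℝ, ((μ : ℂ) * (n : ℂ)).re = n * μ := fun μ => by
    rw [← Complex.ofReal_natCast, ← Complex.ofReal_mul, Complex.ofReal_re]; ring
  simp only [Matrix.trace_sub, Matrix.trace_smul, Matrix.trace_one, Fintype.card_fin,
    Complex.sub_re, Complex.zero_re, smul_eq_mul, h3] at h1 h2
  exact ⟨by linarith, by linarith⟩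

/-- The interior third order estimate on a ball with arbitrary centre. -/
theorem interior_estimate (hn : 1 ≤ n) {p : Cn n} {r lam Lam M N : ℝ} (hr : 0 < r)
    (hlam : 0 < lam) (hu : ContDiffOn ℝ 5 u (Metric.ball p r))
    (hφ : ContDiffOn ℝ 3 φ (Metric.ball p r))
    (hdet : ∀ z ∈ Metric.ball p r, (complexHessian u z).det = ((Real.exp (φ z) : ℝ) : ℂ))
    (hg : ∀ z ∈ Metric.ball p r, MatrixBetween lam Lam (complexHessian u z))
    (hΦ : ∀ z ∈ Metric.ball p r,
      MatrixBetween (-(M * (r ^ 2)⁻¹)) (M * (r ^ 2)⁻¹) (complexHessian φ z))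
    (hN : ∀ z ∈ Metric.ball p r,
      √(∑ i, ∑ j, ∑ k, ‖mixed3 φ i j k z‖ ^ 2) ≤ N * (r ^ 3)⁻¹)
    {z : Cn n} (hz : z ∈ Metric.ball p (r / 2)) :
    ∑ i, ∑ j, ∑ k, ‖mixed3 u i j k z‖ ^ 2 ≤
      (256 / 25 * (1 + 2 * ((13 + 2 * n) * n))) * lam⁻¹ * Lam ^ 3 *
        (((1 + M) ^ 2)⁻¹ * N ^ 2 + lam⁻¹ * Lam * (1 + M)) * (r ^ 2)⁻¹ := by
  simp only [complexHessian_eq_hessE, sum_mixed3_eq_nsq] at *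
  have hzr : z ∈ Metric.ball p r := Metric.ball_subset_ball (by linarith) hz
  have hlL : lam ≤ Lam := (hg z hzr).le hn
  have hLam : 0 < Lam := hlam.trans_le hlL
  have hM : 0 ≤ M := by
    have := (hΦ z hzr).le hn
    have h2 : 0 ≤ M * (r ^ 2)⁻¹ := by linarith
    exact nonneg_of_mul_nonneg_left h2 (by positivity)
  have hu' : ∀ y ∈ Metric.ball p r, ContDiffAt ℝ 5 u y := fun y hy =>
    hu.contDiffAt (Metric.isOpen_ball.mem_nhds hy)
  have hφ' : ∀ y ∈ Metric.ball p r, ContDiffAt ℝ 3 φ y := fun y hy =>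
    hφ.contDiffAt (Metric.isOpen_ball.mem_nhds hy)
  have hdet' : ∀ y ∈ Metric.ball p r, (hessE (frame 1) u y).det = Complex.exp (φ y) :=
    fun y hy => by rw [hdet y hy, Complex.ofReal_exp]
  -- Any radius strictly between r/2 and r would do: the closed ball is compact inside the domain of
  -- the hypotheses, and the cutoff vanishes on its boundary.
  set ρ := 3 * r / 4 with hρ
  have hρr : Metric.closedBall p ρ ⊆ Metric.ball p r :=
    Metric.closedBall_subset_ball (by rw [hρ]; linarith)
  set k : ℝ := 13 + 2 * n with hk
  set κ := (1 + M) * (lam⁻¹ * (r ^ 2)⁻¹) with hκ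
  set F : Cn n → ℝ := fun y => ((cutoff p ρ r y : ℂ) * cutoff p ρ r y * calabi (frame 1) u y
      + ((k * κ * lam⁻¹ : ℝ) : ℂ) * (hessE (frame 1) u y).trace).re with hF
  have hFval : ∀ y, F y = cutoff p ρ r y ^ 2 * (calabi (frame 1) u y).re
      + k * κ * lam⁻¹ * (hessE (frame 1) u y).trace.re := by
    intro y
    simp only [hF, ← Complex.ofReal_mul, Complex.add_re, Complex.re_ofReal_mul]
    ring
  have hcont : ContinuousOn F (Metric.closedBall p ρ) := by
    intro y hy
    have hy' := hρr hy
    have hc := contDiffAt_calabi (e := frame 1) (hu' y hy')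
      (by rw [hdet' y hy']; exact Complex.exp_ne_zero _)
    have ht := contDiffAt_trace (e := frame 1) (hu' y hy')
    have hη := (cutoff_jet p y 0 ρ r).contDiffAt
    exact (Complex.continuous_re.continuousAt.comp (((hη.mul hη).mul hc).add
      (contDiffAt_const.mul ht)).continuousAt).continuousWithinAt
  have hz' : z ∈ Metric.closedBall p ρ :=
    Metric.ball_subset_closedBall (Metric.ball_subset_ball (by rw [hρ]; linarith) hz)
  obtain ⟨x, hx, hmax⟩ := (isCompact_closedBall p ρ).exists_isMaxOn ⟨z, hz'⟩ hcont
  have hxr := hρr hx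
  have hk0 : 0 < lam⁻¹ * (r ^ 2)⁻¹ := by positivity
  have hkpos : 0 < k := by positivity
  have hκpos : 0 < κ := by positivity
  set Q := lam⁻¹ * (r ^ 2)⁻¹ * (((1 + M) ^ 2)⁻¹ * N ^ 2) + k * n * κ with hQ
  have hQ0 : 0 ≤ Q := by positivity
  have hη1 : cutoff p ρ r x ≤ 1 := by
    rw [cutoff, mul_inv_le_iff₀ (by positivity), hρ]
    nlinarith [sq_nonneg ‖x - p‖]
  have hxnorm : ‖x - p‖ ≤ ρ := by rw [← dist_eq_norm]; exact hx
  have hη0 : 0 ≤ cutoff p ρ r x := by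
    rw [cutoff]
    have : ‖x - p‖ ^ 2 ≤ ρ ^ 2 := by gcongr
    exact mul_nonneg (by linarith) (by positivity)
  have hcx := (nsq_thirdE_le_calabi hlam hLam.le (hu' x hxr) (hg x hxr)).1
  -- At a maximum on the sphere the cutoff is zero and the claim is trivial, so only interior maxima
  -- need the differential inequality.
  have hxQ : cutoff p ρ r x ^ 2 * (calabi (frame 1) u x).re ≤ Q := by
    rcases (Metric.mem_closedBall.mp hx).lt_or_eq with h | h
    · have hloc : IsLocalMax F x :=
        hmax.isLocalMax (mem_of_superset (Metric.isOpen_ball.mem_nhds h)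
          Metric.ball_subset_closedBall)
      have hN' : nsq (thirdE (frame 1) φ x) ≤ N ^ 2 * (r ^ 6)⁻¹ := by
        have h1 := hN x hxr
        have h2 := pow_le_pow_left₀ (Real.sqrt_nonneg _) h1 2
        rw [Real.sq_sqrt (nsq_nonneg _)] at h2
        refine h2.trans_eq ?_
        field_simp
      have hle := calabi_le_at_max hr hlam hM (hu' x hxr) (hφ' x hxr)
        (mem_of_superset (Metric.isOpen_ball.mem_nhds hxr) hdet') (hg x hxr) (hΦ x hxr) hN'
        (hxnorm.trans (by rw [hρ]; linarith)) hη0 hη1 hloc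
      calc _ ≤ 1 * (calabi (frame 1) u x).re := by
            gcongr; exact pow_le_one₀ hη0 hη1
        _ ≤ Q := by rw [one_mul]; exact hle
    · have : cutoff p ρ r x = 0 := by
        rw [cutoff, ← dist_eq_norm, h, sub_self, zero_mul]
      rw [this]
      simpa using hQ0
  have hcz := nsq_thirdE_le_calabi hlam hLam.le (hu' z hzr) (hg z hzr)
  have hFz : F z ≤ F x := hmax hz'
  rw [hFval, hFval] at hFz
  have htz : 0 ≤ (hessE (frame 1) u z).trace.re :=
    le_trans (by positivity) (hg z hzr).trace_re.1
  have htx := (hg x hxr).trace_re.2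
  -- On the half ball the cutoff is at least 9/16 - 1/4; the inverse square of this bound is the
  -- factor 256/25.
  have hηz : 5 / 16 ≤ cutoff p ρ r z := by
    have hzn : ‖z - p‖ ≤ r / 2 := by rw [← dist_eq_norm]; exact (Metric.mem_ball.mp hz).le
    have : ‖z - p‖ ^ 2 ≤ (r / 2) ^ 2 := by gcongr
    rw [cutoff, ← div_eq_mul_inv, le_div_iff₀ (by positivity), hρ]
    nlinarith
  have h1 : (5 / 16) ^ 2 * (calabi (frame 1) u z).re
      ≤ cutoff p ρ r z ^ 2 * (calabi (frame 1) u z).re := by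
    gcongr
    exact hcz.1
  have h2 : k * κ * lam⁻¹ * (hessE (frame 1) u x).trace.re ≤ k * κ * lam⁻¹ * (n * Lam) := by
    gcongr
  have h3 : 0 ≤ k * κ * lam⁻¹ * (hessE (frame 1) u z).trace.re := by positivity
  have h4 : (calabi (frame 1) u z).re ≤ 256 / 25 * (Q + k * κ * lam⁻¹ * (n * Lam)) := by
    linarith
  refine hcz.2.trans ?_
  have hratio : 1 ≤ lam⁻¹ * Lam := by
    rw [inv_mul_eq_div, one_le_div hlam]; exact hlL
  have h5 : Q + k * κ * lam⁻¹ * (n * Lam) ≤ (1 + 2 * (k * n)) * (lam⁻¹ * (r ^ 2)⁻¹ *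
      (((1 + M) ^ 2)⁻¹ * N ^ 2 + lam⁻¹ * Lam * (1 + M))) := by
    have e1 : Q + k * κ * lam⁻¹ * (n * Lam) = lam⁻¹ * (r ^ 2)⁻¹ *
        (((1 + M) ^ 2)⁻¹ * N ^ 2 + k * n * (1 + M) + k * n * (lam⁻¹ * Lam * (1 + M))) := by
      rw [hQ, hκ]; ring
    rw [e1, mul_left_comm (1 + 2 * (k * n))]
    refine mul_le_mul_of_nonneg_left ?_ hk0.le
    have a1 : 0 ≤ ((1 + M) ^ 2)⁻¹ * N ^ 2 := by positivity
    have a2 : 1 + M ≤ lam⁻¹ * Lam * (1 + M) := le_mul_of_one_le_left (by positivity) hratio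
    have a3 : 0 ≤ lam⁻¹ * Lam * (1 + M) := by positivity
    have a4 : 0 ≤ k * n := by positivity
    have a5 := mul_le_mul_of_nonneg_left a2 a4
    have a6 := mul_nonneg a4 a1
    linarith
  calc Lam ^ 3 * (calabi (frame 1) u z).re
      ≤ Lam ^ 3 * (256 / 25 * ((1 + 2 * (k * n)) * (lam⁻¹ * (r ^ 2)⁻¹ *
      (((1 + M) ^ 2)⁻¹ * N ^ 2 + lam⁻¹ * Lam * (1 + M))))) := by
        gcongr
        exact h4.trans (by gcongr)
    _ = _ := by ring

end interior

end interiorEstimate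

/-! ### Plurisubharmonicity and eigenvalue bounds -/

section leviForm

open Matrix
open scoped Kronecker

variable {n : ℕ}

section plurisubharmonic

variable {u : Cn n → ℝ}

lemma le_of_second_deriv_le {F F' F'' : ℝ → ℝ} {c : ℝ}
    (h1 : ∀ s ∈ Set.Icc (0 : ℝ) 1, HasDerivAt F (F' s) s)
    (h2 : ∀ s ∈ Set.Icc (0 : ℝ) 1, HasDerivAt F' (F'' s) s) (h0 : F' 0 = 0)
    (hc : ∀ s ∈ Set.Icc (0 : ℝ) 1, F'' s ≤ c) : F 1 ≤ F 0 + c / 2 := by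
  have hG' : ∀ s ∈ Set.Icc (0 : ℝ) 1, HasDerivAt (fun s => F' s - c * s) (F'' s - c) s :=
    fun s hs =>
      ((h2 s hs).sub ((hasDerivAt_id s).const_mul c)).congr_deriv (by simp)
  have hG : ∀ s ∈ Set.Icc (0 : ℝ) 1,
      HasDerivAt (fun s => F s - c / 2 * s ^ 2) (F' s - c * s) s := fun s hs => by
    exact ((h1 s hs).sub ((hasDerivAt_pow 2 s).const_mul (c / 2))).congr_deriv (by
      push_cast; ring)
  have a1 : AntitoneOn (fun s => F' s - c * s) (Set.Icc 0 1) :=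
    antitoneOn_of_deriv_nonpos (convex_Icc 0 1)
      (fun s hs => (hG' s hs).continuousAt.continuousWithinAt)
      (fun s hs => (hG' s (interior_subset hs)).differentiableAt.differentiableWithinAt)
      (fun s hs => by
        rw [(hG' s (interior_subset hs)).deriv]
        linarith [hc s (interior_subset hs)])
  have a2 : AntitoneOn (fun s => F s - c / 2 * s ^ 2) (Set.Icc 0 1) :=
    antitoneOn_of_deriv_nonpos (convex_Icc 0 1)
      (fun s hs => (hG s hs).continuousAt.continuousWithinAt)
      (fun s hs => (hG s (interior_subset hs)).differentiableAt.differentiableWithinAt)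
      (fun s hs => by
        have hs' := interior_subset hs
        rw [(hG s hs').deriv]
        have := a1 (Set.left_mem_Icc.mpr zero_le_one) hs' hs'.1
        simp only [h0] at this
        linarith)
  have := a2 (Set.left_mem_Icc.mpr zero_le_one) (Set.right_mem_Icc.mpr zero_le_one) zero_le_one
  simp only at this
  linarith

/-- The Levi form is invariant under rotations of the direction. -/
lemma bilinear_rotate (B : Cn n →L[ℝ] Cn n →L[ℝ] ℝ) (ζ : ℂ) (w : Cn n) :
    B (ζ • w) (ζ • w) + B (Complex.I • ζ • w) (Complex.I • ζ • w)
      = ‖ζ‖ ^ 2 * (B w w + B (Complex.I • w) (Complex.I • w)) := by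
  have h1 : ζ • w = ζ.re • w + ζ.im • (Complex.I • w) := by
    rw [← Complex.coe_smul, ← Complex.coe_smul, smul_smul, ← add_smul, Complex.re_add_im]
  have h2 : Complex.I • ζ • w = ζ.re • (Complex.I • w) - ζ.im • w := by
    rw [h1, smul_add, smul_comm Complex.I ζ.re, smul_comm Complex.I ζ.im, smul_smul,
      Complex.I_mul_I]
    simp [sub_eq_add_neg]
  rw [h2, h1, ← Complex.normSq_eq_norm_sq, Complex.normSq_apply]
  simp only [map_add, map_sub, map_smul, ContinuousLinearMap.add_apply,
    ContinuousLinearMap.sub_apply, ContinuousLinearMap.smul_apply, smul_eq_mul]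
  ring

/-- The even function s ↦ u(z+sv) + u(z-sv) has zero derivative at 0, so only its second derivative
matters, and that stays within the oscillation ε of the Hessian. -/
lemma symmetric_taylor_le {z v : Cn n} {ε δ : ℝ}
    (hu : ∀ y ∈ Metric.ball z δ, ContDiffAt ℝ 2 u y)
    (hε : ∀ y ∈ Metric.ball z δ,
      ‖fderiv ℝ (fderiv ℝ u) y - fderiv ℝ (fderiv ℝ u) z‖ ≤ ε) (hv : ‖v‖ < δ) :
    u (z + v) + u (z - v) ≤ 2 * u z + fderiv ℝ (fderiv ℝ u) z v v + ε * ‖v‖ ^ 2 := by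
  have hmem : ∀ s ∈ Set.Icc (0 : ℝ) 1, z + s • v ∈ Metric.ball z δ ∧
      z + s • (-v) ∈ Metric.ball z δ := fun s hs => by
    have : ‖s • v‖ < δ := by
      rw [norm_smul, Real.norm_of_nonneg hs.1]
      exact (mul_le_of_le_one_left (norm_nonneg _) hs.2).trans_lt hv
    simp [this]
  have hsec : ∀ y ∈ Metric.ball z δ, fderiv ℝ (fderiv ℝ u) y v v
      ≤ fderiv ℝ (fderiv ℝ u) z v v + ε * ‖v‖ ^ 2 := fun y hy => by
    have h := (fderiv ℝ (fderiv ℝ u) y - fderiv ℝ (fderiv ℝ u) z).le_opNorm₂ v v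
    have h3 := (le_abs_self _).trans h
    simp only [ContinuousLinearMap.sub_apply] at h3
    have h4 := mul_le_mul_of_nonneg_right (hε y hy) (sq_nonneg ‖v‖)
    nlinarith
  have key := le_of_second_deriv_le (F := fun s : ℝ => u (z + s • v) + u (z + s • (-v)))
    (F' := fun s => fderiv ℝ u (z + s • v) v + fderiv ℝ u (z + s • (-v)) (-v))
    (F'' := fun s => fderiv ℝ (fderiv ℝ u) (z + s • v) v v
      + fderiv ℝ (fderiv ℝ u) (z + s • (-v)) (-v) (-v))
    (c := 2 * (fderiv ℝ (fderiv ℝ u) z v v + ε * ‖v‖ ^ 2))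
    (fun s hs => (deriv_line ((hu _ (hmem s hs).1).differentiableAt (by norm_num))).add
      (deriv_line ((hu _ (hmem s hs).2).differentiableAt (by norm_num))))
    (fun s hs => (deriv_deriv_line (hu _ (hmem s hs).1)).add
      (deriv_deriv_line (hu _ (hmem s hs).2)))
    (by simp)
    (fun s hs => by
      have h1 := hsec _ (hmem s hs).1
      have h2 := hsec _ (hmem s hs).2
      simp only [map_neg, ContinuousLinearMap.neg_apply, neg_neg] at h1 h2 ⊢
      linarith)
  simp only [one_smul, zero_smul, add_zero, ← sub_eq_add_neg] at key
  linarith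

/-- The Levi form of a plurisubharmonic function is nonnegative. -/
theorem PlurisubharmonicOn.levi_nonneg {Ω : Set (Cn n)} (hpsh : PlurisubharmonicOn u Ω)
    (hΩ : IsOpen Ω) (hu : ContDiffOn ℝ 2 u Ω) {z : Cn n} (hz : z ∈ Ω) (w : Cn n) :
    0 ≤ fderiv ℝ (fderiv ℝ u) z w w
      + fderiv ℝ (fderiv ℝ u) z (Complex.I • w) (Complex.I • w) := by
  by_contra! hq
  set q := fderiv ℝ (fderiv ℝ u) z w w
      + fderiv ℝ (fderiv ℝ u) z (Complex.I • w) (Complex.I • w) with hq_def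
  have hw : 0 < ‖w‖ := by
    rw [norm_pos_iff]
    rintro rfl
    simp [hq_def] at hq
  have hu' : ∀ y ∈ Ω, ContDiffAt ℝ 2 u y := fun y hy => hu.contDiffAt (hΩ.mem_nhds hy)
  have hcont : ContinuousAt (fderiv ℝ (fderiv ℝ u)) z :=
    ((((hu' z hz).fderiv_right (m := 1) (by norm_num)).fderiv_right (m := 0)
      (by norm_num))).continuousAt
  -- Chosen so that the Taylor error 2ε‖w‖² uses up only half of the negative quantity q.
  set ε := -q / (4 * ‖w‖ ^ 2) with hε
  have hε0 : 0 < ε := by have : 0 < -q := by linarith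
                         positivity
  have hev : ∀ᶠ y in 𝓝 z, ‖fderiv ℝ (fderiv ℝ u) y - fderiv ℝ (fderiv ℝ u) z‖ < ε := by
    have h : ContinuousAt (fun y => ‖fderiv ℝ (fderiv ℝ u) y - fderiv ℝ (fderiv ℝ u) z‖) z :=
      ContinuousAt.norm (E := Cn n →L[ℝ] Cn n →L[ℝ] ℝ) (hcont.sub continuousAt_const)
    refine h.eventually_lt continuousAt_const ?_
    rw [sub_self]
    exact (norm_zero (E := Cn n →L[ℝ] Cn n →L[ℝ] ℝ)).trans_lt hε0
  obtain ⟨δ, hδ, hball⟩ := Metric.eventually_nhds_iff_ball.mp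
    ((show ∀ᶠ y in 𝓝 z, y ∈ Ω from hΩ.mem_nhds hz).and
      hev)
  set t := δ / (2 * ‖w‖) with ht
  have ht0 : 0 < t := by positivity
  have htw : t * ‖w‖ < δ := by rw [ht]; field_simp; linarith
  -- The mean value inequality is applied to the disc in the directions tw, -tw, itw and -itw. The
  -- sum of the four integrands is bounded pointwise through the rotation invariant Levi form, so no
  -- second order term has to be integrated.
  have hrot : ∀ c : ℂ, ‖c‖ = t → CircleIntegrable (fun ζ : ℂ => u (z + ζ • (c • w))) 0 1 ∧
      u z ≤ Real.circleAverage (fun ζ : ℂ => u (z + ζ • (c • w))) 0 1 := fun c hc =>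
    hpsh.2 z (c • w) fun ζ hζ => (hball _ (by
      rw [mem_ball_iff_norm, add_sub_cancel_left, norm_smul, norm_smul c, hc]
      exact (mul_le_of_le_one_left (by positivity) hζ).trans_lt htw)).1
  have ht' : ‖(t : ℂ)‖ = t := by simp [abs_of_pos ht0]
  obtain ⟨i1, a1⟩ := hrot t ht'
  obtain ⟨i2, a2⟩ := hrot (-t) (by simpa using ht')
  obtain ⟨i3, a3⟩ := hrot (Complex.I * t) (by simpa using ht')
  obtain ⟨i4, a4⟩ := hrot (-(Complex.I * t)) (by simpa using ht')
  have hle := Real.circleAverage_mono_on_of_le_circle (((i1.add i2).add i3).add i4)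
    (a := 4 * u z + t ^ 2 * (q + 2 * ε * ‖w‖ ^ 2)) (fun ζ hζ => by
      have hζ1 : ‖ζ‖ = 1 := by simpa using hζ
      have hn1 : ‖ζ • ((t : ℂ) • w)‖ = t * ‖w‖ := by
        rw [norm_smul, norm_smul, ht', hζ1, one_mul]
      have hn2 : ‖Complex.I • ζ • ((t : ℂ) • w)‖ = t * ‖w‖ := by
        rw [norm_smul, Complex.norm_I, one_mul, hn1]
      have hb : ∀ y ∈ Metric.ball z δ,
        ‖fderiv ℝ (fderiv ℝ u) y - fderiv ℝ (fderiv ℝ u) z‖ ≤ ε := fun y hy => (hball y hy).2.le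
      have t1 := symmetric_taylor_le (fun y hy => hu' y (hball y hy).1) hb (hn1.trans_lt htw)
      have t2 := symmetric_taylor_le (fun y hy => hu' y (hball y hy).1) hb (hn2.trans_lt htw)
      have hr := bilinear_rotate (fderiv ℝ (fderiv ℝ u) z) (ζ * t) w
      rw [mul_smul, ← hq_def, norm_mul, hζ1, ht', one_mul] at hr
      rw [hn1] at t1
      rw [hn2] at t2
      have e2 : ζ • (-(t : ℂ)) • w = -(ζ • (t : ℂ) • w) := by simp
      have e3 : ζ • (Complex.I * t) • w = Complex.I • ζ • (t : ℂ) • w := by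
        simp only [smul_smul]; congr 1; ring
      have e4 : ζ • (-(Complex.I * t)) • w = -(Complex.I • ζ • (t : ℂ) • w) := by
        rw [← e3]; simp
      simp only [Pi.add_apply, e2, e3, e4, ← sub_eq_add_neg]
      nlinarith)
  rw [Real.circleAverage_add ((i1.add i2).add i3) i4, Real.circleAverage_add (i1.add i2) i3,
    Real.circleAverage_add i1 i2] at hle
  have hneg : q + 2 * ε * ‖w‖ ^ 2 < 0 := by
    have : ε * ‖w‖ ^ 2 = -q / 4 := by rw [hε]; field_simp
    linarith
  have := mul_neg_of_pos_of_neg (pow_pos ht0 2) hneg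
  linarith

end plurisubharmonic

section hessian

variable {u : Cn n → ℝ} {x : Cn n}

/-- The direction is the conjugate of y, because the Hessian is conjugate linear in its second
index. The index a merely selects a row of a frame with all rows equal, so that the change of frame
formula applies. -/
lemma star_dotProduct_hessE (a : Fin n) (hu : ContDiffAt ℝ 2 u x) (y : Fin n → ℂ) :
    ∃ v : Cn n, ‖v‖ ^ 2 = nsq y ∧ star y ⬝ᵥ (hessE (frame 1) u x *ᵥ y)
      = ((1 / 4 * (fderiv ℝ (fderiv ℝ u) x v v
        + fderiv ℝ (fderiv ℝ u) x (Complex.I • v) (Complex.I • v)) : ℝ) : ℂ) := by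
  refine ⟨frame (Matrix.of fun _ i => conj (y i)) a, ?_, ?_⟩
  · rw [← nsq_ofLp, ← nsq_conj y]; rfl
  · have hU := contDiffAt_ofReal hu
    have h := wirtBar_wirt_frame (Matrix.of fun _ i => conj (y i)) hU a a
    rw [← wirt_wirtBar_comm hU, wirt_wirtBar_self hU, fderiv_fderiv_ofReal hu,
      fderiv_fderiv_ofReal hu] at h
    push_cast
    rw [h]
    simp only [dotProduct, Matrix.mulVec, Finset.mul_sum, Pi.star_apply, hessE, Matrix.of_apply,
      Complex.star_def, Complex.conj_conj]
    exact Finset.sum_congr rfl fun i _ => Finset.sum_congr rfl fun j _ => by ring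

lemma MatrixBetween.of_bounds {A : Matrix (Fin n) (Fin n) ℂ} {a b : ℝ} (hA : A.IsHermitian)
    (h : ∀ y : Fin n → ℂ, ∃ r : ℝ, star y ⬝ᵥ (A *ᵥ y) = r ∧ a * nsq y ≤ r ∧ r ≤ b * nsq y) :
    MatrixBetween a b A := by
  have hone : ∀ c : ℝ, ((c : ℂ) • (1 : Matrix (Fin n) (Fin n) ℂ)).IsHermitian := fun c => by
    simp [Matrix.IsHermitian, Matrix.conjTranspose_smul]
  refine ⟨.of_dotProduct_mulVec_nonneg (hA.sub (hone a)) fun y => ?_,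
    .of_dotProduct_mulVec_nonneg ((hone b).sub hA) fun y => ?_⟩
  all_goals
    obtain ⟨r, hr, h1, h2⟩ := h y
    simp only [Matrix.sub_mulVec, dotProduct_sub, Matrix.smul_mulVec, Matrix.one_mulVec,
      dotProduct_smul, star_dotProduct_self, hr, smul_eq_mul, ← Complex.ofReal_mul,
      ← Complex.ofReal_sub]
    exact_mod_cast sub_nonneg.mpr (by assumption)

/-- A quarter of two real second derivatives is at most b/2 in size, so there is room to spare. -/
lemma hessE_matrixBetween (a : Fin n) {b : ℝ} (hu : ContDiffAt ℝ 2 u x)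
    (hb : ‖iteratedFDeriv ℝ 2 u x‖ ≤ b) : MatrixBetween (-b) b (hessE (frame 1) u x) := by
  refine .of_bounds (hessE_isHermitian hu) fun y => ?_
  obtain ⟨v, hv, h⟩ := star_dotProduct_hessE a hu y
  have hb' : ‖fderiv ℝ (fderiv ℝ u) x‖ ≤ b := by
    rwa [← norm_iteratedFDeriv_one, norm_iteratedFDeriv_fderiv]
  have h1 : ∀ w : Cn n, ‖w‖ = ‖v‖ → |fderiv ℝ (fderiv ℝ u) x w w| ≤ b * nsq y := fun w hw => by
    have := (fderiv ℝ (fderiv ℝ u) x).le_opNorm₂ w w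
    rw [Real.norm_eq_abs, hw, mul_assoc, ← sq, hv] at this
    exact this.trans (mul_le_mul_of_nonneg_right hb' (nsq_nonneg y))
  have h2 := abs_le.mp (h1 v rfl)
  have h3 := abs_le.mp (h1 (Complex.I • v) (by simp [norm_smul]))
  have h4 : 0 ≤ b * nsq y := mul_nonneg ((norm_nonneg _).trans hb) (nsq_nonneg y)
  refine ⟨_, h, ?_, ?_⟩ <;> linarith [h2.1, h2.2, h3.1, h3.2]

lemma PlurisubharmonicOn.hessE_posSemidef {Ω : Set (Cn n)} (a : Fin n)
    (hpsh : PlurisubharmonicOn u Ω) (hΩ : IsOpen Ω) (hu : ContDiffOn ℝ 2 u Ω) (hx : x ∈ Ω) :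
    (hessE (frame 1) u x).PosSemidef := by
  have hux := hu.contDiffAt (hΩ.mem_nhds hx)
  refine .of_dotProduct_mulVec_nonneg (hessE_isHermitian hux) fun y => ?_
  obtain ⟨v, -, h⟩ := star_dotProduct_hessE a hux y
  rw [h]
  have := hpsh.levi_nonneg hΩ hu hx v
  exact_mod_cast mul_nonneg (by norm_num) this

/-- Eigenvalue bounds from the trace and the determinant. -/
lemma matrixBetween_of_trace_det (hn : 1 ≤ n) {A : Matrix (Fin n) (Fin n) ℂ} (hA : A.PosSemidef)
    {K m f : ℝ} (hm : 0 < m) (hmf : m ≤ f) (hdet : A.det = (f : ℂ)) (htr : A.trace.re ≤ K) :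
    0 < K ∧ MatrixBetween (m / K ^ (n - 1)) K A := by
  set μ := hA.isHermitian.eigenvalues with hμ
  have h0 : ∀ i, 0 ≤ μ i := hA.eigenvalues_nonneg
  have hsum : ∑ i, μ i ≤ K := by
    have := hA.isHermitian.trace_eq_sum_eigenvalues
    rw [this] at htr
    simpa using htr
  have hprod : ∏ i, μ i = f := by
    have := hA.isHermitian.det_eq_prod_eigenvalues
    rw [hdet] at this
    refine Complex.ofReal_injective ?_
    rw [this]
    simp [hμ]
  have hle : ∀ i, μ i ≤ K := fun i =>
    (Finset.single_le_sum (fun j _ => h0 j) (Finset.mem_univ i)).trans hsum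
  have hpos : ∀ i, 0 < μ i := fun i => (h0 i).lt_of_ne' fun h => by
    have := Finset.prod_eq_zero (Finset.mem_univ i) h
    linarith
  have hK : 0 < K := (hpos ⟨0, hn⟩).trans_le (hle _)
  -- The other n - 1 eigenvalues are at most K, while the product of all of them is at least m.
  have hlow : ∀ i, m / K ^ (n - 1) ≤ μ i := fun i => by
    rw [div_le_iff₀ (by positivity)]
    rw [← Finset.mul_prod_erase _ _ (Finset.mem_univ i)] at hprod
    have : ∏ j ∈ Finset.univ.erase i, μ j ≤ K ^ (n - 1) := by
      refine (Finset.prod_le_prod (fun j _ => h0 j) fun j _ => hle j).trans_eq ?_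
      simp
    nlinarith [hpos i]
  have hspec := hA.isHermitian.spectral_theorem
  rw [Unitary.conjStarAlgAut_apply] at hspec
  set U : Matrix (Fin n) (Fin n) ℂ := (hA.isHermitian.eigenvectorUnitary).1 with hU
  refine ⟨hK, .of_bounds hA.isHermitian fun y => ?_⟩
  have hUU : U * star U = 1 := Unitary.mul_star_self_of_mem hA.isHermitian.eigenvectorUnitary.2
  have hstar : star y ⬝ᵥ (A *ᵥ y) = ((∑ i, μ i * ‖(star U *ᵥ y) i‖ ^ 2 : ℝ) : ℂ) := by
    have e : star y ⬝ᵥ (A *ᵥ y)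
        = star (star U *ᵥ y) ⬝ᵥ (diagonal (RCLike.ofReal ∘ μ) *ᵥ (star U *ᵥ y)) := by
      conv_lhs => rw [hspec]
      rw [Matrix.star_mulVec, ← Matrix.dotProduct_mulVec, Matrix.mulVec_mulVec,
        Matrix.mulVec_mulVec, ← Matrix.star_eq_conjTranspose, star_star, mul_assoc]
    rw [e]
    simp only [dotProduct, Matrix.mulVec_diagonal, Pi.star_apply, Complex.star_def]
    push_cast
    refine Finset.sum_congr rfl fun i _ => ?_
    rw [← Complex.conj_mul']
    simp only [Function.comp_apply, Complex.coe_algebraMap, RCLike.ofReal_eq_complex_ofReal]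
    ring
  have hnsq : nsq (star U *ᵥ y) = nsq y := by
    have h1 := star_dotProduct_self (star U *ᵥ y)
    rw [Matrix.star_mulVec, ← Matrix.dotProduct_mulVec, Matrix.mulVec_mulVec,
      ← Matrix.star_eq_conjTranspose, star_star, hUU, Matrix.one_mulVec,
      star_dotProduct_self] at h1
    exact_mod_cast h1.symm
  refine ⟨_, hstar, ?_, ?_⟩ <;> rw [← hnsq, nsq, Finset.mul_sum]
  · exact Finset.sum_le_sum fun i _ => mul_le_mul_of_nonneg_right (hlow i) (sq_nonneg _)
  · exact Finset.sum_le_sum fun i _ => mul_le_mul_of_nonneg_right (hle i) (sq_nonneg _)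

end hessian

end leviForm

/-! ### Weighted seminorms on domains -/

section boundedDomains

open Matrix
open scoped Kronecker

variable {n : ℕ}

section norms

variable {f : Cn n → ℂ} {u : Cn n → ℝ} {x : Cn n}

/-- The linear functional `T ↦ (T v - i T (i v)) / 2` behind the Wirtinger derivative. -/
def wirtFunctional (v : Cn n) : (Cn n →L[ℝ] ℂ) →L[ℝ] ℂ :=
  (1 / 2 : ℂ) • (ContinuousLinearMap.apply ℝ ℂ v
    - Complex.I • ContinuousLinearMap.apply ℝ ℂ (Complex.I • v))

/-- The linear functional `T ↦ (T v + i T (i v)) / 2` behind the conjugate derivative. -/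
def wirtBarFunctional (v : Cn n) : (Cn n →L[ℝ] ℂ) →L[ℝ] ℂ :=
  (1 / 2 : ℂ) • (ContinuousLinearMap.apply ℝ ℂ v
    + Complex.I • ContinuousLinearMap.apply ℝ ℂ (Complex.I • v))

lemma wirt_eq_comp (v : Cn n) (f : Cn n → ℂ) : wirt v f = wirtFunctional v ∘ fderiv ℝ f := rfl

lemma wirtBar_eq_comp (v : Cn n) (f : Cn n → ℂ) :
    wirtBar v f = wirtBarFunctional v ∘ fderiv ℝ f := rfl

lemma norm_half_mul_le {a b : ℂ} {c : ℝ} (ha : ‖a‖ ≤ c) (hb : ‖b‖ ≤ c) :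
    ‖(1 / 2 : ℂ) * (a - Complex.I * b)‖ ≤ c ∧ ‖(1 / 2 : ℂ) * (a + Complex.I * b)‖ ≤ c := by
  have h1 : ‖Complex.I * b‖ ≤ c := by simpa using hb
  have h2 := norm_sub_le a (Complex.I * b)
  have h3 := norm_add_le a (Complex.I * b)
  constructor <;> rw [norm_mul] <;> norm_num <;> linarith

lemma norm_apply_I_smul_le (T : Cn n →L[ℝ] ℂ) (v : Cn n) :
    ‖T (Complex.I • v)‖ ≤ ‖v‖ * ‖T‖ := by
  have h := T.le_opNorm (Complex.I • v)
  rwa [norm_smul, Complex.norm_I, one_mul, mul_comm] at h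

lemma norm_wirtFunctional_le (v : Cn n) : ‖wirtFunctional v‖ ≤ ‖v‖ :=
  ContinuousLinearMap.opNorm_le_bound _ (norm_nonneg _) fun T =>
    (norm_half_mul_le ((T.le_opNorm v).trans_eq (mul_comm _ _)) (norm_apply_I_smul_le T v)).1

lemma norm_wirtBarFunctional_le (v : Cn n) : ‖wirtBarFunctional v‖ ≤ ‖v‖ :=
  ContinuousLinearMap.opNorm_le_bound _ (norm_nonneg _) fun T =>
    (norm_half_mul_le ((T.le_opNorm v).trans_eq (mul_comm _ _)) (norm_apply_I_smul_le T v)).2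

/-- A Wirtinger derivative along a unit vector is a functional of norm at most 1 applied to the real
derivative; each use trades one real order without loss. -/
lemma norm_iteratedFDeriv_comp_fderiv_le {k : ℕ} (hf : ContDiffAt ℝ (k + 1 : ℕ) f x)
    {Φ : (Cn n →L[ℝ] ℂ) →L[ℝ] ℂ} (hΦ : ‖Φ‖ ≤ 1) :
    ‖iteratedFDeriv ℝ k (Φ ∘ fderiv ℝ f) x‖ ≤ ‖iteratedFDeriv ℝ (k + 1) f x‖ := by
  have h := Φ.norm_iteratedFDeriv_comp_left (n := k)
    (hf.fderiv_right (m := (k : WithTop ℕ∞)) (by norm_cast)) le_rfl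
  rw [norm_iteratedFDeriv_fderiv] at h
  exact h.trans (mul_le_of_le_one_left (norm_nonneg _) hΦ)

lemma norm_frame_one (a : Fin n) : ‖(frame 1 a : Cn n)‖ = 1 := by
  rw [frame_one, EuclideanSpace.norm_single, norm_one]

lemma norm_thirdE_le (hu : ContDiffAt ℝ 3 u x) (α : Fin n × Fin n × Fin n) :
    ‖thirdE (frame 1) u x α‖ ≤ ‖iteratedFDeriv ℝ 3 u x‖ := by
  have hU : ContDiffAt ℝ 3 (fun y => (u y : ℂ)) x := contDiffAt_ofReal hu
  have h1 : ContDiffAt ℝ 2 (wirt (frame 1 α.1) fun y => (u y : ℂ)) x :=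
    contDiffAt_wirt (k := 2) hU _
  have h2 : ContDiffAt ℝ 1 (wirtBar (frame 1 α.2.1) (wirt (frame 1 α.1) fun y => (u y : ℂ))) x :=
    contDiffAt_wirtBar (k := 1) h1 _
  have hw : ∀ a : Fin n, ‖wirtFunctional (frame 1 a)‖ ≤ 1 := fun a =>
    (norm_wirtFunctional_le _).trans_eq (norm_frame_one a)
  have hwb : ∀ a : Fin n, ‖wirtBarFunctional (frame 1 a)‖ ≤ 1 := fun a =>
    (norm_wirtBarFunctional_le _).trans_eq (norm_frame_one a)
  have b1 := norm_iteratedFDeriv_comp_fderiv_le (k := 0) (by exact_mod_cast h2) (hw α.2.2)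
  have b2 := norm_iteratedFDeriv_comp_fderiv_le (k := 1) (by exact_mod_cast h1) (hwb α.2.1)
  have b3 := norm_iteratedFDeriv_comp_fderiv_le (k := 2) (by exact_mod_cast hU) (hw α.1)
  rw [← wirt_eq_comp] at b1 b3
  rw [← wirtBar_eq_comp] at b2
  rw [norm_iteratedFDeriv_zero] at b1
  have b4 : ‖iteratedFDeriv ℝ 3 (fun y => (u y : ℂ)) x‖ = ‖iteratedFDeriv ℝ 3 u x‖ :=
    Complex.ofRealLI.norm_iteratedFDeriv_comp_left hu le_rfl
  exact b1.trans (b2.trans (b3.trans_eq b4))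

/-- There are n³ entries; the resulting exponent 3/2 of n is rounded up to 2. -/
lemma sqrt_nsq_thirdE_le {b : ℝ} (hu : ContDiffAt ℝ 3 u x)
    (hb : ‖iteratedFDeriv ℝ 3 u x‖ ≤ b) : √(nsq (thirdE (frame 1) u x)) ≤ n ^ 2 * b := by
  have hb0 : 0 ≤ b := (norm_nonneg _).trans hb
  refine Real.sqrt_le_iff.mpr ⟨by positivity, ?_⟩
  calc nsq (thirdE (frame 1) u x) ≤ ∑ _α : Fin n × Fin n × Fin n, b ^ 2 :=
        Finset.sum_le_sum fun α _ =>
          pow_le_pow_left₀ (norm_nonneg _) ((norm_thirdE_le hu α).trans hb) 2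
    _ = n ^ 3 * b ^ 2 := by
        simp only [Finset.sum_const, Finset.card_univ, Fintype.card_prod, Fintype.card_fin,
          nsmul_eq_mul]
        push_cast; ring
    _ ≤ n ^ 4 * b ^ 2 := by
        refine mul_le_mul_of_nonneg_right ?_ (sq_nonneg b)
        rcases n.eq_zero_or_pos with h | h
        · simp [h]
        · exact_mod_cast Nat.pow_le_pow_right h (by norm_num)
    _ = (n ^ 2 * b) ^ 2 := by ring

lemma nsq_thirdE_slice_le (e : Fin n → Cn n) (u : Cn n → ℝ) (x : Cn n) (i j : Fin n) :
    nsq (fun k => thirdE e u x (i, j, k)) ≤ nsq (thirdE e u x) := by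
  simp only [nsq, Fintype.sum_prod_type]
  refine le_trans ?_ (Finset.single_le_sum (f := fun i => ∑ j, ∑ k, ‖thirdE e u x (i, j, k)‖ ^ 2)
    (fun _ _ => by positivity) (Finset.mem_univ i))
  exact Finset.single_le_sum (f := fun j => ∑ k, ‖thirdE e u x (i, j, k)‖ ^ 2)
    (fun _ _ => by positivity) (Finset.mem_univ j)

lemma norm_sum_mul_le {ι : Type*} [Fintype ι] (c s : ι → ℂ) :
    ‖∑ k, c k * s k‖ ≤ √(nsq c) * √(nsq s) := by
  have h := norm_star_dotProduct_le (fun k => conj (c k)) s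
  rw [nsq_conj] at h
  simpa [dotProduct] using h

/-- The real derivative is the sum of ∂ and ∂̄. The barred derivatives of u_{i j̄} are conjugates of
u_{j ī k}, so both halves are controlled by the same tensor, giving the factor 2. -/
lemma norm_fderiv_hessE_le (hu : ContDiffAt ℝ 5 u x) (i j : Fin n) :
    ‖fderiv ℝ (fun y => hessE (frame 1) u y i j) x‖ ≤ 2 * √(nsq (thirdE (frame 1) u x)) := by
  refine ContinuousLinearMap.opNorm_le_bound _ (by positivity) fun w => ?_
  have hw : w = frame (Matrix.of fun _ k => w k) i := rfl
  have hn : √(nsq fun k => w k) = ‖w‖ := by rw [nsq_ofLp, Real.sqrt_sq (norm_nonneg _)]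
  have hn' : √(nsq fun k => conj (w k)) = ‖w‖ := by rw [nsq_conj, hn]
  have h1 : ‖wirt w (fun y => hessE (frame 1) u y i j) x‖
      ≤ ‖w‖ * √(nsq (thirdE (frame 1) u x)) := by
    rw [hw, wirt_frame, ← hw]
    refine (norm_sum_mul_le (fun k => w k) _).trans ?_
    rw [hn]
    exact mul_le_mul_of_nonneg_left (Real.sqrt_le_sqrt (nsq_thirdE_slice_le _ u x i j))
      (norm_nonneg _)
  have h2 : ‖wirtBar w (fun y => hessE (frame 1) u y i j) x‖
      ≤ ‖w‖ * √(nsq (thirdE (frame 1) u x)) := by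
    rw [hw, wirtBar_frame, ← hw]
    refine (norm_sum_mul_le (fun k => conj (w k)) _).trans ?_
    rw [hn']
    refine mul_le_mul_of_nonneg_left (Real.sqrt_le_sqrt ?_) (norm_nonneg _)
    refine le_trans (le_of_eq ?_) (nsq_thirdE_slice_le _ u x j i)
    rw [← nsq_conj (fun k => thirdE (frame 1) u x (j, i, k))]
    congr 1
    funext k
    rw [wirtBar_hessE hu]
    rfl
  rw [fderiv_apply_eq_wirt_add]
  refine (norm_add_le _ _).trans ?_
  linarith

end norms

section domain

/-- The ball around `x` of radius the distance to the boundary lies in the domain. -/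
lemma ball_infDist_frontier_subset {Ω : Set (Cn n)} (hΩ : IsOpen Ω) {x : Cn n} (hx : x ∈ Ω) :
    Metric.ball x (Metric.infDist x (frontier Ω)) ⊆ Ω := by
  intro y hy
  have hd : 0 < Metric.infDist x (frontier Ω) := dist_nonneg.trans_lt (Metric.mem_ball.mp hy)
  -- The ball is connected and misses the frontier, hence cannot leave Ω.
  refine IsPreconnected.subset_left_of_subset_union (v := (closure Ω)ᶜ) hΩ
    isClosed_closure.isOpen_compl
    (Set.disjoint_left.mpr fun z hz hz' => hz' (subset_closure hz)) (fun z hz => ?_)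
    ⟨x, Metric.mem_ball_self hd, hx⟩ (convex_ball x _).isPreconnected hy
  by_cases hzc : z ∈ closure Ω
  · left
    by_contra hzΩ
    have hzf : z ∈ frontier Ω := by rw [hΩ.frontier_eq]; exact ⟨hzc, hzΩ⟩
    have := Metric.infDist_le_dist_of_mem (x := x) hzf
    rw [dist_comm] at this
    exact absurd (Metric.mem_ball.mp hz) (not_lt.mpr this)
  · exact Or.inr hzc

lemma norm_le_of_starSeminorm_le {Ω : Set (Cn n)} {F : Type} [NormedAddCommGroup F]
    [NormedSpace ℝ F] {g : Cn n → F} {k : ℕ} {L r : ℝ} (hL : 0 ≤ L) (hr : 0 < r)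
    (h : starSeminorm k Ω g ≤ ENNReal.ofReal L) {y : Cn n} (hy : y ∈ Ω)
    (hry : r ≤ Metric.infDist y (frontier Ω)) :
    ‖iteratedFDeriv ℝ k g y‖ ≤ L * (r ^ k)⁻¹ := by
  have h1 := (le_iSup₂ (f := fun x (_ : x ∈ Ω) =>
    ENNReal.ofReal (Metric.infDist x (frontier Ω) ^ k * ‖iteratedFDeriv ℝ k g x‖)) y hy).trans h
  rw [ENNReal.ofReal_le_ofReal_iff hL] at h1
  rw [← div_eq_mul_inv, le_div_iff₀ (by positivity), mul_comm]
  exact (mul_le_mul_of_nonneg_right (pow_le_pow_left₀ hr.le hry k) (norm_nonneg _)).trans h1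

/-- With M = L and N = bL the factor (1+M)⁻² reduces the N² term to at most b², so only linear
growth in L is left, and the square root of it gives 1 + √L. -/
lemma sqrt_third_order_bound {C b K L lam r S : ℝ} (hC : 0 ≤ C) (hlam : 0 < lam) (hK : lam ≤ K)
    (hL : 0 ≤ L) (hr : 0 < r)
    (hS : S ≤ C * lam⁻¹ * K ^ 3 * (((1 + L) ^ 2)⁻¹ * (b * L) ^ 2 + lam⁻¹ * K * (1 + L))
      * (r ^ 2)⁻¹) :
    r * √S ≤ √(C * (1 + b ^ 2)) * (lam⁻¹ * K ^ 2) * (1 + √L) := by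
  have hK0 : 0 < K := hlam.trans_le hK
  set X := lam⁻¹ * K with hX
  have hX1 : 1 ≤ X := by rw [hX, inv_mul_eq_div, le_div_iff₀ hlam]; linarith
  have hq : ((1 + L) ^ 2)⁻¹ * (b * L) ^ 2 ≤ b ^ 2 * (X * (1 + L)) := by
    have h1 : L ^ 2 / (1 + L) ^ 2 ≤ 1 := by
      rw [div_le_one (by positivity)]; nlinarith
    have h2 : (1 : ℝ) ≤ X * (1 + L) := by nlinarith
    calc ((1 + L) ^ 2)⁻¹ * (b * L) ^ 2 = b ^ 2 * (L ^ 2 / (1 + L) ^ 2) := by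
          rw [div_eq_mul_inv]; ring
      _ ≤ b ^ 2 * (X * (1 + L)) := mul_le_mul_of_nonneg_left (h1.trans h2) (sq_nonneg b)
  have hL2 : 1 + L ≤ (1 + √L) ^ 2 := by nlinarith [Real.sq_sqrt hL, Real.sqrt_nonneg L]
  rw [← Real.sqrt_sq hr.le, ← Real.sqrt_mul (sq_nonneg r)]
  refine Real.sqrt_le_iff.mpr ⟨by positivity, ?_⟩
  rw [mul_pow, mul_pow, Real.sq_sqrt (by positivity)]
  have e1 : lam⁻¹ * K ^ 2 = X * K := by rw [hX]; ring
  calc r ^ 2 * S ≤ r ^ 2 * (C * lam⁻¹ * K ^ 3 *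
        (((1 + L) ^ 2)⁻¹ * (b * L) ^ 2 + X * (1 + L)) * (r ^ 2)⁻¹) :=
        mul_le_mul_of_nonneg_left hS (sq_nonneg r)
    _ = C * X * K ^ 2 * (((1 + L) ^ 2)⁻¹ * (b * L) ^ 2 + X * (1 + L)) := by
        rw [hX]; field_simp
    _ ≤ C * X * K ^ 2 * (b ^ 2 * (X * (1 + L)) + X * (1 + L)) :=
        mul_le_mul_of_nonneg_left (by linarith) (by positivity)
    _ = C * (1 + b ^ 2) * (X * K) ^ 2 * (1 + L) := by ring
    _ ≤ C * (1 + b ^ 2) * (lam⁻¹ * K ^ 2) ^ 2 * (1 + √L) ^ 2 := by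
        rw [e1]; exact mul_le_mul_of_nonneg_left hL2 (by positivity)

/-- The interior third order estimate in scale invariant form on a domain. -/
theorem starSeminorm_mixed_le (hn : 1 ≤ n) {Ω : Set (Cn n)} {m K L : ℝ} {u f : Cn n → ℝ}
    (hΩ : IsOpen Ω) (hm : 0 < m) (hL : 0 ≤ L) (hpsh : PlurisubharmonicOn u Ω)
    (hu : ContDiffOn ℝ 5 u Ω) (hf : ContDiffOn ℝ 3 f Ω) (hmf : ∀ z ∈ Ω, m ≤ f z)
    (hdet : ∀ z ∈ Ω, (complexHessian u z).det = ((f z : ℝ) : ℂ))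
    (hK : ∀ z ∈ Ω, complexLaplacian u z ≤ K)
    (h2 : starSeminorm 2 Ω (fun z => Real.log (f z)) ≤ ENNReal.ofReal L)
    (h3 : starSeminorm 3 Ω (fun z => Real.log (f z)) ≤ ENNReal.ofReal L) (i j : Fin n) :
    starSeminorm 1 Ω (mixed u i j) ≤ ENNReal.ofReal
      (4 * √((256 / 25 * (1 + 2 * ((13 + 2 * n) * n))) * (1 + ((n : ℝ) ^ 2) ^ 2))
        * K ^ (n + 1) * m⁻¹ * (1 + √L)) := by
  refine iSup₂_le fun x hx => ENNReal.ofReal_le_ofReal ?_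
  have hH : ∀ z ∈ Ω, 0 < K ∧ MatrixBetween (m / K ^ (n - 1)) K (complexHessian u z) :=
    fun z hz => by
      have hp := hpsh.hessE_posSemidef i hΩ (hu.of_le (by norm_num)) hz
      rw [← complexHessian_eq_hessE] at hp
      exact matrixBetween_of_trace_det hn hp hm (hmf z hz) (hdet z hz) (hK z hz)
  have hK0 : 0 < K := (hH x hx).1
  -- A zero distance covers the default value of `infDist` for an empty frontier; the weight then
  -- kills the left side.
  rcases (Metric.infDist_nonneg (x := x) (s := frontier Ω)).eq_or_lt with hd | hd
  · rw [← hd, pow_one, zero_mul]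
    positivity
  -- Half the distance, so that every point of the ball is still at distance at least r from the
  -- frontier and the weights convert to powers of r.
  set r := Metric.infDist x (frontier Ω) / 2 with hr
  have hr0 : 0 < r := by positivity
  have hball : Metric.ball x r ⊆ Ω :=
    (Metric.ball_subset_ball (by linarith)).trans (ball_infDist_frontier_subset hΩ hx)
  have hdist : ∀ y ∈ Metric.ball x r, r ≤ Metric.infDist y (frontier Ω) := fun y hy => by
    have := Metric.infDist_le_infDist_add_dist (x := x) (y := y) (s := frontier Ω)
    rw [dist_comm] at this
    have hy' := Metric.mem_ball.mp hy
    linarith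
  have hφ : ContDiffOn ℝ 3 (fun z => Real.log (f z)) Ω :=
    hf.log fun z hz => (hm.trans_le (hmf z hz)).ne'
  have hφ' : ∀ y ∈ Metric.ball x r, ContDiffAt ℝ 3 (fun z => Real.log (f z)) y := fun y hy =>
    hφ.contDiffAt (hΩ.mem_nhds (hball hy))
  have hlam : 0 < m / K ^ (n - 1) := by positivity
  have est := interior_estimate (φ := fun z => Real.log (f z)) (M := L) (N := n ^ 2 * L) hn hr0
    hlam (hu.mono hball) (hφ.mono hball)
    (fun z hz => by
      rw [hdet z (hball hz), Real.exp_log (hm.trans_le (hmf z (hball hz)))])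
    (fun z hz => (hH z (hball hz)).2)
    (fun z hz => by
      rw [complexHessian_eq_hessE]
      exact hessE_matrixBetween i ((hφ' z hz).of_le (by norm_num))
        (norm_le_of_starSeminorm_le hL hr0 h2 (hball hz) (hdist z hz)))
    (fun z hz => by
      rw [sum_mixed3_eq_nsq, mul_assoc]
      exact sqrt_nsq_thirdE_le (hφ' z hz)
        (norm_le_of_starSeminorm_le hL hr0 h3 (hball hz) (hdist z hz)))
    (Metric.mem_ball_self (half_pos hr0))
  rw [sum_mixed3_eq_nsq] at est
  have hb := sqrt_third_order_bound (by positivity) hlam ((hH x hx).2.le hn) hL hr0 est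
  have hgrad := norm_fderiv_hessE_le (hu.contDiffAt (hΩ.mem_nhds hx)) i j
  rw [norm_iteratedFDeriv_one, mixed_eq_hessE, pow_one]
  have hKm : (m / K ^ (n - 1))⁻¹ * K ^ 2 = K ^ (n + 1) * m⁻¹ := by
    obtain ⟨k, rfl⟩ := Nat.exists_eq_add_of_le' hn
    rw [Nat.add_sub_cancel, inv_div]
    ring
  rw [hKm] at hb
  have hdr : Metric.infDist x (frontier Ω) = 2 * r := by rw [hr]; ring
  calc Metric.infDist x (frontier Ω) * _ ≤ 2 * r * (2 * √(nsq (thirdE (frame 1) u x))) := by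
        rw [hdr]; exact mul_le_mul_of_nonneg_left hgrad (by positivity)
    _ = 4 * (r * √(nsq (thirdE (frame 1) u x))) := by ring
    _ ≤ 4 * _ := mul_le_mul_of_nonneg_left hb (by norm_num)
    _ = _ := by ring

end domain

end boundedDomains

end ComplexMA

end

/-! ### Assembly with explicit constants -/

theorem theorem6p1 (n : ℕ) (hn : 1 ≤ n) :
    (∃ C : ℝ, 0 < C ∧
      ∀ (r lam Lam M N : ℝ) (u φ : ComplexMA.Cn n → ℝ), 0 < r → 0 < lam →
        ComplexMA.PlurisubharmonicOn u (Metric.ball 0 r) →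
        ContDiffOn ℝ 5 u (Metric.ball 0 r) →
        ContDiffOn ℝ 3 φ (Metric.ball 0 r) →
        (∀ z ∈ Metric.ball (0 : ComplexMA.Cn n) r,
          (ComplexMA.complexHessian u z).det = ((Real.exp (φ z) : ℝ) : ℂ)) →
        (∀ z ∈ Metric.ball (0 : ComplexMA.Cn n) r,
          ComplexMA.MatrixBetween lam Lam (ComplexMA.complexHessian u z)) →
        (∀ z ∈ Metric.ball (0 : ComplexMA.Cn n) r,
          ComplexMA.MatrixBetween (-(M * (r ^ 2)⁻¹)) (M * (r ^ 2)⁻¹)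
            (ComplexMA.complexHessian φ z)) →
        (∀ z ∈ Metric.ball (0 : ComplexMA.Cn n) r,
          √(∑ i, ∑ j, ∑ k, ‖ComplexMA.mixed3 φ i j k z‖ ^ 2) ≤ N * (r ^ 3)⁻¹) →
        ∀ z ∈ Metric.ball (0 : ComplexMA.Cn n) (r / 2),
          ∑ i, ∑ j, ∑ k, ‖ComplexMA.mixed3 u i j k z‖ ^ 2 ≤
            C * lam⁻¹ * Lam ^ 3 *
              (((1 + M) ^ 2)⁻¹ * N ^ 2 + lam⁻¹ * Lam * (1 + M)) * (r ^ 2)⁻¹) ∧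
    (∃ C : ℝ, 0 < C ∧
      ∀ (Ω : Set (ComplexMA.Cn n)) (m K L : ℝ) (u f : ComplexMA.Cn n → ℝ),
        IsOpen Ω → IsConnected Ω → Bornology.IsBounded Ω → 0 < m → 0 ≤ L →
        ComplexMA.PlurisubharmonicOn u Ω →
        ContDiffOn ℝ 5 u Ω →
        ContDiffOn ℝ 3 f Ω →
        (∀ z ∈ Ω, m ≤ f z) →
        (∀ z ∈ Ω, (ComplexMA.complexHessian u z).det = ((f z : ℝ) : ℂ)) →
        (∀ z ∈ Ω, ComplexMA.complexLaplacian u z ≤ K) →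
        ComplexMA.starSeminorm 2 Ω (fun z => Real.log (f z)) +
          ComplexMA.starSeminorm 3 Ω (fun z => Real.log (f z)) ≤ ENNReal.ofReal L →
        ∀ i j : Fin n, ComplexMA.starSeminorm 1 Ω (ComplexMA.mixed u i j) ≤
          ENNReal.ofReal (C * K ^ (n + 1) * m⁻¹ * (1 + √L))) := by
  refine ⟨⟨256 / 25 * (1 + 2 * ((13 + 2 * n) * n)), by positivity, ?_⟩,
    ⟨4 * √((256 / 25 * (1 + 2 * ((13 + 2 * n) * n))) * (1 + ((n : ℝ) ^ 2) ^ 2)),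
      by positivity, ?_⟩⟩
  · intro r lam Lam M N u φ hr hlam _ hu hφ hdet hg hΦ hN z hz
    exact ComplexMA.interior_estimate hn hr hlam hu hφ hdet hg hΦ hN hz
  · intro Ω m K L u f hΩ _ _ hm hL hpsh hu hf hmf hdet hK hsum i j
    exact ComplexMA.starSeminorm_mixed_le hn hΩ hm hL hpsh hu hf hmf hdet hK
      (le_self_add.trans hsum) (le_add_self.trans hsum) i j
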